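/- **Dynamics.** Let $(\sigma_t)_{t\ge 0}$ be the zero-temperature Glauber dynamics on $\{-1,+1\}^{\mathbb Z^2}$, i.e. the Markov process with generator $Lg(\sigma)=\sum_{x}c(x,\sigma)\,(g(\sigma^x)-g(\sigma))$ on local functions $g$. Here $\sigma^x$ is $\sigma$ with the spin at $x$ reversed, and $c(x,\sigma)=1,\ \tfrac12,\ 0$ according to whether $x$ has more than two, exactly two, or fewer than two nearest neighbours with spin opposite to $\sigma(x)$. **Discretization.** For $N\ge1$ and $x=(x_1,x_2)\in\mathbb Z^2$ put $\Lambda_{x/N}=\prod_{i=1,2}\left[\frac{x_i}{N}-\frac1{2N},\frac{x_i}{N}+\frac1{2N}\right)$. Put $\mathcal A_N^\sigma=\bigcup_{\sigma(x)=+1}\Lambda_{x/N}$, and for bounded $\mathcal S\subset\mathbb R^2$ let $\mathcal S_N$ be the union of the boxes $\Lambda_{x/N}$ that meet $\mathcal S$. **Averaged drift.** Let $\gamma=\partial D$ be a Jordan curve of class $C^2$ (regular, oriented counterclockwise) enclosing the connected compact set $D$, and let $s\in\gamma$. For $r>0$ small, the circle $\partial B(s,r)$ meets $\gamma$ in exactly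 two points $x_0,x_1$, named so that $x_0,s,x_1$ are in counterclockwise order. With closed balls, set $\mathcal S=\mathcal S(\alpha_1,\alpha_2)=B(s,r)\cup B(x_0,\alpha_1)\cup B(x_1,\alpha_2)$ and $$L_N^{\sigma}(\alpha_1,\alpha_2)=\lim_{t\downarrow0}\frac1t\Big(\mathbb E_\sigma\big[\mathrm{vol}(\mathcal A_N^{\sigma_{tN^2}}\cap\mathcal S_N)\big]-\mathrm{vol}(\mathcal A_N^{\sigma}\cap\mathcal S_N)\Big),\qquad \mathbf A_N^{\sigma}(s,r,\delta)=\frac1{\delta^2}\int_0^\delta\!\!\int_0^\delta L_N^\sigma(\alpha_1,\alpha_2)\,d\alpha_1d\alpha_2 .$$ **Spohn's initial condition.** Suppose that in a neighbourhood $V$ of $s$ the curve $\gamma$ is the graph of a monotone differentiable function $f$ defined on a segment $[a,b]$. For each $N\ge 1$ let $\sigma$ be a random configuration and $\Phi_N:[a,b]\cap\frac{\mathbb Z}{N}\to\frac1N(\mathbb Z+\frac12)$ a random height function, with joint law $\mu_N$, such that: 1. Almost surely the boundary of the droplet in $V$ is the staircase with heights $\Phi_N$, with the droplet on the same side as $D$.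 That is, if $D$ is locally below the graph of $f$ at $s$, then for all $(u,v)\in V\cap\frac{\mathbb Z^2}{N}$ with $u\in[a,b]$ the spin at $N(u,v)$ is $+1$ if and only if $v<\Phi_N(u)$; if $D$ is locally above, it is $+1$ if and only if $v>\Phi_N(u)$. 2. The increments $\Phi_N(\frac{k+1}N)-\Phi_N(\frac kN)$, for $\frac kN,\frac{k+1}N\in[a,b]$, are independent. With $q=|f'(\frac kN)|$, the increment equals $\frac lN$ (if $f$ is nondecreasing), respectively $-\frac lN$ (if $f$ is nonincreasing), with probability $q^l(1+q)^{-l-1}$ for every integer $l\ge0$. 3. There are points $a_N\in\frac{\mathbb Z}{N}$, with $a_N\in[a,b]$ and $|a-a_N|\le\frac1N$ for all large $N$, such that $\Phi_N(a_N)$ is independent of the family of increments to the right of $a_N$, and $\mu_N(|\Phi_N(a_N)-f(a)|\ge\varepsilon)\to0$ as $N\to\infty$ for every $\varepsilon>0$. **Conclusion.** The quantities above are well defined, and $$\lim_{r\to0}\lim_{\delta\to0}\liminf_{N\to\infty}\frac1{2r}\,\mu_N\big(\mathbf A_N^{\sigma}(s,r,\delta)\big)=\lim_{r\to0}\lim_{\delta\to0}\limsup_{N\to\infty}\frac1{2r}\,\mu_N\big(\mathbf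 A_N^{\sigma}(s,r,\delta)\big)=-\frac{\xi_\gamma(s)}{2(|\cos\theta|+|\sin\theta|)^2},$$ where $\mu_N(\cdot)$ denotes expectation, $\xi_\gamma(s)=\frac{x'y''-x''y'}{(x'^2+y'^2)^{3/2}}$ is the signed curvature of $\gamma$ at $s$ for a counterclockwise parametrization $(x,y)$, and $\theta$ is the angle between the horizontal axis and the tangent to $\gamma$ at $s$. -/

import Mathlib

open Set Filter Topology MeasureTheory ProbabilityTheory
open scoped NNReal

noncomputable section

/-! ### The zero-temperature Glauber dynamics on `ℤ²` -/

/-- Spin configurations on `ℤ²`; `true` is the spin `+1` and `false` is the spin `-1`. -/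
abbrev Config : Type := ℤ × ℤ → Bool

/-- The four nearest neighbours of a site. -/
def neighbours (x : ℤ × ℤ) : Finset (ℤ × ℤ) :=
  {(x.1 + 1, x.2), (x.1 - 1, x.2), (x.1, x.2 + 1), (x.1, x.2 - 1)}

/-- The number of neighbours of `x` whose spin is opposite to the spin at `x`. -/
def numOpposite (η : Config) (x : ℤ × ℤ) : ℕ :=
  ((neighbours x).filter fun y => η y ≠ η x).card

/-- The flip rate of the site `x`: `1` for more than two opposite neighbours, `1/2` for
exactly two, and `0` otherwise. -/
def flipRate (x : ℤ × ℤ) (η : Config) : ℝ :=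
  if 2 < numOpposite η x then 1 else if numOpposite η x = 2 then 1 / 2 else 0

/-- The configuration with the spin at `x` reversed. -/
def flipAt (η : Config) (x : ℤ × ℤ) : Config := Function.update η x (!η x)

/-- A local function depends on finitely many spins only. -/
def IsLocal (g : Config → ℝ) : Prop :=
  ∃ F : Finset (ℤ × ℤ), DependsOn g (F : Set (ℤ × ℤ))

/-- The generator (a finite sum when `g` is local). -/
def generator (g : Config → ℝ) (η : Config) : ℝ :=
  ∑ᶠ x : ℤ × ℤ, flipRate x η * (g (flipAt η x) - g η)

/-- The process with the above generator, through its martingale problem: under `Q η` the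
right-continuous process `X` with left limits starts at `η`, and
`g (X t) - g (X 0) - ∫₀ᵗ (generator g) (X u) du` is a martingale for every local `g`. -/
structure IsGlauberProcess {Ω' : Type*} [mΩ' : MeasurableSpace Ω'] (Q : Config → Measure Ω')
    (ℱ : Filtration ℝ≥0 mΩ') (X : ℝ≥0 → Ω' → Config) : Prop where
  isProbabilityMeasure : ∀ η, IsProbabilityMeasure (Q η)
  adapted : ∀ t, Measurable[ℱ t] (X t)
  rightContinuous : ∀ w t, ContinuousWithinAt (fun u => X u w) (Ici t) t
  leftLimits : ∀ w t, ∃ l, Tendsto (fun u => X u w) (𝓝[<] t) (𝓝 l)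
  initial : ∀ η, ∀ᵐ w ∂(Q η), X 0 w = η
  martingale : ∀ η, ∀ g : Config → ℝ, IsLocal g →
    Martingale (fun (t : ℝ≥0) w =>
      g (X t w) - g (X 0 w) - ∫ u in (0 : ℝ)..t, generator g (X u.toNNReal w)) ℱ (Q η)

/-! ### Droplets and discretization; the plane `ℝ²` is identified with `ℂ` -/

/-- The half-open box of side `1/N` centred at `x/N`. -/
def box (N : ℕ) (x : ℤ × ℤ) : Set ℂ :=
  {u | -(1 / (2 * (N : ℝ))) ≤ u.re - x.1 / N ∧ u.re - x.1 / N < 1 / (2 * (N : ℝ)) ∧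
       -(1 / (2 * (N : ℝ))) ≤ u.im - x.2 / N ∧ u.im - x.2 / N < 1 / (2 * (N : ℝ))}

/-- The union of the boxes that meet `S`. -/
def discretize (N : ℕ) (S : Set ℂ) : Set ℂ :=
  ⋃ x ∈ {x : ℤ × ℤ | (box N x ∩ S).Nonempty}, box N x

/-- The droplet of a configuration: the union of the boxes of the plus sites. -/
def droplet (N : ℕ) (η : Config) : Set ℂ :=
  ⋃ x ∈ {x : ℤ × ℤ | η x = true}, box N x

/-- The union of three closed balls in which the volume is observed. -/
def region (s : ℂ) (r : ℝ) (x₀ x₁ : ℂ) (α₁ α₂ : ℝ) : Set ℂ :=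
  Metric.closedBall s r ∪ Metric.closedBall x₀ α₁ ∪ Metric.closedBall x₁ α₂

section Drift

variable {Ω' : Type*} [MeasurableSpace Ω']

/-- The mean volume variation in the discretization of `S` per unit of (rescaled) time,
for the process started at `η` and speeded up by `N²`. -/
def driftQuotient (Q : Config → Measure Ω') (X : ℝ≥0 → Ω' → Config) (N : ℕ) (η : Config)
    (S : Set ℂ) (t : ℝ) : ℝ :=
  1 / t * ((∫ w, volume.real (droplet N (X (t * (N : ℝ) ^ 2).toNNReal w) ∩ discretize N S) ∂(Q η))
    - volume.real (droplet N η ∩ discretize N S))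

/-- The initial drift of the volume: the limit of the quotient as time decreases to `0`. -/
def drift (Q : Config → Measure Ω') (X : ℝ≥0 → Ω' → Config) (N : ℕ) (η : Config)
    (S : Set ℂ) : ℝ :=
  limUnder (𝓝[>] 0) (driftQuotient Q X N η S)

/-- The average of the drift over the two radii `α₁, α₂ ∈ [0, δ]`. -/
def avgDrift (Q : Config → Measure Ω') (X : ℝ≥0 → Ω' → Config) (N : ℕ) (η : Config)
    (s : ℂ) (r : ℝ) (x₀ x₁ : ℂ) (δ : ℝ) : ℝ :=
  1 / δ ^ 2 * ∫ α₁ in (0 : ℝ)..δ, ∫ α₂ in (0 : ℝ)..δ, drift Q X N η (region s r x₀ x₁ α₁ α₂)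

end Drift

/-! ### Jordan curves of class `C²` -/

/-- `φ` is a regular `1`-periodic counterclockwise parametrization, of class `C²`, of a Jordan
curve that encloses the connected compact set `D`. Counterclockwise means that `D` lies on the
left of the curve. -/
structure IsC2JordanCurve (φ : ℝ → ℂ) (D : Set ℂ) : Prop where
  contDiff : ContDiff ℝ 2 φ
  periodic : Function.Periodic φ 1
  injOn : InjOn φ (Ico 0 1)
  regular : ∀ t, deriv φ t ≠ 0
  isCompact : IsCompact D
  isConnected : IsConnected D
  frontier_eq : frontier D = range φ
  counterclockwise : ∀ t, ∀ᶠ ε : ℝ in 𝓝[>] 0, φ t + ε * (Complex.I * deriv φ t) ∈ D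

/-- The signed curvature `(x' y'' - x'' y') / (x'² + y'²)^(3/2)`. -/
def curvature (φ : ℝ → ℂ) (t : ℝ) : ℝ :=
  ((deriv φ t).re * (deriv (deriv φ) t).im - (deriv (deriv φ) t).re * (deriv φ t).im) /
    ‖deriv φ t‖ ^ 3

/-- The circle of centre `s = φ t` and radius `r` meets the curve in exactly the two points
`x₀` and `x₁`, and `x₀, s, x₁` are arranged counterclockwise. -/
def IsCrossingPair (φ : ℝ → ℂ) (t r : ℝ) (x₀ x₁ : ℂ) : Prop :=
  Metric.sphere (φ t) r ∩ range φ = {x₀, x₁} ∧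
    ∃ t₀ t₁ : ℝ, t₀ < t ∧ t < t₁ ∧ t₁ < t₀ + 1 ∧ φ t₀ = x₀ ∧ φ t₁ = x₁

/-! ### Spohn's initial condition -/

/-- The geometric law `q ^ l * (1 + q) ^ (-l - 1)`, `l ≥ 0`, on `ℤ`. -/
def geometricWeight (q : ℝ) (l : ℤ) : ℝ :=
  if 0 ≤ l then q ^ l.toNat / (1 + q) ^ (l.toNat + 1) else 0

/-- The height over `k/N` of the boundary that separates the site `(k, h k)` from the site
`(k, h k + 1)` above it. -/
def height (N : ℕ) (h : ℤ → ℤ) (k : ℤ) : ℝ := ((h k : ℝ) + 1 / 2) / N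

/-- Spohn's initial condition near the point `s` of the curve `γ = ∂D`. In the neighbourhood `V`
of `s` the curve is the graph of the monotone differentiable function `f` on `[a, b]`. For `N ≥ 1`
the random configuration `σ N`, under the probability measure `P N`, has in `V` a boundary with
height function `height N (h N ω)` and the plus spins on the same side as `D`. The height
increments are independent geometric variables with parameter `|f'|`, and the height over the
reference point `m N / N` is independent of the increments to the right of it. -/
structure SpohnInitialCondition {Ω : Type*} [MeasurableSpace Ω] (γ D : Set ℂ) (s : ℂ)
    (V : Set ℂ) (a b : ℝ) (f : ℝ → ℝ) (m : ℕ → ℤ)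
    (P : ℕ → Measure Ω) (σ : ℕ → Ω → Config) (h : ℕ → Ω → ℤ → ℤ) : Prop where
  mem_nhds : V ∈ 𝓝 s
  graph : γ ∩ V = {z : ℂ | z.re ∈ Icc a b ∧ z.im = f z.re}
  monotone : MonotoneOn f (Icc a b) ∨ AntitoneOn f (Icc a b)
  differentiable : DifferentiableOn ℝ f (Icc a b)
  measurable_config : ∀ N : ℕ, Measurable (σ N)
  measurable_height : ∀ N k, Measurable fun ω => h N ω k
  /-- either `D` is below the graph and the plus sites are those below the height function,
  or `D` is above the graph and the plus sites are those above the height function -/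
  side :
    ((∀ᶠ z in 𝓝 s, z ∈ D ↔ z.im ≤ f z.re) ∧
      ∀ N : ℕ, 1 ≤ N → ∀ᵐ ω ∂(P N), ∀ k j : ℤ, (k : ℝ) / N ∈ Icc a b →
        (⟨(k : ℝ) / N, (j : ℝ) / N⟩ : ℂ) ∈ V → (σ N ω (k, j) = true ↔ j ≤ h N ω k)) ∨
    ((∀ᶠ z in 𝓝 s, z ∈ D ↔ f z.re ≤ z.im) ∧
      ∀ N : ℕ, 1 ≤ N → ∀ᵐ ω ∂(P N), ∀ k j : ℤ, (k : ℝ) / N ∈ Icc a b →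
        (⟨(k : ℝ) / N, (j : ℝ) / N⟩ : ℂ) ∈ V → (σ N ω (k, j) = true ↔ h N ω k < j))
  law_of_monotone : MonotoneOn f (Icc a b) → ∀ N : ℕ, 1 ≤ N → ∀ k : ℤ,
    (k : ℝ) / N ∈ Icc a b → ((k + 1 : ℤ) : ℝ) / N ∈ Icc a b → ∀ l : ℤ,
      (P N).real {ω | h N ω (k + 1) - h N ω k = l} =
        geometricWeight |derivWithin f (Icc a b) ((k : ℝ) / N)| l
  law_of_antitone : AntitoneOn f (Icc a b) → ∀ N : ℕ, 1 ≤ N → ∀ k : ℤ,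
    (k : ℝ) / N ∈ Icc a b → ((k + 1 : ℤ) : ℝ) / N ∈ Icc a b → ∀ l : ℤ,
      (P N).real {ω | h N ω (k + 1) - h N ω k = l} =
        geometricWeight |derivWithin f (Icc a b) ((k : ℝ) / N)| (-l)
  indep_increments : ∀ N : ℕ, 1 ≤ N →
    iIndepFun (fun (k : {k : ℤ // (k : ℝ) / N ∈ Icc a b ∧ ((k + 1 : ℤ) : ℝ) / N ∈ Icc a b})
      (ω : Ω) => h N ω (k + 1) - h N ω k) (P N)
  indep_reference : ∀ N : ℕ, 1 ≤ N →
    IndepFun (fun ω => h N ω (m N))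
      (fun (ω : Ω) (k : {k : ℤ // m N ≤ k ∧ (k : ℝ) / N ∈ Icc a b ∧
        ((k + 1 : ℤ) : ℝ) / N ∈ Icc a b}) => h N ω (k + 1) - h N ω k) (P N)

end

noncomputable section

/-! ### Local functions -/

/-! For small times only the generator matters. By the martingale problem the initial drift of the
volume is the generator applied to the volume, and the time factor `N²` cancels the area `1/N²` of a
box. So the averaged drift is a finite sum `∑ x, A x * siteDrift σ x`, where the weight `A x ∈ [0,
1]` is the proportion of radii for which the box of `x` meets the region
(`IsGlauberProcess.avgDrift_eq`).

On a monotone staircase with the plus spins below, only corners flip, at rate `1/2`. A step from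
column `k` to column `k + 1` of a nondecreasing staircase contributes `(A (k, h k + 1) - A (k + 1, h
(k + 1))) / 2`: one corner can be filled, the other can be removed. The event that the increment is
positive has probability `q/(1+q)`, and given this event the increment minus one is again geometric
and independent of `h k`. The mean of the contribution is therefore `q k/(1 + q k) * (g k - g (k +
1)) / 2` with `g k` the mean of `A (k, h k + 1)`. This exact identity, followed by summation by
parts, is `IsGeometricWalk.integral_sum_siteDrift`; it leaves the differences of `q/(1+q)` weighted
by `g`. Nonincreasing staircases change the sign `e`, and a droplet above its boundary is reduced to
one below by reversing all spins.

By Chebyshev's inequality and a Riemann sum, the heights follow `f` in probability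
(`eventually_height_close`). Hence `g k` is close to `1` when `k/N` lies between the abscissas `uL <
uR` of the crossing points and close to `0` outside, apart from `O(Nδ)` columns near the crossings.
The differences telescope, so the mean drift is `e/2 * (W uR - W uL)` up to `O(δ)`, with `W =
|f'|/(1 + |f'|)` (`eventually_abs_integral_sub_le`).

As `r → 0`, `uR - uL` is asymptotic to `2r/√(1 + f'²)`, so division by `2r` gives `e/2 * W'/√(1 +
f'²)`. The `C²` curve provides the derivative of `f'`, as `(x'y'' - x''y')/x'³`
(`IsC2JordanCurve.derivWithin_regular`). The counterclockwise orientation determines the sign of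
`x'` from the side of `D`, and all signs combine into the curvature formula in `curvature_limit_eq`.
-/

theorem DependsOn.isLocallyConstant {G : Config → ℝ} {F : Finset (ℤ × ℤ)}
    (hG : DependsOn G (F : Set (ℤ × ℤ))) : IsLocallyConstant G := by
  rw [IsLocallyConstant.iff_eventually_eq]
  intro η
  have : ∀ᶠ η' in 𝓝 η, ∀ x ∈ F, η' x = η x := by
    rw [F.eventually_all]
    intro x _
    have : Tendsto (fun η' : Config => η' x) (𝓝 η) (𝓝 (η x)) := (continuous_apply x).tendsto η
    rw [nhds_discrete Bool, tendsto_pure] at this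
    exact this
  filter_upwards [this] with η' h'
  exact hG fun x hx => h' x hx

theorem IsLocal.isLocallyConstant {G : Config → ℝ} (hG : IsLocal G) : IsLocallyConstant G :=
  hG.choose_spec.isLocallyConstant

theorem IsLocal.measurable {G : Config → ℝ} (hG : IsLocal G) : Measurable G :=
  hG.isLocallyConstant.continuous.measurable

/-- The configuration space is compact as a product of finite spaces, so continuity suffices. -/
theorem IsLocal.exists_abs_le {G : Config → ℝ} (hG : IsLocal G) : ∃ C, ∀ η, |G η| ≤ C := by
  obtain ⟨C, hC⟩ := (isCompact_univ (X := Config)).exists_bound_of_continuousOn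
    hG.isLocallyConstant.continuous.continuousOn
  exact ⟨C, fun η => hC η (mem_univ η)⟩

theorem IsLocal.const_mul {G : Config → ℝ} (hG : IsLocal G) (c : ℝ) :
    IsLocal fun η => c * G η := by
  obtain ⟨F, hF⟩ := hG
  exact ⟨F, fun η η' h => by simp only [hF h]⟩

theorem isLocal_sum {ι : Type*} (F : Finset ι) {G : ι → Config → ℝ}
    (hG : ∀ i ∈ F, IsLocal (G i)) : IsLocal fun η => ∑ i ∈ F, G i η := by
  classical
  choose! K hK using hG
  refine ⟨F.biUnion K, fun η η' h => Finset.sum_congr rfl fun i hi => hK i hi fun x hx => h x ?_⟩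
  simp only [Finset.coe_biUnion, mem_iUnion]
  exact ⟨i, hi, hx⟩

/-! ### The drift of one site and the count of plus spins -/

/-- `-1` at a plus site and `1` at a minus site: the effect of a flip on the number of pluses. -/
def flipSign (η : Config) (x : ℤ × ℤ) : ℝ := if η x then -1 else 1

/-- The mean effect of the site `x` on the number of pluses per unit of time. -/
def siteDrift (η : Config) (x : ℤ × ℤ) : ℝ := flipRate x η * flipSign η x

theorem numOpposite_congr {η η' : Config} {x : ℤ × ℤ} (hx : η x = η' x)
    (h : ∀ y ∈ neighbours x, η y = η' y) : numOpposite η x = numOpposite η' x := by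
  unfold numOpposite
  congr 1
  refine Finset.filter_congr fun y hy => ?_
  rw [hx, h y hy]

theorem siteDrift_congr {η η' : Config} {x : ℤ × ℤ} (hx : η x = η' x)
    (h : ∀ y ∈ neighbours x, η y = η' y) : siteDrift η x = siteDrift η' x := by
  unfold siteDrift flipRate flipSign
  rw [numOpposite_congr hx h, hx]

theorem isLocal_siteDrift (x : ℤ × ℤ) : IsLocal fun η => siteDrift η x := by
  refine ⟨insert x (neighbours x), fun η η' h => siteDrift_congr (h x (by simp)) fun y hy => h y ?_⟩
  simp only [Finset.coe_insert, mem_insert_iff, Finset.mem_coe]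
  exact Or.inr hy

theorem abs_siteDrift_le (η : Config) (x : ℤ × ℤ) : |siteDrift η x| ≤ 1 := by
  unfold siteDrift flipRate flipSign
  split_ifs <;> norm_num [abs_le]

/-- The number of pluses in a finite set of sites. -/
def plusCount (F : Finset (ℤ × ℤ)) (η : Config) : ℝ := ∑ x ∈ F, if η x then 1 else 0

theorem isLocal_plusCount (F : Finset (ℤ × ℤ)) : IsLocal (plusCount F) := by
  refine isLocal_sum F fun x _ => ⟨{x}, fun η η' h => ?_⟩
  simp only
  rw [h x (by simp)]

/-- Flipping a site of `F` changes the count by `flipSign`, and flipping any other site leaves it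
unchanged. The result is again a local function, as `tendsto_quotient` requires. -/
theorem generator_smul_plusCount (F : Finset (ℤ × ℤ)) (c : ℝ) (η : Config) :
    generator (fun η => c * plusCount F η) η = c * ∑ x ∈ F, siteDrift η x := by
  have key : ∀ x, flipRate x η * (c * plusCount F (flipAt η x) - c * plusCount F η) =
      if x ∈ F then c * siteDrift η x else 0 := by
    intro x
    have h1 : plusCount F (flipAt η x) - plusCount F η = if x ∈ F then flipSign η x else 0 := by
      unfold plusCount
      rw [← Finset.sum_sub_distrib]
      have : ∀ y ∈ F, ((if flipAt η x y then (1 : ℝ) else 0) - if η y then 1 else 0) =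
          if y = x then flipSign η x else 0 := by
        intro y _
        by_cases hy : y = x
        · subst hy
          simp only [flipAt, Function.update_self, flipSign, if_true]
          cases η y <;> simp
        · simp [flipAt, hy]
      rw [Finset.sum_congr rfl this, Finset.sum_ite_eq']
    rw [← mul_sub, h1]
    split_ifs
    · unfold siteDrift; ring
    · simp
  unfold generator
  simp_rw [key]
  rw [finsum_eq_sum_of_support_subset (s := F), Finset.mul_sum]
  · exact Finset.sum_congr rfl fun x hx => by simp [hx]
  · intro x hx
    by_contra h
    simp only [Finset.mem_coe] at h
    simp [h] at hx

/-! ### The initial drift of a local function -/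

/-- The martingale property turns the increment of the mean into the mean of the time integral of
`generator g`. This integrand is bounded and, by right-continuity, constant for a short time along
almost every path; dominated convergence concludes. -/
theorem IsGlauberProcess.tendsto_quotient {Ω' : Type*} [mΩ' : MeasurableSpace Ω']
    {Q : Config → Measure Ω'} {ℱ : Filtration ℝ≥0 mΩ'} {X : ℝ≥0 → Ω' → Config}
    (hX : IsGlauberProcess Q ℱ X) {g : Config → ℝ} (hg : IsLocal g)
    (hG : IsLocal (generator g)) (η : Config) :
    Tendsto (fun T : ℝ => 1 / T * ((∫ w, g (X T.toNNReal w) ∂(Q η)) - g η)) (𝓝[>] 0)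
      (𝓝 (generator g η)) := by
  have := hX.isProbabilityMeasure η
  obtain ⟨C, hC⟩ := hG.exists_abs_le
  obtain ⟨C', hC'⟩ := hg.exists_abs_le
  have hmeas : ∀ t, Measurable (X t) := fun t => (hX.adapted t).mono (ℱ.le t) le_rfl
  have hgint : ∀ t, Integrable (fun w => g (X t w)) (Q η) := fun t =>
    Integrable.of_bound (hg.measurable.comp (hmeas t)).aestronglyMeasurable C'
      (Eventually.of_forall fun w => hC' _)
  set I : ℝ → Ω' → ℝ := fun T w => ∫ u in (0 : ℝ)..T, generator g (X u.toNNReal w) with hI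
  have hM := hX.martingale η g hg
  -- The time integral is a combination of integrable variables, one of them the martingale itself,
  -- so no joint measurability of the process in time and path is needed.
  have hIint : ∀ T : ℝ, 0 ≤ T → Integrable (I T) (Q η) := by
    intro T hT
    have h1 := ((hgint T.toNNReal).sub (hgint 0)).sub (hM.integrable T.toNNReal)
    refine h1.congr (Eventually.of_forall fun w => ?_)
    simp only [Pi.sub_apply, hI, Real.coe_toNNReal T hT]
    ring
  have hEI : ∀ T : ℝ, 0 ≤ T → (∫ w, g (X T.toNNReal w) ∂(Q η)) - g η = ∫ w, I T w ∂(Q η) := by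
    intro T hT
    -- The martingale vanishes at time `0`, so its mean at time `T` is `0`.
    have h0 := hM.setIntegral_eq (zero_le (a := T.toNNReal)) (s := univ) MeasurableSet.univ
    simp only [Measure.restrict_univ, NNReal.coe_zero, intervalIntegral.integral_same, sub_self,
      integral_zero, Real.coe_toNNReal T hT] at h0
    have h1 : ∫ w, g (X 0 w) ∂(Q η) = g η := by
      rw [integral_congr_ae (g := fun _ => g η)]
      · simp
      · filter_upwards [hX.initial η] with w hw
        simp [hw]
    have h2 : ∫ w, (g (X T.toNNReal w) - g (X 0 w) - I T w) ∂(Q η) = 0 := h0.symm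
    rw [integral_sub (f := fun w => g (X T.toNNReal w) - g (X 0 w))
      ((hgint _).sub (hgint 0)) (hIint T hT), integral_sub (hgint _) (hgint 0),
      h1] at h2
    linarith
  have hlim : Tendsto (fun T : ℝ => ∫ w, 1 / T * I T w ∂(Q η)) (𝓝[>] 0)
      (𝓝 (∫ _, generator g η ∂(Q η))) := by
    refine tendsto_integral_filter_of_dominated_convergence (fun _ => C) ?_ ?_
      (integrable_const _) ?_
    · filter_upwards [self_mem_nhdsWithin] with T hT
      exact ((hIint T (le_of_lt hT)).const_mul _).aestronglyMeasurable
    · filter_upwards [self_mem_nhdsWithin] with T hT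
      refine Eventually.of_forall fun w => ?_
      have hT' : (0 : ℝ) < T := hT
      have h1 : ‖I T w‖ ≤ C * |T - 0| :=
        intervalIntegral.norm_integral_le_of_norm_le_const fun u _ => hC _
      rw [norm_mul, Real.norm_of_nonneg (by positivity)]
      rw [sub_zero, abs_of_pos hT'] at h1
      rw [one_div, inv_mul_le_iff₀ hT']
      linarith
    · filter_upwards [hX.initial η] with w hw
      have h1 : ∀ᶠ u in 𝓝[≥] (0 : ℝ≥0), generator g (X u w) = generator g η := by
        have := hX.rightContinuous w 0
        have h2 := this.eventually ((IsLocallyConstant.iff_eventually_eq _).1 hG.isLocallyConstant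
          (X 0 w))
        rw [hw] at h2
        exact h2
      have h3 : ∀ᶠ u in 𝓝 (0 : ℝ), generator g (X u.toNNReal w) = generator g η := by
        have h4 : Tendsto Real.toNNReal (𝓝 0) (𝓝[≥] (0 : ℝ≥0)) := by
          rw [tendsto_nhdsWithin_iff]
          refine ⟨?_, Eventually.of_forall fun u => zero_le (a := u.toNNReal)⟩
          have := (continuous_real_toNNReal.tendsto 0)
          rwa [Real.toNNReal_zero] at this
        exact h4.eventually h1
      obtain ⟨ε, hε, hball⟩ := Metric.eventually_nhds_iff.1 h3
      refine tendsto_const_nhds.congr' ?_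
      filter_upwards [Ioo_mem_nhdsGT hε] with T hT
      have h5 : I T w = ∫ u in (0 : ℝ)..T, generator g η := by
        refine intervalIntegral.integral_congr fun u hu => ?_
        rw [uIcc_of_le hT.1.le] at hu
        refine hball ?_
        rw [Real.dist_eq, sub_zero, abs_of_nonneg hu.1]
        exact hu.2.trans_lt hT.2
      rw [h5, intervalIntegral.integral_const]
      have := hT.1.ne'
      simp only [sub_zero, smul_eq_mul]
      field_simp
  simp only [integral_const, probReal_univ, one_smul] at hlim
  refine hlim.congr' ?_
  filter_upwards [self_mem_nhdsWithin] with T hT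
  rw [integral_const_mul, hEI T (le_of_lt hT)]

/-! ### Boxes -/

theorem box_eq_reProdIm (N : ℕ) (x : ℤ × ℤ) :
    box N x = Ico ((x.1 : ℝ) / N - 1 / (2 * N)) (x.1 / N + 1 / (2 * N)) ×ℂ
      Ico ((x.2 : ℝ) / N - 1 / (2 * N)) (x.2 / N + 1 / (2 * N)) := by
  ext u
  simp only [box, mem_ofPred_eq, Complex.mem_reProdIm, mem_Ico]
  constructor
  · rintro ⟨h1, h2, h3, h4⟩
    exact ⟨⟨by linarith, by linarith⟩, by linarith, by linarith⟩
  · rintro ⟨⟨h1, h2⟩, h3, h4⟩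
    exact ⟨by linarith, by linarith, by linarith, by linarith⟩

theorem measurableSet_box (N : ℕ) (x : ℤ × ℤ) : MeasurableSet (box N x) := by
  rw [box_eq_reProdIm]
  exact (Complex.measurable_re measurableSet_Ico).inter (Complex.measurable_im measurableSet_Ico)

theorem volume_real_box {N : ℕ} (hN : 1 ≤ N) (x : ℤ × ℤ) :
    volume.real (box N x) = 1 / (N : ℝ) ^ 2 := by
  have hN' : (0 : ℝ) < N := by exact_mod_cast hN
  have h : box N x = Complex.measurableEquivRealProd ⁻¹'
      (Ico ((x.1 : ℝ) / N - 1 / (2 * N)) (x.1 / N + 1 / (2 * N)) ×ˢ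
      Ico ((x.2 : ℝ) / N - 1 / (2 * N)) (x.2 / N + 1 / (2 * N))) := by
    rw [box_eq_reProdIm]; rfl
  rw [Measure.real, h, Complex.volume_preserving_equiv_real_prod.measure_preimage
    (measurableSet_Ico.prod measurableSet_Ico).nullMeasurableSet, Measure.volume_eq_prod,
    Measure.prod_prod, Real.volume_Ico, Real.volume_Ico, ← ENNReal.ofReal_mul]
  · rw [ENNReal.toReal_ofReal]
    · field_simp; ring
    · ring_nf; positivity
  · ring_nf; positivity

theorem volume_box_ne_top {N : ℕ} (hN : 1 ≤ N) (x : ℤ × ℤ) : volume (box N x) ≠ ⊤ := by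
  intro h
  have h1 := volume_real_box hN x
  have hN' : (0 : ℝ) < N := by exact_mod_cast hN
  rw [Measure.real, h, ENNReal.toReal_top] at h1
  have : 0 < 1 / (N : ℝ) ^ 2 := by positivity
  linarith

/-- Coordinates of two centres of boxes containing `u` differ by less than `1/N`, because the sides
are half-open; integers at distance less than `1` agree. -/
theorem eq_of_mem_box {N : ℕ} (hN : 1 ≤ N) {x y : ℤ × ℤ} {u : ℂ} (hx : u ∈ box N x)
    (hy : u ∈ box N y) : x = y := by
  have hN' : (0 : ℝ) < N := by exact_mod_cast hN
  have key : ∀ (i j : ℤ) (c : ℝ), -(1 / (2 * (N : ℝ))) ≤ c - i / N → c - i / N < 1 / (2 * (N : ℝ)) →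
      -(1 / (2 * (N : ℝ))) ≤ c - j / N → c - j / N < 1 / (2 * (N : ℝ)) → i = j := by
    intro i j c h1 h2 h3 h4
    have e : (1 : ℝ) / (2 * N) + 1 / (2 * N) = 1 / N := by field_simp; norm_num
    have h5 : ((i : ℝ) - j) / N < 1 / N := by rw [sub_div]; linarith
    have h6 : ((j : ℝ) - i) / N < 1 / N := by rw [sub_div]; linarith
    rw [div_lt_div_iff_of_pos_right hN'] at h5 h6
    have h7 : i - j < 1 := by exact_mod_cast h5
    have h8 : j - i < 1 := by exact_mod_cast h6
    omega
  obtain ⟨h1, h2, h3, h4⟩ := hx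
  obtain ⟨h1', h2', h3', h4'⟩ := hy
  exact Prod.ext (key _ _ _ h1 h2 h1' h2') (key _ _ _ h3 h4 h3' h4')

/-- The point of the plane that corresponds to the site `x`. -/
def point (N : ℕ) (x : ℤ × ℤ) : ℂ := ⟨(x.1 : ℝ) / N, (x.2 : ℝ) / N⟩

theorem point_mem_box {N : ℕ} (hN : 1 ≤ N) (x : ℤ × ℤ) : point N x ∈ box N x := by
  have hN' : (0 : ℝ) < N := by exact_mod_cast hN
  have : 0 < 1 / (2 * (N : ℝ)) := by positivity
  simp only [point, box, mem_ofPred_eq, sub_self]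
  exact ⟨by linarith, this, by linarith, this⟩

theorem dist_point_le {N : ℕ} {x : ℤ × ℤ} {u : ℂ} (hu : u ∈ box N x) :
    dist u (point N x) ≤ 1 / N := by
  obtain ⟨h1, h2, h3, h4⟩ := hu
  rw [Complex.dist_eq]
  refine (Complex.norm_le_abs_re_add_abs_im _).trans ?_
  have e : (1 : ℝ) / (2 * N) + 1 / (2 * N) = 1 / N := by
    rcases eq_or_ne (N : ℝ) 0 with h | h
    · simp [h]
    · field_simp; norm_num
  rw [← e]
  exact add_le_add (abs_le.2 ⟨h1, h2.le⟩) (abs_le.2 ⟨h3, h4.le⟩)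

/-- The sites whose box meets `S`. -/
def meetingSites (N : ℕ) (S : Set ℂ) : Set (ℤ × ℤ) := {x | (box N x ∩ S).Nonempty}

theorem meetingSites_mono (N : ℕ) {S T : Set ℂ} (h : S ⊆ T) :
    meetingSites N S ⊆ meetingSites N T := fun _ hx => hx.mono (inter_subset_inter_right _ h)

theorem finite_meetingSites {N : ℕ} (hN : 1 ≤ N) {S : Set ℂ} (hS : Bornology.IsBounded S) :
    (meetingSites N S).Finite := by
  have hN' : (0 : ℝ) < N := by exact_mod_cast hN
  obtain ⟨R, hR⟩ := hS.subset_closedBall 0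
  set K : ℤ := ⌈N * (R + 1 / N)⌉
  refine (Finset.finite_toSet (Finset.Icc (-K) K ×ˢ Finset.Icc (-K) K)).subset ?_
  rintro x ⟨u, hu, huS⟩
  have h1 : ‖point N x‖ ≤ R + 1 / N := by
    have h2 := hR huS
    have h3 := dist_point_le hu
    rw [dist_comm] at h3
    have := dist_triangle (point N x) u 0
    rw [Metric.mem_closedBall] at h2
    rw [← dist_zero_right]
    linarith
  have key : ∀ i : ℤ, |(i : ℝ) / N| ≤ R + 1 / N → i ∈ Finset.Icc (-K) K := by
    intro i hi
    rw [abs_div, abs_of_pos hN', div_le_iff₀ hN', mul_comm] at hi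
    have h4 : |(i : ℝ)| ≤ K := hi.trans (Int.le_ceil _)
    rw [Finset.mem_Icc]
    rw [abs_le] at h4
    exact ⟨by exact_mod_cast h4.1, by exact_mod_cast h4.2⟩
  simp only [Finset.coe_product, mem_prod, Finset.mem_coe]
  exact ⟨key _ ((Complex.abs_re_le_norm _).trans h1), key _ ((Complex.abs_im_le_norm _).trans h1)⟩

/-- Both sets are unions of boxes from the same partition of the plane, so their intersection is the
union over the common sites, each of area `1/N²`. -/
theorem volume_droplet_inter {N : ℕ} (hN : 1 ≤ N) {S : Set ℂ} (hS : (meetingSites N S).Finite)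
    (η : Config) : volume.real (droplet N η ∩ discretize N S) =
      1 / (N : ℝ) ^ 2 * plusCount hS.toFinset η := by
  have h1 : droplet N η ∩ discretize N S =
      ⋃ x ∈ hS.toFinset.filter (fun x => η x = true), box N x := by
    ext u
    simp only [droplet, discretize, mem_inter_iff, mem_iUnion, exists_prop, mem_ofPred_eq,
      Finset.mem_filter]
    constructor
    · rintro ⟨⟨x, hx, hux⟩, y, hy, huy⟩
      obtain rfl := eq_of_mem_box hN hux huy
      exact ⟨x, ⟨hS.mem_toFinset.2 hy, hx⟩, hux⟩
    · rintro ⟨x, ⟨hy, hx⟩, hux⟩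
      rw [hS.mem_toFinset] at hy
      exact ⟨⟨x, hx, hux⟩, x, hy, hux⟩
  rw [h1, measureReal_biUnion_finset _ (fun x _ => measurableSet_box N x)
    (fun x _ => volume_box_ne_top hN x)]
  · rw [plusCount, Finset.sum_congr rfl fun x _ => volume_real_box hN x, Finset.sum_const,
      ← Finset.sum_filter, Finset.sum_const]
    simp only [nsmul_eq_mul, mul_one]
    ring
  · intro x _ y _ hxy
    rw [Function.onFun, Set.disjoint_left]
    exact fun u hx hy => hxy (eq_of_mem_box hN hx hy)

/-! ### The initial drift of the volume -/

/-- With `T = t * N²`, the quotient in `t` is `N²` times the quotient in `T`, and this factor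
cancels the area of a box. -/
theorem IsGlauberProcess.tendsto_driftQuotient {Ω' : Type*} [mΩ' : MeasurableSpace Ω']
    {Q : Config → Measure Ω'} {ℱ : Filtration ℝ≥0 mΩ'} {X : ℝ≥0 → Ω' → Config}
    (hX : IsGlauberProcess Q ℱ X) {N : ℕ} (hN : 1 ≤ N) (η : Config) {S : Set ℂ}
    (hS : (meetingSites N S).Finite) :
    Tendsto (driftQuotient Q X N η S) (𝓝[>] 0) (𝓝 (∑ x ∈ hS.toFinset, siteDrift η x)) := by
  have hN' : (0 : ℝ) < N := by exact_mod_cast hN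
  have hgen := generator_smul_plusCount hS.toFinset (1 / (N : ℝ) ^ 2)
  have h1 := hX.tendsto_quotient ((isLocal_plusCount hS.toFinset).const_mul (1 / (N : ℝ) ^ 2))
    (by
      rw [funext hgen]
      exact (isLocal_sum _ fun x _ => isLocal_siteDrift x).const_mul _) η
  rw [hgen] at h1
  have h2 : Tendsto (fun t : ℝ => t * (N : ℝ) ^ 2) (𝓝[>] 0) (𝓝[>] 0) := by
    rw [tendsto_nhdsWithin_iff]
    constructor
    · have : Tendsto (fun t : ℝ => t * (N : ℝ) ^ 2) (𝓝 0) (𝓝 (0 * (N : ℝ) ^ 2)) :=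
        (continuous_mul_const _).tendsto 0
      rw [zero_mul] at this
      exact this.mono_left nhdsWithin_le_nhds
    · filter_upwards [self_mem_nhdsWithin] with t ht
      have ht' : (0 : ℝ) < t := ht
      exact mem_Ioi.2 (by positivity)
  have h3 := (h1.comp h2).const_mul ((N : ℝ) ^ 2)
  have e : (N : ℝ) ^ 2 * (1 / (N : ℝ) ^ 2 * ∑ x ∈ hS.toFinset, siteDrift η x) =
      ∑ x ∈ hS.toFinset, siteDrift η x := by field_simp
  rw [e] at h3
  refine h3.congr' ?_
  filter_upwards [self_mem_nhdsWithin] with t ht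
  have ht' : (0 : ℝ) < t := ht
  simp only [driftQuotient, volume_droplet_inter hN hS, Function.comp]
  field_simp

theorem IsGlauberProcess.drift_eq {Ω' : Type*} [mΩ' : MeasurableSpace Ω']
    {Q : Config → Measure Ω'} {ℱ : Filtration ℝ≥0 mΩ'} {X : ℝ≥0 → Ω' → Config}
    (hX : IsGlauberProcess Q ℱ X) {N : ℕ} (hN : 1 ≤ N) (η : Config) {S : Set ℂ}
    (hS : (meetingSites N S).Finite) :
    drift Q X N η S = ∑ x ∈ hS.toFinset, siteDrift η x :=
  (hX.tendsto_driftQuotient hN η hS).limUnder_eq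

/-! ### The averaged drift as a weighted sum over sites -/

theorem region_mono {s : ℂ} {r : ℝ} {x₀ x₁ : ℂ} {α₁ α₂ β₁ β₂ : ℝ} (h₁ : α₁ ≤ β₁) (h₂ : α₂ ≤ β₂) :
    region s r x₀ x₁ α₁ α₂ ⊆ region s r x₀ x₁ β₁ β₂ :=
  union_subset_union (union_subset_union_right _ (Metric.closedBall_subset_closedBall h₁))
    (Metric.closedBall_subset_closedBall h₂)

theorem finite_meetingSites_region {N : ℕ} (hN : 1 ≤ N) (s : ℂ) (r : ℝ) (x₀ x₁ : ℂ) (α₁ α₂ : ℝ) :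
    (meetingSites N (region s r x₀ x₁ α₁ α₂)).Finite :=
  finite_meetingSites hN ((Metric.isBounded_closedBall.union Metric.isBounded_closedBall).union
    Metric.isBounded_closedBall)

/-- The indicator of the event that the box of `x` meets the region with radii `α₁, α₂`. -/
def meetingIndicator (N : ℕ) (s : ℂ) (r : ℝ) (x₀ x₁ : ℂ) (x : ℤ × ℤ) (α₁ α₂ : ℝ) : ℝ :=
  (meetingSites N (region s r x₀ x₁ α₁ α₂)).indicator 1 x

section
variable (N : ℕ) (s : ℂ) (r : ℝ) (x₀ x₁ : ℂ) (x : ℤ × ℤ)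

theorem meetingIndicator_nonneg (α₁ α₂ : ℝ) : 0 ≤ meetingIndicator N s r x₀ x₁ x α₁ α₂ :=
  indicator_nonneg (fun _ _ => zero_le_one) _

theorem meetingIndicator_le_one (α₁ α₂ : ℝ) : meetingIndicator N s r x₀ x₁ x α₁ α₂ ≤ 1 := by
  unfold meetingIndicator
  by_cases h : x ∈ meetingSites N (region s r x₀ x₁ α₁ α₂) <;> simp [h]

theorem meetingIndicator_mono {α₁ α₂ β₁ β₂ : ℝ} (h₁ : α₁ ≤ β₁) (h₂ : α₂ ≤ β₂) :
    meetingIndicator N s r x₀ x₁ x α₁ α₂ ≤ meetingIndicator N s r x₀ x₁ x β₁ β₂ :=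
  indicator_le_indicator_of_subset (meetingSites_mono N (region_mono h₁ h₂))
    (fun _ => zero_le_one) x

theorem intervalIntegrable_meetingIndicator (α₁ c d : ℝ) :
    IntervalIntegrable (fun α₂ => meetingIndicator N s r x₀ x₁ x α₁ α₂) volume c d :=
  Monotone.intervalIntegrable fun _ _ h => meetingIndicator_mono N s r x₀ x₁ x le_rfl h

theorem intervalIntegrable_integral_meetingIndicator {δ : ℝ} (hδ : 0 ≤ δ) (c d : ℝ) :
    IntervalIntegrable (fun α₁ => ∫ α₂ in (0 : ℝ)..δ, meetingIndicator N s r x₀ x₁ x α₁ α₂)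
      volume c d :=
  Monotone.intervalIntegrable fun _ _ h => intervalIntegral.integral_mono_on hδ
    (intervalIntegrable_meetingIndicator N s r x₀ x₁ x _ _ _)
    (intervalIntegrable_meetingIndicator N s r x₀ x₁ x _ _ _)
    fun _ _ => meetingIndicator_mono N s r x₀ x₁ x h le_rfl

/-- The average over the radii of the indicator that the box of `x` meets the region. -/
def siteWeight (δ : ℝ) : ℝ :=
  1 / δ ^ 2 * ∫ α₁ in (0 : ℝ)..δ, ∫ α₂ in (0 : ℝ)..δ, meetingIndicator N s r x₀ x₁ x α₁ α₂

theorem siteWeight_nonneg {δ : ℝ} (hδ : 0 ≤ δ) : 0 ≤ siteWeight N s r x₀ x₁ x δ :=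
  mul_nonneg (by positivity) (intervalIntegral.integral_nonneg hδ fun _ _ =>
    intervalIntegral.integral_nonneg hδ fun _ _ => meetingIndicator_nonneg N s r x₀ x₁ x _ _)

theorem siteWeight_le_one {δ : ℝ} (hδ : 0 < δ) : siteWeight N s r x₀ x₁ x δ ≤ 1 := by
  have h1 : ∀ α₁, ∫ α₂ in (0 : ℝ)..δ, meetingIndicator N s r x₀ x₁ x α₁ α₂ ≤ δ := by
    intro α₁
    have := intervalIntegral.integral_mono_on hδ.le
      (intervalIntegrable_meetingIndicator N s r x₀ x₁ x α₁ 0 δ) (intervalIntegrable_const (c := (1:ℝ)))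
      fun α₂ _ => meetingIndicator_le_one N s r x₀ x₁ x α₁ α₂
    simpa using this
  have h2 := intervalIntegral.integral_mono_on hδ.le
      (intervalIntegrable_integral_meetingIndicator N s r x₀ x₁ x hδ.le 0 δ)
      (intervalIntegrable_const (c := δ)) fun α₁ _ => h1 α₁
  rw [intervalIntegral.integral_const, sub_zero, smul_eq_mul] at h2
  unfold siteWeight
  rw [one_div, inv_mul_le_iff₀ (by positivity)]
  linarith

theorem siteWeight_eq_zero {δ : ℝ} (hδ : 0 ≤ δ)
    (hx : x ∉ meetingSites N (region s r x₀ x₁ δ δ)) : siteWeight N s r x₀ x₁ x δ = 0 := by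
  have h1 : ∀ α₁ ∈ uIcc 0 δ, ∫ α₂ in (0 : ℝ)..δ, meetingIndicator N s r x₀ x₁ x α₁ α₂ = 0 := by
    intro α₁ hα₁
    rw [uIcc_of_le hδ] at hα₁
    rw [intervalIntegral.integral_congr (g := fun _ => 0), intervalIntegral.integral_zero]
    intro α₂ hα₂
    rw [uIcc_of_le hδ] at hα₂
    exact indicator_of_notMem (fun h => hx (meetingSites_mono N (region_mono hα₁.2 hα₂.2) h)) _
  unfold siteWeight
  rw [intervalIntegral.integral_congr h1, intervalIntegral.integral_zero, mul_zero]

theorem siteWeight_eq_one {δ : ℝ} (hN : 1 ≤ N) (hδ : 0 < δ)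
    (hx : point N x ∈ Metric.closedBall s r) : siteWeight N s r x₀ x₁ x δ = 1 := by
  have h1 : ∀ α₁ α₂, meetingIndicator N s r x₀ x₁ x α₁ α₂ = 1 := fun α₁ α₂ => by
    unfold meetingIndicator
    rw [indicator_of_mem]
    · rfl
    · exact ⟨point N x, point_mem_box hN x, Or.inl (Or.inl hx)⟩
  unfold siteWeight
  simp only [h1, intervalIntegral.integral_const, sub_zero, smul_eq_mul, mul_one]
  field_simp
end

/-- A ball meeting the box still meets it when its radius grows, so each radius condition cuts out
an order-connected set of reals. -/
theorem measurable_meetingIndicator (N : ℕ) (s : ℂ) (r : ℝ) (x₀ x₁ : ℂ) (x : ℤ × ℤ) :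
    Measurable fun p : ℝ × ℝ => meetingIndicator N s r x₀ x₁ x p.1 p.2 := by
  have hball : ∀ c : ℂ, MeasurableSet {α : ℝ | (box N x ∩ Metric.closedBall c α).Nonempty} := by
    intro c
    refine OrdConnected.measurableSet ⟨?_⟩
    intro α hα β _ γ hγ
    exact hα.mono (inter_subset_inter_right _ (Metric.closedBall_subset_closedBall hγ.1))
  have h : {p : ℝ × ℝ | x ∈ meetingSites N (region s r x₀ x₁ p.1 p.2)} =
      ({_p : ℝ × ℝ | (box N x ∩ Metric.closedBall s r).Nonempty} ∪
        Prod.fst ⁻¹' {α : ℝ | (box N x ∩ Metric.closedBall x₀ α).Nonempty}) ∪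
        Prod.snd ⁻¹' {α : ℝ | (box N x ∩ Metric.closedBall x₁ α).Nonempty} := by
    ext p
    simp only [meetingSites, region, inter_union_distrib_left, union_nonempty, mem_ofPred_eq,
      mem_union, mem_preimage]
  have hm : MeasurableSet {p : ℝ × ℝ | x ∈ meetingSites N (region s r x₀ x₁ p.1 p.2)} := by
    rw [h]
    exact ((MeasurableSet.const _).union (measurable_fst (hball x₀))).union
      (measurable_snd (hball x₁))
  have : (fun p : ℝ × ℝ => meetingIndicator N s r x₀ x₁ x p.1 p.2) =
      {p : ℝ × ℝ | x ∈ meetingSites N (region s r x₀ x₁ p.1 p.2)}.indicator 1 := by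
    ext p
    simp only [meetingIndicator, indicator, mem_ofPred_eq, Pi.one_apply]
  rw [this]
  exact measurable_one.indicator hm

section
variable {Ω' : Type*} [mΩ' : MeasurableSpace Ω'] {Q : Config → Measure Ω'}
  {ℱ : Filtration ℝ≥0 mΩ'} {X : ℝ≥0 → Ω' → Config} (hX : IsGlauberProcess Q ℱ X)
include hX

/-- The index set is enlarged to the sites met with the maximal radii, so that it no longer depends
on `α₁, α₂` and the average over the radii can be taken term by term. -/
theorem IsGlauberProcess.drift_region_eq {N : ℕ} (hN : 1 ≤ N) (η : Config) (s : ℂ) (r : ℝ)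
    (x₀ x₁ : ℂ) {α₁ α₂ β₁ β₂ : ℝ} (h₁ : α₁ ≤ β₁) (h₂ : α₂ ≤ β₂) :
    drift Q X N η (region s r x₀ x₁ α₁ α₂) =
      ∑ x ∈ (finite_meetingSites_region hN s r x₀ x₁ β₁ β₂).toFinset,
        meetingIndicator N s r x₀ x₁ x α₁ α₂ * siteDrift η x := by
  rw [hX.drift_eq hN η (finite_meetingSites_region hN s r x₀ x₁ α₁ α₂)]
  refine Finset.sum_subset_zero_on_sdiff ?_ ?_ ?_
  · rw [Finite.toFinset_subset_toFinset]
    exact meetingSites_mono N (region_mono h₁ h₂)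
  · intro x hx
    rw [Finset.mem_sdiff, Finite.mem_toFinset, Finite.mem_toFinset] at hx
    rw [meetingIndicator, indicator_of_notMem hx.2, zero_mul]
  · intro x hx
    rw [Finite.mem_toFinset] at hx
    rw [meetingIndicator, indicator_of_mem hx, Pi.one_apply, one_mul]

theorem IsGlauberProcess.integrableOn_drift {N : ℕ} (hN : 1 ≤ N) (η : Config) (s : ℂ) (r : ℝ)
    (x₀ x₁ : ℂ) (δ : ℝ) :
    IntegrableOn (fun p : ℝ × ℝ => drift Q X N η (region s r x₀ x₁ p.1 p.2))
      (Icc 0 δ ×ˢ Icc 0 δ) := by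
  have hfin : volume (Icc 0 δ ×ˢ Icc 0 δ : Set (ℝ × ℝ)) ≠ ⊤ :=
    (isCompact_Icc.prod isCompact_Icc).measure_lt_top.ne
  have h1 : IntegrableOn (fun p : ℝ × ℝ =>
      ∑ x ∈ (finite_meetingSites_region hN s r x₀ x₁ δ δ).toFinset,
        meetingIndicator N s r x₀ x₁ x p.1 p.2 * siteDrift η x) (Icc 0 δ ×ˢ Icc 0 δ) := by
    refine integrable_finsetSum _ fun x _ => Integrable.mul_const ?_ _
    refine Measure.integrableOn_of_bounded hfin
      (measurable_meetingIndicator N s r x₀ x₁ x).aestronglyMeasurable (M := 1) ?_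
    refine Eventually.of_forall fun p => ?_
    rw [Real.norm_of_nonneg (meetingIndicator_nonneg ..)]
    exact meetingIndicator_le_one ..
  refine h1.congr_fun (fun p hp => ?_) (measurableSet_Icc.prod measurableSet_Icc)
  exact (hX.drift_region_eq hN η s r x₀ x₁ hp.1.2 hp.2.2).symm

theorem IsGlauberProcess.avgDrift_eq {N : ℕ} (hN : 1 ≤ N) (η : Config) (s : ℂ) (r : ℝ)
    (x₀ x₁ : ℂ) {δ : ℝ} (hδ : 0 < δ) :
    avgDrift Q X N η s r x₀ x₁ δ =
      ∑ x ∈ (finite_meetingSites_region hN s r x₀ x₁ δ δ).toFinset,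
        siteWeight N s r x₀ x₁ x δ * siteDrift η x := by
  have h1 : ∀ α₁ ∈ uIcc 0 δ, ∫ α₂ in (0 : ℝ)..δ, drift Q X N η (region s r x₀ x₁ α₁ α₂) =
      ∑ x ∈ (finite_meetingSites_region hN s r x₀ x₁ δ δ).toFinset,
        (∫ α₂ in (0 : ℝ)..δ, meetingIndicator N s r x₀ x₁ x α₁ α₂) * siteDrift η x := by
    intro α₁ hα₁
    rw [uIcc_of_le hδ.le] at hα₁
    have h2 : ∀ α₂ ∈ uIcc 0 δ, drift Q X N η (region s r x₀ x₁ α₁ α₂) =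
        ∑ x ∈ (finite_meetingSites_region hN s r x₀ x₁ δ δ).toFinset,
        meetingIndicator N s r x₀ x₁ x α₁ α₂ * siteDrift η x := by
      intro α₂ hα₂
      rw [uIcc_of_le hδ.le] at hα₂
      exact hX.drift_region_eq hN η s r x₀ x₁ hα₁.2 hα₂.2
    rw [intervalIntegral.integral_congr h2, intervalIntegral.integral_finsetSum]
    · simp_rw [intervalIntegral.integral_mul_const]
    · intro x _
      exact (intervalIntegrable_meetingIndicator N s r x₀ x₁ x α₁ 0 δ).mul_const _
  unfold avgDrift
  rw [intervalIntegral.integral_congr h1, intervalIntegral.integral_finsetSum, Finset.mul_sum]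
  · refine Finset.sum_congr rfl fun x _ => ?_
    rw [intervalIntegral.integral_mul_const, siteWeight, mul_assoc]
  · intro x _
    exact (intervalIntegrable_integral_meetingIndicator N s r x₀ x₁ x hδ.le 0 δ).mul_const _

theorem IsGlauberProcess.integrable_avgDrift {Ω : Type*} [MeasurableSpace Ω] {P : Measure Ω}
    [IsProbabilityMeasure P] {σ : Ω → Config} (hσ : Measurable σ) {N : ℕ} (hN : 1 ≤ N) (s : ℂ)
    (r : ℝ) (x₀ x₁ : ℂ) {δ : ℝ} (hδ : 0 < δ) :
    Integrable (fun ω => avgDrift Q X N (σ ω) s r x₀ x₁ δ) P := by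
  simp_rw [hX.avgDrift_eq hN _ s r x₀ x₁ hδ]
  refine integrable_finsetSum _ fun x _ => Integrable.const_mul ?_ _
  exact Integrable.of_bound ((isLocal_siteDrift x).measurable.comp hσ).aestronglyMeasurable 1
    (Eventually.of_forall fun ω => abs_siteDrift_le _ _)
end

/-! ### The drift of a staircase -/

theorem numOpposite_eq (η : Config) (x : ℤ × ℤ) :
    numOpposite η x = (if η (x.1 + 1, x.2) ≠ η x then 1 else 0) +
      ((if η (x.1 - 1, x.2) ≠ η x then 1 else 0) +
      ((if η (x.1, x.2 + 1) ≠ η x then 1 else 0) +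
      (if η (x.1, x.2 - 1) ≠ η x then 1 else 0))) := by
  unfold numOpposite neighbours
  rw [Finset.card_filter, Finset.sum_insert, Finset.sum_insert, Finset.sum_insert,
    Finset.sum_singleton]
  all_goals
    simp only [Finset.mem_insert, Finset.mem_singleton, Prod.mk.injEq]
    omega

/-- In a neighbourhood of `x` the plus sites are those below the heights `h`. -/
def IsStaircaseAt (η : Config) (h : ℤ → ℤ) (x : ℤ × ℤ) : Prop :=
  ∀ y ∈ insert x (neighbours x), (η y = true ↔ y.2 ≤ h y.1)

theorem IsStaircaseAt.apply_eq {η : Config} {h : ℤ → ℤ} {x : ℤ × ℤ} (hη : IsStaircaseAt η h x)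
    {y : ℤ × ℤ} (hy : y ∈ insert x (neighbours x)) : η y = decide (y.2 ≤ h y.1) := by
  rw [Bool.eq_iff_iff, hη y hy, decide_eq_true_iff]

/-- No site of a monotone staircase has more than two opposite neighbours. Exactly two occur only at
the top plus site of a column with a lower left neighbour column, and at the lowest minus site of a
column with a higher right one. -/
theorem IsStaircaseAt.siteDrift_of_le {η : Config} {h : ℤ → ℤ} {x : ℤ × ℤ}
    (hη : IsStaircaseAt η h x) (h₁ : h (x.1 - 1) ≤ h x.1) (h₂ : h x.1 ≤ h (x.1 + 1)) :
    siteDrift η x = 1 / 2 * ((if x.2 = h x.1 + 1 then (if h x.1 < h (x.1 + 1) then 1 else 0) else 0)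
      - (if x.2 = h x.1 then (if h (x.1 - 1) < h x.1 then 1 else 0) else 0)) := by
  unfold siteDrift flipRate flipSign
  rw [numOpposite_eq, hη.apply_eq (y := x) (by simp),
    hη.apply_eq (y := (x.1 + 1, x.2)) (by simp [neighbours]),
    hη.apply_eq (y := (x.1 - 1, x.2)) (by simp [neighbours]),
    hη.apply_eq (y := (x.1, x.2 + 1)) (by simp [neighbours]),
    hη.apply_eq (y := (x.1, x.2 - 1)) (by simp [neighbours])]
  simp only [ne_eq, decide_eq_decide, decide_eq_true_eq]
  generalize h (x.1 - 1) = A at *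
  generalize h (x.1 + 1) = C at *
  generalize h x.1 = B at *
  generalize x.2 = j at *
  rcases lt_trichotomy j B with hj | rfl | hj
  · have e1 : (j ≤ C ↔ j ≤ B) := by omega
    have e2 : (j + 1 ≤ B ↔ j ≤ B) := by omega
    have e3 : (j - 1 ≤ B ↔ j ≤ B) := by omega
    have e4 : ¬ j = B + 1 := by omega
    simp only [e1, e2, e3, e4, hj.ne, not_true, if_false]
    split_ifs <;> first | omega | norm_num
  · have e1 : (j ≤ C ↔ j ≤ j) := by omega
    have e2 : ¬ (j + 1 ≤ j) := by omega
    have e3 : (j - 1 ≤ j) := by omega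
    have e4 : ¬ j = j + 1 := by omega
    have e5 : (j ≤ A ↔ ¬ A < j) := by omega
    by_cases hA : A < j <;> simp [e1, e2, e3, e4, e5, hA]
  · have e1 : ¬ j ≤ B := by omega
    have e2 : ¬ (j + 1 ≤ B) := by omega
    have e3 : ¬ (j ≤ A) := by omega
    have e4 : ¬ j = B := by omega
    rcases eq_or_ne j (B + 1) with rfl | hj'
    · have e5 : (B + 1 ≤ C ↔ B < C) := by omega
      by_cases hC : B < C <;> simp [e2, e3, e5, hC]
    · have e5 : ¬ j - 1 ≤ B := by omega
      simp only [e1, e2, e3, e4, e5, hj', not_true, if_false]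
      split_ifs <;> first | omega | norm_num

/-- The mirror image: left and right neighbour columns exchange roles. -/
theorem IsStaircaseAt.siteDrift_of_ge {η : Config} {h : ℤ → ℤ} {x : ℤ × ℤ}
    (hη : IsStaircaseAt η h x) (h₁ : h x.1 ≤ h (x.1 - 1)) (h₂ : h (x.1 + 1) ≤ h x.1) :
    siteDrift η x = 1 / 2 * ((if x.2 = h x.1 + 1 then (if h x.1 < h (x.1 - 1) then 1 else 0) else 0)
      - (if x.2 = h x.1 then (if h (x.1 + 1) < h x.1 then 1 else 0) else 0)) := by
  unfold siteDrift flipRate flipSign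
  rw [numOpposite_eq, hη.apply_eq (y := x) (by simp),
    hη.apply_eq (y := (x.1 + 1, x.2)) (by simp [neighbours]),
    hη.apply_eq (y := (x.1 - 1, x.2)) (by simp [neighbours]),
    hη.apply_eq (y := (x.1, x.2 + 1)) (by simp [neighbours]),
    hη.apply_eq (y := (x.1, x.2 - 1)) (by simp [neighbours])]
  simp only [ne_eq, decide_eq_decide, decide_eq_true_eq]
  generalize h (x.1 - 1) = C at *
  generalize h (x.1 + 1) = A at *
  generalize h x.1 = B at *
  generalize x.2 = j at *
  rcases lt_trichotomy j B with hj | rfl | hj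
  · have e1 : (j ≤ C ↔ j ≤ B) := by omega
    have e2 : (j + 1 ≤ B ↔ j ≤ B) := by omega
    have e3 : (j - 1 ≤ B ↔ j ≤ B) := by omega
    have e4 : ¬ j = B + 1 := by omega
    simp only [e1, e2, e3, e4, hj.ne, not_true, if_false]
    split_ifs <;> first | omega | norm_num
  · have e1 : (j ≤ C ↔ j ≤ j) := by omega
    have e2 : ¬ (j + 1 ≤ j) := by omega
    have e3 : (j - 1 ≤ j) := by omega
    have e4 : ¬ j = j + 1 := by omega
    have e5 : (j ≤ A ↔ ¬ A < j) := by omega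
    by_cases hA : A < j <;> simp [e1, e2, e3, e4, e5, hA]
  · have e1 : ¬ j ≤ B := by omega
    have e2 : ¬ (j + 1 ≤ B) := by omega
    have e3 : ¬ (j ≤ A) := by omega
    have e4 : ¬ j = B := by omega
    rcases eq_or_ne j (B + 1) with rfl | hj'
    · have e5 : (B + 1 ≤ C ↔ B < C) := by omega
      by_cases hC : B < C <;> simp [e2, e3, e5, hC]
    · have e5 : ¬ j - 1 ≤ B := by omega
      simp only [e1, e2, e3, e4, e5, hj', not_true, if_false]
      split_ifs <;> first | omega | norm_num

/-- A global reversal preserves disagreements, hence the rates, and exchanges gain with loss. -/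
theorem siteDrift_not (η : Config) (x : ℤ × ℤ) :
    siteDrift (fun y => !η y) x = -siteDrift η x := by
  have h1 : numOpposite (fun y => !η y) x = numOpposite η x := by
    unfold numOpposite
    congr 1
    refine Finset.filter_congr fun y _ => ?_
    simp
  unfold siteDrift flipRate flipSign
  rw [h1]
  dsimp only
  by_cases hx : η x = true <;> simp [hx]

/-- Each column contains one site of the graph of `H`. Graph sites outside `F` do no harm because
`A` vanishes there. -/
theorem sum_graph {F : Finset (ℤ × ℤ)} {A : ℤ × ℤ → ℝ} (hA : ∀ x ∉ F, A x = 0) {K : Finset ℤ}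
    (hK : ∀ x ∈ F, x.1 ∈ K) (H : ℤ → ℤ) (c : ℤ → ℝ) :
    ∑ x ∈ F, A x * (if x.2 = H x.1 then c x.1 else 0) = ∑ k ∈ K, A (k, H k) * c k := by
  have h1 : ∀ x ∈ F, A x * (if x.2 = H x.1 then c x.1 else 0) =
      ∑ k ∈ K, if x = (k, H k) then A x * c k else 0 := by
    intro x hx
    rw [Finset.sum_eq_single x.1]
    · by_cases h : x.2 = H x.1
      · have e : x = (x.1, H x.1) := Prod.ext rfl h
        rw [if_pos h, if_pos e]
      · rw [if_neg h, if_neg (fun e => h (by rw [e])), mul_zero]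
    · intro k _ hk
      exact if_neg fun e => hk (by rw [e])
    · intro h
      exact absurd (hK x hx) h
  rw [Finset.sum_congr rfl h1, Finset.sum_comm]
  refine Finset.sum_congr rfl fun k _ => ?_
  rw [Finset.sum_ite_eq']
  split_ifs with h
  · rfl
  · rw [hA _ h, zero_mul]

section
variable {F : Finset (ℤ × ℤ)} {A : ℤ × ℤ → ℝ} (hA : ∀ x ∉ F, A x = 0) {k₀ k₁ : ℤ}
  (hF : ∀ x ∈ F, k₀ < x.1 ∧ x.1 < k₁) {η : Config} {h : ℤ → ℤ}
  (hη : ∀ x ∈ F, IsStaircaseAt η h x)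
include hA hF hη

/-- Corners are grouped by steps: a rise between columns `k` and `k + 1` has its fillable corner on
column `k` and its removable corner on top of column `k + 1`. The strict bounds in `hF` keep both
neighbouring columns inside the range where monotonicity is known. -/
theorem sum_siteDrift_of_le (hh : ∀ k ∈ Ico k₀ k₁, h k ≤ h (k + 1)) :
    ∑ x ∈ F, A x * siteDrift η x = 1 / 2 * ∑ k ∈ Finset.Ico k₀ k₁,
      if 0 < h (k + 1) - h k then A (k, h k + 1) - A (k + 1, h (k + 1)) else 0 := by
  have h1 : ∀ x ∈ F, A x * siteDrift η x = 1 / 2 * (A x * (if x.2 = h x.1 + 1 then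
      (if h x.1 < h (x.1 + 1) then 1 else 0) else 0) -
      A x * (if x.2 = h x.1 then (if h (x.1 - 1) < h x.1 then 1 else 0) else 0)) := by
    intro x hx
    have hx' := hF x hx
    have h2 := hh (x.1 - 1) ⟨by omega, by omega⟩
    rw [sub_add_cancel] at h2
    rw [(hη x hx).siteDrift_of_le h2 (hh x.1 ⟨by omega, by omega⟩)]
    ring
  rw [Finset.sum_congr rfl h1, ← Finset.mul_sum, Finset.sum_sub_distrib,
    sum_graph hA (K := Finset.Ico k₀ k₁)
      (fun x hx => Finset.mem_Ico.2 ⟨by have := hF x hx; omega, by have := hF x hx; omega⟩)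
      (fun k => h k + 1) (fun k => if h k < h (k + 1) then 1 else 0),
    -- Removable corners are indexed by the right column of their step, so this window is shifted by
    -- one in order to match the first sum after reindexing.
    sum_graph hA (K := Finset.Ico (k₀ + 1) (k₁ + 1))
      (fun x hx => Finset.mem_Ico.2 ⟨by have := hF x hx; omega, by have := hF x hx; omega⟩)
      h (fun k => if h (k - 1) < h k then 1 else 0), ← Finset.sum_Ico_add', ← Finset.sum_sub_distrib]
  congr 1
  refine Finset.sum_congr rfl fun k _ => ?_
  simp only [add_sub_cancel_right, sub_pos]
  split_ifs <;> ring

/-- For a descent the fillable corner is on column `k + 1` and the removable one on top of column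
`k`. -/
theorem sum_siteDrift_of_ge (hh : ∀ k ∈ Ico k₀ k₁, h (k + 1) ≤ h k) :
    ∑ x ∈ F, A x * siteDrift η x = 1 / 2 * ∑ k ∈ Finset.Ico k₀ k₁,
      if 0 < h k - h (k + 1) then A (k + 1, h (k + 1) + 1) - A (k, h k) else 0 := by
  have h1 : ∀ x ∈ F, A x * siteDrift η x = 1 / 2 * (A x * (if x.2 = h x.1 + 1 then
      (if h x.1 < h (x.1 - 1) then 1 else 0) else 0) -
      A x * (if x.2 = h x.1 then (if h (x.1 + 1) < h x.1 then 1 else 0) else 0)) := by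
    intro x hx
    have hx' := hF x hx
    have h2 := hh (x.1 - 1) ⟨by omega, by omega⟩
    rw [sub_add_cancel] at h2
    rw [(hη x hx).siteDrift_of_ge h2 (hh x.1 ⟨by omega, by omega⟩)]
    ring
  rw [Finset.sum_congr rfl h1, ← Finset.mul_sum, Finset.sum_sub_distrib,
    sum_graph hA (K := Finset.Ico k₀ k₁)
      (fun x hx => Finset.mem_Ico.2 ⟨by have := hF x hx; omega, by have := hF x hx; omega⟩)
      h (fun k => if h (k + 1) < h k then 1 else 0),
    sum_graph hA (K := Finset.Ico (k₀ + 1) (k₁ + 1))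
      (fun x hx => Finset.mem_Ico.2 ⟨by have := hF x hx; omega, by have := hF x hx; omega⟩)
      (fun k => h k + 1) (fun k => if h k < h (k - 1) then 1 else 0), ← Finset.sum_Ico_add',
      ← Finset.sum_sub_distrib]
  congr 1
  refine Finset.sum_congr rfl fun k _ => ?_
  simp only [add_sub_cancel_right, sub_pos]
  split_ifs <;> ring
end

/-- Summation by parts; the vanishing of `g` at both ends removes the boundary terms. -/
theorem sum_mul_sub_eq {k₀ k₁ : ℤ} (_hk : k₀ ≤ k₁) (w g : ℤ → ℝ) (h₀ : g k₀ = 0) (h₁ : g k₁ = 0) :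
    ∑ k ∈ Finset.Ico k₀ k₁, w k * (g k - g (k + 1)) =
      ∑ k ∈ Finset.Ico k₀ k₁, (w k - w (k - 1)) * g k := by
  have h2 : ∑ k ∈ Finset.Ico k₀ k₁, w k * g (k + 1) =
      ∑ k ∈ Finset.Ico k₀ k₁, w (k - 1) * g k := by
    have h3 := Finset.sum_Ico_add' (fun k => w (k - 1) * g k) k₀ k₁ 1
    simp only [add_sub_cancel_right] at h3
    rw [h3]
    have h4 : ∑ k ∈ Finset.Ico (k₀ + 1) (k₁ + 1), w (k - 1) * g k =
        ∑ k ∈ Finset.Ico k₀ (k₁ + 1), w (k - 1) * g k := by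
      refine Finset.sum_subset (Finset.Ico_subset_Ico_left (by omega)) fun k hk hk' => ?_
      rw [Finset.mem_Ico] at hk hk'
      rw [show k = k₀ by omega, h₀, mul_zero]
    have h5 : ∑ k ∈ Finset.Ico k₀ k₁, w (k - 1) * g k =
        ∑ k ∈ Finset.Ico k₀ (k₁ + 1), w (k - 1) * g k := by
      refine Finset.sum_subset (Finset.Ico_subset_Ico_right (by omega)) fun k hk hk' => ?_
      rw [Finset.mem_Ico] at hk hk'
      rw [show k = k₁ by omega, h₁, mul_zero]
    rw [h4, h5]
  simp_rw [mul_sub, sub_mul]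
  rw [Finset.sum_sub_distrib, Finset.sum_sub_distrib, h2]

/-! ### The geometric law -/

theorem geometricWeight_natCast (q : ℝ) (n : ℕ) :
    geometricWeight q n = 1 / (1 + q) * (q / (1 + q)) ^ n := by
  rw [geometricWeight, if_pos (by positivity), Int.toNat_natCast, pow_succ, div_pow]
  rw [div_mul_div_comm, one_mul, mul_comm]

theorem geometricWeight_of_neg (q : ℝ) {l : ℤ} (hl : l < 0) : geometricWeight q l = 0 :=
  if_neg (by omega)

theorem geometricWeight_succ (q : ℝ) {l : ℤ} (hl : 0 ≤ l) :
    geometricWeight q (l + 1) = q / (1 + q) * geometricWeight q l := by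
  lift l to ℕ using hl
  rw [geometricWeight_natCast, show (l : ℤ) + 1 = ((l + 1 : ℕ) : ℤ) by push_cast; rfl,
    geometricWeight_natCast, pow_succ]
  ring

/-- `ν` is the geometric law with parameter `q`. -/
def IsGeometric (q : ℝ) (ν : Measure ℤ) : Prop := ∀ l, ν.real {l} = geometricWeight q l

namespace IsGeometric
variable {q : ℝ} {ν : Measure ℤ} [IsProbabilityMeasure ν] (hν : IsGeometric q ν)
include hν

theorem ae_nonneg : ∀ᵐ l ∂ν, 0 ≤ l := by
  rw [ae_iff_of_countable]
  intro l hl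
  by_contra h
  have h1 := hν l
  rw [geometricWeight_of_neg q (by omega), measureReal_eq_zero_iff] at h1
  exact hl h1

theorem integrable_of_summable {f : ℤ → ℝ}
    (hf : Summable fun n : ℕ => geometricWeight q n * ‖f n‖) : Integrable f ν := by
  rw [← Measure.sum_smul_dirac ν]
  refine integrable_sum_dirac (fun i => measure_ne_top ν _) ?_
  have h1 : ∀ l : ℤ, (ν {l}).toReal * ‖f l‖ = geometricWeight q l * ‖f l‖ := fun l => by
    rw [← hν l]; rfl
  simp_rw [h1]
  rw [← (Nat.cast_injective (R := ℤ)).summable_iff]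
  · exact hf
  · intro l hl
    rw [geometricWeight_of_neg, zero_mul]
    by_contra h
    exact hl ⟨l.toNat, Int.toNat_of_nonneg (by omega)⟩

-- Consecutive weights have the constant ratio `q / (1 + q)`. Both the lack of memory and the
-- moments follow from this shift.
omit [IsProbabilityMeasure ν] in
theorem integral_shift {f : ℤ → ℝ} (hf : Integrable f ν)
    (hf' : Integrable (fun l => if 0 < l then f (l - 1) else 0) ν) :
    ∫ l, (if 0 < l then f (l - 1) else 0) ∂ν = q / (1 + q) * ∫ l, f l ∂ν := by
  rw [integral_countable hf', integral_countable hf, ← tsum_mul_left,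
    ← (Equiv.addRight (1 : ℤ)).tsum_eq]
  refine tsum_congr fun l => ?_
  simp only [Equiv.coe_addRight, add_sub_cancel_right, hν _, smul_eq_mul]
  by_cases hl : 0 ≤ l
  · rw [if_pos (by omega), geometricWeight_succ q hl, mul_assoc]
  · rw [if_neg (by omega), geometricWeight_of_neg q (l := l) (by omega)]
    ring

theorem integrable_pow (hq : 0 ≤ q) (k : ℕ) : Integrable (fun l : ℤ => (l : ℝ) ^ k) ν := by
  refine hν.integrable_of_summable ?_
  have h1 : ‖q / (1 + q)‖ < 1 := by
    rw [Real.norm_of_nonneg (by positivity), div_lt_one (by positivity)]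
    linarith
  refine ((summable_pow_mul_geometric_of_norm_lt_one k h1).mul_left (1 / (1 + q))).congr fun n => ?_
  rw [geometricWeight_natCast, Int.cast_natCast, Real.norm_of_nonneg (by positivity)]
  ring

/-- The shift applied to `l + 1` gives the linear equation `E = q / (1 + q) * (E + 1)` for the mean.
-/
theorem integral_id (hq : 0 ≤ q) : ∫ l, (l : ℝ) ∂ν = q := by
  have h1 : Integrable (fun l : ℤ => (l : ℝ)) ν := by simpa using hν.integrable_pow hq 1
  have h2 : (fun l : ℤ => if 0 < l then ((l - 1 : ℤ) : ℝ) + 1 else 0) =ᵐ[ν] fun l => (l : ℝ) := by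
    filter_upwards [hν.ae_nonneg] with l hl
    split_ifs with h
    · push_cast; ring
    · rw [show l = 0 by omega]; simp
  have h3 := hν.integral_shift (f := fun l => (l : ℝ) + 1) (h1.add (integrable_const 1))
    (h1.congr h2.symm)
  rw [integral_congr_ae h2, integral_add h1 (integrable_const _)] at h3
  simp only [integral_const, probReal_univ, one_smul] at h3
  field_simp at h3
  linarith

/-- The same argument applied to `(l + 1) ^ 2`, with the mean already known. -/
theorem integral_sq (hq : 0 ≤ q) : ∫ l, (l : ℝ) ^ 2 ∂ν = q * (2 * q + 1) := by
  have h0 := hν.integral_id hq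
  have h1 : Integrable (fun l : ℤ => (l : ℝ)) ν := by simpa using hν.integrable_pow hq 1
  have h1' := hν.integrable_pow hq 2
  have h2 : (fun l : ℤ => if 0 < l then ((l - 1 : ℤ) : ℝ) ^ 2 + (2 * ((l - 1 : ℤ) : ℝ) + 1) else 0)
      =ᵐ[ν] fun l => (l : ℝ) ^ 2 := by
    filter_upwards [hν.ae_nonneg] with l hl
    split_ifs with h
    · push_cast; ring
    · rw [show l = 0 by omega]; simp
  have h4 : Integrable (fun l : ℤ => 2 * (l : ℝ) + 1) ν := (h1.const_mul 2).add (integrable_const 1)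
  have h3 := hν.integral_shift (f := fun l => (l : ℝ) ^ 2 + (2 * (l : ℝ) + 1)) (h1'.add h4)
    (h1'.congr h2.symm)
  rw [integral_congr_ae h2, integral_add h1' h4,
    integral_add (h1.const_mul 2) (integrable_const _), integral_const_mul, h0] at h3
  simp only [integral_const, probReal_univ, one_smul] at h3
  field_simp at h3
  linarith

end IsGeometric

theorem isGeometric_map {Ω : Type*} [MeasurableSpace Ω] {P : Measure Ω} {ξ : Ω → ℤ} (hξ : Measurable ξ) {q : ℝ}
    (h : ∀ l, P.real {ω | ξ ω = l} = geometricWeight q l) : IsGeometric q (P.map ξ) := by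
  intro l
  rw [map_measureReal_apply hξ (measurableSet_singleton l), ← h l]
  rfl

/-! ### Independence and the lack of memory -/

section
variable {Ω : Type*} [MeasurableSpace Ω] {P : Measure Ω} [IsProbabilityMeasure P]

/-- The lack of memory of the geometric law. -/
theorem integral_pos_increment {H ξ : Ω → ℤ} (hH : Measurable H) (hξ : Measurable ξ)
    (hind : IndepFun H ξ P) {q : ℝ} (hg : IsGeometric q (P.map ξ)) {Ψ : ℤ → ℤ → ℝ} {C : ℝ}
    (hΨ : ∀ a l, |Ψ a l| ≤ C) :
    ∫ ω, (if 0 < ξ ω then Ψ (H ω) (ξ ω - 1) else 0) ∂P = q / (1 + q) * ∫ ω, Ψ (H ω) (ξ ω) ∂P := by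
  have := Measure.isProbabilityMeasure_map (μ := P) hH.aemeasurable
  have := Measure.isProbabilityMeasure_map (μ := P) hξ.aemeasurable
  have hprod := hind.map_prod_eq_prod_map_map hH.aemeasurable hξ.aemeasurable
  -- Independence makes the joint law a product; with the position frozen at `a`, what remains is
  -- the one-variable shift.
  have hbound : ∀ G : ℤ × ℤ → ℝ, (∀ p, |G p| ≤ C) →
      ∫ ω, G (H ω, ξ ω) ∂P = ∫ a, ∫ l, G (a, l) ∂(P.map ξ) ∂(P.map H) := by
    intro G hG
    rw [← integral_prod, ← hprod, integral_map (hH.prodMk hξ).aemeasurable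
      (measurable_of_countable G).aestronglyMeasurable]
    exact Integrable.of_bound (measurable_of_countable G).aestronglyMeasurable C
      (Eventually.of_forall hG)
  have hC : 0 ≤ C := (abs_nonneg _).trans (hΨ 0 0)
  have h1 := hbound (fun p => if 0 < p.2 then Ψ p.1 (p.2 - 1) else 0) (fun p => by
    split_ifs
    · exact hΨ _ _
    · simpa using hC)
  have h2 := hbound (fun p => Ψ p.1 p.2) (fun p => hΨ _ _)
  dsimp only at h1 h2
  rw [h1, h2, ← integral_const_mul]
  congr 1
  ext a
  refine hg.integral_shift ?_ ?_
  · exact Integrable.of_bound (measurable_of_countable _).aestronglyMeasurable C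
      (Eventually.of_forall fun l => hΨ _ _)
  · refine Integrable.of_bound (measurable_of_countable _).aestronglyMeasurable C
      (Eventually.of_forall fun l => ?_)
    split_ifs
    · exact hΨ _ _
    · simpa using hC

/-- The joint law of the three variables is a triple product, and reassociating it gives the other
grouping. It is used with the starting height, the sum of the earlier increments and the next
increment. -/
theorem IndepFun.assoc_of_prodMk {A B C : Ω → ℤ} (hA : Measurable A) (hB : Measurable B)
    (hC : Measurable C) (h₁ : IndepFun A (fun ω => (B ω, C ω)) P) (h₂ : IndepFun B C P) :
    IndepFun (fun ω => (A ω, B ω)) C P := by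
  have := Measure.isProbabilityMeasure_map (μ := P) hA.aemeasurable
  have := Measure.isProbabilityMeasure_map (μ := P) hB.aemeasurable
  have := Measure.isProbabilityMeasure_map (μ := P) hC.aemeasurable
  have hAB : IndepFun A B P := h₁.comp measurable_id measurable_fst
  rw [indepFun_iff_map_prod_eq_prod_map_map (hA.prodMk hB).aemeasurable hC.aemeasurable,
    hAB.map_prod_eq_prod_map_map hA.aemeasurable hB.aemeasurable]
  have h3 := h₁.map_prod_eq_prod_map_map hA.aemeasurable (hB.prodMk hC).aemeasurable
  rw [h₂.map_prod_eq_prod_map_map hB.aemeasurable hC.aemeasurable, ← Measure.prodAssoc_prod] at h3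
  have h4 := congrArg (Measure.map (MeasurableEquiv.prodAssoc (α := ℤ) (β := ℤ) (γ := ℤ)).symm) h3
  rw [Measure.map_map (MeasurableEquiv.measurable _) (hA.prodMk (hB.prodMk hC)),
    Measure.map_map (MeasurableEquiv.measurable _) (MeasurableEquiv.measurable _)] at h4
  simp only [MeasurableEquiv.symm_comp_self, Measure.map_id] at h4
  exact h4
end

/-! ### Walks with independent geometric increments -/

theorem integrable_weight {Ω : Type*} [MeasurableSpace Ω] {P : Measure Ω} [IsFiniteMeasure P]
    {A : ℤ × ℤ → ℝ} (hA₀ : ∀ x, 0 ≤ A x) (hA₁ : ∀ x, A x ≤ 1) {k : ℤ} {H : Ω → ℤ} (hH : Measurable H) :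
    Integrable (fun ω => A (k, H ω)) P := by
  have hm : Measurable fun ω => A (k, H ω) := by
    have : Measurable fun j : ℤ => A (k, j) := measurable_of_countable _
    exact this.comp hH
  refine Integrable.of_bound hm.aestronglyMeasurable 1 (Eventually.of_forall fun ω => ?_)
  rw [Real.norm_of_nonneg (hA₀ _)]
  exact hA₁ _

theorem abs_weight_sub_le {A : ℤ × ℤ → ℝ} (hA₀ : ∀ x, 0 ≤ A x) (hA₁ : ∀ x, A x ≤ 1) (x y : ℤ × ℤ) : |A x - A y| ≤ 1 := by
  rw [abs_le]
  constructor <;> linarith [hA₀ x, hA₁ x, hA₀ y, hA₁ y]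

/-- On the window `[m, M]`, `h` has increments `e * ξ k` with `e = ± 1` and independent geometric
variables `ξ k`, each of which is independent of the position at its time. -/
structure IsGeometricWalk {Ω : Type*} [MeasurableSpace Ω] (P : Measure Ω) (h : Ω → ℤ → ℤ) (e : ℤ)
    (q : ℤ → ℝ) (m M : ℤ) : Prop where
  measurable : ∀ k, Measurable fun ω => h ω k
  sign : e = 1 ∨ e = -1
  nonneg : ∀ k, 0 ≤ q k
  law : ∀ k ∈ Ico m M, IsGeometric (q k) (P.map fun ω => e * (h ω (k + 1) - h ω k))
  indep_position : ∀ k ∈ Ico m M, IndepFun (fun ω => h ω k) (fun ω => e * (h ω (k + 1) - h ω k)) P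
  indep_increments : ∀ k ∈ Ico m M, ∀ l ∈ Ico m M, k ≠ l →
    IndepFun (fun ω => e * (h ω (k + 1) - h ω k)) (fun ω => e * (h ω (l + 1) - h ω l)) P

namespace IsGeometricWalk

theorem measurable_increment {Ω : Type*} [MeasurableSpace Ω] {P : Measure Ω} {h : Ω → ℤ → ℤ}
    {e : ℤ} {q : ℤ → ℝ} {m M : ℤ} (hw : IsGeometricWalk P h e q m M) (k : ℤ) :
    Measurable fun ω => e * (h ω (k + 1) - h ω k) :=
  ((hw.measurable (k + 1)).sub (hw.measurable k)).const_mul e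

section
variable {Ω : Type*} [MeasurableSpace Ω] {P : Measure Ω} [IsProbabilityMeasure P] {h : Ω → ℤ → ℤ}
  {e : ℤ} {q : ℤ → ℝ} {m M : ℤ} (hw : IsGeometricWalk P h e q m M)
include hw

theorem ae_increment_nonneg : ∀ᵐ ω ∂P, ∀ k ∈ Ico m M, 0 ≤ e * (h ω (k + 1) - h ω k) := by
  rw [ae_all_iff]
  intro k
  by_cases hk : k ∈ Ico m M
  · have := Measure.isProbabilityMeasure_map (μ := P) (hw.measurable_increment k).aemeasurable
    filter_upwards [ae_of_ae_map (hw.measurable_increment k).aemeasurable (hw.law k hk).ae_nonneg]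
      with ω hω _ using hω
  · exact Eventually.of_forall fun ω hk' => absurd hk' hk

theorem integral_increment_pos {k : ℤ} (hk : k ∈ Ico m M) {Ψ : ℤ → ℤ → ℝ} {C : ℝ}
    (hΨ : ∀ a l, |Ψ a l| ≤ C) :
    ∫ ω, (if 0 < e * (h ω (k + 1) - h ω k) then
      Ψ (h ω k) (e * (h ω (k + 1) - h ω k) - 1) else 0) ∂P =
      q k / (1 + q k) * ∫ ω, Ψ (h ω k) (e * (h ω (k + 1) - h ω k)) ∂P :=
  integral_pos_increment (hw.measurable k) (hw.measurable_increment k) (hw.indep_position k hk)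
    (hw.law k hk) hΨ
end

/-- The corner of the interface next to the column `k` at height `l` sits at `l` or at `l + 1`. -/
def cornerOffset (e : ℤ) : ℤ := if e = 1 then 1 else 0

variable {Ω : Type*} [MeasurableSpace Ω] {P : Measure Ω} [IsProbabilityMeasure P] {h : Ω → ℤ → ℤ}
  {e : ℤ} {q : ℤ → ℝ} {m M : ℤ} (hw : IsGeometricWalk P h e q m M) {A : ℤ × ℤ → ℝ}
  (hA₀ : ∀ x, 0 ≤ A x) (hA₁ : ∀ x, A x ≤ 1)
include hw hA₀ hA₁

/-- The mean of the weighted drift of the staircase, by the lack of memory of the increments. -/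
theorem integral_sum_siteDrift {F : Finset (ℤ × ℤ)} (hA : ∀ x ∉ F, A x = 0) {k₀ k₁ : ℤ}
    (hm : m ≤ k₀) (hk : k₀ ≤ k₁) (hM : k₁ ≤ M) (hF : ∀ x ∈ F, k₀ < x.1 ∧ x.1 < k₁)
    {σ : Ω → Config} (hσ : ∀ᵐ ω ∂P, ∀ x ∈ F, IsStaircaseAt (σ ω) (h ω) x) :
    ∫ ω, ∑ x ∈ F, A x * siteDrift (σ ω) x ∂P = (e : ℝ) / 2 * ∑ k ∈ Finset.Ico k₀ k₁,
      (q k / (1 + q k) - q (k - 1) / (1 + q (k - 1))) * ∫ ω, A (k, h ω k + cornerOffset e) ∂P := by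
  have hsub : ∀ k ∈ Finset.Ico k₀ k₁, k ∈ Ico m M := fun k hk' => by
    rw [Finset.mem_Ico] at hk'
    exact ⟨by omega, by omega⟩
  -- The columns of `F` lie strictly between `k₀` and `k₁`, so the weights vanish on both end
  -- columns.
  have hend : ∀ k, (k = k₀ ∨ k = k₁) → ∫ ω, A (k, h ω k + cornerOffset e) ∂P = 0 := by
    intro k hk'
    have : ∀ j, A (k, j) = 0 := fun j => hA _ fun hx => by
      have := hF _ hx
      dsimp only at this
      omega
    simp [this]
  rw [← sum_mul_sub_eq hk (fun k => q k / (1 + q k)) _ (hend _ (Or.inl rfl)) (hend _ (Or.inr rfl))]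
  rcases hw.sign with he | he
  · subst he
    have hmono : ∀ᵐ ω ∂P, ∀ k ∈ Ico k₀ k₁, h ω k ≤ h ω (k + 1) := by
      filter_upwards [hw.ae_increment_nonneg] with ω hω k hk'
      have := hω k ⟨by have := hk'.1; omega, by have := hk'.2; omega⟩
      omega
    -- The height `h (k + 1)` is written as `h k + 1 + (ξ - 1)`. The lack of memory replaces `ξ - 1`
    -- by `ξ`, turning it into `h (k + 1) + 1`: both corners then have offset `1`.
    have h1 : ∀ᵐ ω ∂P, ∑ x ∈ F, A x * siteDrift (σ ω) x = 1 / 2 * ∑ k ∈ Finset.Ico k₀ k₁,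
        if 0 < 1 * (h ω (k + 1) - h ω k) then
          A (k, h ω k + 1) - A (k + 1, h ω k + 1 + (1 * (h ω (k + 1) - h ω k) - 1)) else 0 := by
      filter_upwards [hmono, hσ] with ω h1 h2
      rw [sum_siteDrift_of_le hA hF h2 h1]
      congr 1
      refine Finset.sum_congr rfl fun k _ => ?_
      rw [one_mul, show h ω k + 1 + (h ω (k + 1) - h ω k - 1) = h ω (k + 1) by ring]
    rw [integral_congr_ae h1, integral_const_mul, integral_finsetSum]
    · congr 1
      · norm_num
      refine Finset.sum_congr rfl fun k hk' => ?_
      rw [hw.integral_increment_pos (hsub k hk')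
        (Ψ := fun a l => A (k, a + 1) - A (k + 1, a + 1 + l)) (C := 1)
        (fun a l => abs_weight_sub_le hA₀ hA₁ _ _), ← integral_sub]
      · congr 2
        ext ω
        rw [one_mul, show h ω k + 1 + (h ω (k + 1) - h ω k) = h ω (k + 1) + 1 by ring]
        rfl
      · exact integrable_weight hA₀ hA₁ ((hw.measurable _).add_const _)
      · exact integrable_weight hA₀ hA₁ ((hw.measurable _).add_const _)
    · intro k _
      have hmk := hw.measurable_increment k
      refine Integrable.of_bound (C := 1) ?_ (Eventually.of_forall fun ω => ?_)
      · refine Measurable.aestronglyMeasurable ?_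
        have : Measurable fun p : ℤ × ℤ => if 0 < p.2 then
          A (k, p.1 + 1) - A (k + 1, p.1 + 1 + (p.2 - 1)) else 0 := measurable_of_countable _
        exact this.comp ((hw.measurable k).prodMk hmk)
      · split_ifs
        · exact abs_weight_sub_le hA₀ hA₁ _ _
        · simp
  · subst he
    have hmono : ∀ᵐ ω ∂P, ∀ k ∈ Ico k₀ k₁, h ω (k + 1) ≤ h ω k := by
      filter_upwards [hw.ae_increment_nonneg] with ω hω k hk'
      have := hω k ⟨by have := hk'.1; omega, by have := hk'.2; omega⟩
      omega
    -- Here `h (k + 1) + 1 = h k - (ξ - 1)` becomes `h k - ξ = h (k + 1)`: both corners have offset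
    -- `0`, and the difference has the opposite sign.
    have h1 : ∀ᵐ ω ∂P, ∑ x ∈ F, A x * siteDrift (σ ω) x = 1 / 2 * ∑ k ∈ Finset.Ico k₀ k₁,
        if 0 < -1 * (h ω (k + 1) - h ω k) then
          A (k + 1, h ω k - (-1 * (h ω (k + 1) - h ω k) - 1)) - A (k, h ω k) else 0 := by
      filter_upwards [hmono, hσ] with ω h1 h2
      rw [sum_siteDrift_of_ge hA hF h2 h1]
      congr 1
      refine Finset.sum_congr rfl fun k _ => ?_
      rw [show h ω k - (-1 * (h ω (k + 1) - h ω k) - 1) = h ω (k + 1) + 1 by ring,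
        show -1 * (h ω (k + 1) - h ω k) = h ω k - h ω (k + 1) by ring]
    rw [integral_congr_ae h1, integral_const_mul, integral_finsetSum]
    · rw [show (((-1 : ℤ) : ℝ) / 2) = (1 / 2) * (-1) by norm_num, mul_assoc]
      congr 1
      rw [Finset.mul_sum]
      refine Finset.sum_congr rfl fun k hk' => ?_
      rw [hw.integral_increment_pos (hsub k hk')
        (Ψ := fun a l => A (k + 1, a - l) - A (k, a)) (C := 1)
        (fun a l => abs_weight_sub_le hA₀ hA₁ _ _), mul_left_comm]
      congr 1
      rw [neg_one_mul, neg_sub, ← integral_sub]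
      · congr 1
        ext ω
        rw [show h ω k - (-1 * (h ω (k + 1) - h ω k)) = h ω (k + 1) by ring]
        simp [cornerOffset]
      · exact integrable_weight hA₀ hA₁ ((hw.measurable _).add_const _)
      · exact integrable_weight hA₀ hA₁ ((hw.measurable _).add_const _)
    · intro k _
      have hmk := hw.measurable_increment k
      refine Integrable.of_bound (C := 1) ?_ (Eventually.of_forall fun ω => ?_)
      · refine Measurable.aestronglyMeasurable ?_
        have : Measurable fun p : ℤ × ℤ => if 0 < p.2 then
          A (k + 1, p.1 - (p.2 - 1)) - A (k, p.1) else 0 := measurable_of_countable _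
        exact this.comp ((hw.measurable k).prodMk hmk)
      · split_ifs
        · exact abs_weight_sub_le hA₀ hA₁ _ _
        · simp

end IsGeometricWalk

/-! ### The walk of Spohn's initial condition -/

theorem sum_Ico_succ_sub (v : ℤ → ℤ) {m k : ℤ} (hmk : m ≤ k) :
    ∑ i ∈ Finset.Ico m k, (v (i + 1) - v i) = v k - v m := by
  induction k, hmk using Int.leInduction with
  | base => simp
  | succ k hk ih =>
    rw [← Finset.insert_Ico_right_eq_Ico_add_one hk, Finset.sum_insert (by simp), ih]
    ring

/-- The height at `k` is the reference height plus the increments before `k`. The former is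
independent of all later increments together and the latter are independent of the `k`-th one, so
the position is independent of the next increment. -/
theorem isGeometricWalk_of_indep {Ω : Type*} [MeasurableSpace Ω] {P : Measure Ω}
    [IsProbabilityMeasure P] {h : Ω → ℤ → ℤ} {e : ℤ} {q : ℤ → ℝ} {m M : ℤ}
    (hmeas : ∀ k, Measurable fun ω => h ω k) (he : e = 1 ∨ e = -1) (hq : ∀ k, 0 ≤ q k)
    (hlaw : ∀ k ∈ Ico m M, ∀ l, P.real {ω | e * (h ω (k + 1) - h ω k) = l} = geometricWeight (q k) l)
    {p : ℤ → Prop} (hp : ∀ k ∈ Ico m M, p k)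
    (hinc : iIndepFun (fun (k : {k : ℤ // p k}) (ω : Ω) => h ω (k + 1) - h ω k) P)
    (href : IndepFun (fun ω => h ω m)
      (fun (ω : Ω) (k : {k : ℤ // m ≤ k ∧ p k}) => h ω (k + 1) - h ω k) P) :
    IsGeometricWalk P h e q m M where
  measurable := hmeas
  sign := he
  nonneg := hq
  law k hk := isGeometric_map (((hmeas _).sub (hmeas _)).const_mul e) (hlaw k hk)
  indep_increments k hk l hl hkl :=
    (hinc.indepFun (i := ⟨k, hp k hk⟩) (j := ⟨l, hp l hl⟩) (by simpa using hkl)).comp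
      (φ := fun z => e * z) (ψ := fun z => e * z) (measurable_of_countable _)
      (measurable_of_countable _)
  indep_position k hk := by
    classical
    have hmI : ∀ k, Measurable fun ω => h ω (k + 1) - h ω k := fun k => (hmeas _).sub (hmeas _)
    have hpk : ∀ i ∈ Finset.Ico m k, p i := fun i hi => by
      rw [Finset.mem_Ico] at hi
      exact hp i ⟨hi.1, hi.2.trans hk.2⟩
    have h1 : IndepFun (fun ω => ∑ i ∈ Finset.Ico m k, (h ω (i + 1) - h ω i))
        (fun ω => h ω (k + 1) - h ω k) P := by
      have h2 := hinc.indepFun_finsetSum_of_notMem (fun i => hmI i)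
        (s := (Finset.Ico m k).subtype p) (i := ⟨k, hp k hk⟩) (by simp)
      convert h2 using 1
      ext ω
      rw [Finset.sum_apply]
      exact (Finset.sum_subtype_of_mem (fun i => h ω (i + 1) - h ω i) hpk).symm
    have h3 : IndepFun (fun ω => h ω m) (fun ω => (∑ i ∈ Finset.Ico m k, (h ω (i + 1) - h ω i),
        h ω (k + 1) - h ω k)) P := by
      have h4 : Measurable fun v : {k : ℤ // m ≤ k ∧ p k} → ℤ =>
          (∑ i ∈ (Finset.Ico m k).subtype (fun k => m ≤ k ∧ p k), v i, v ⟨k, hk.1, hp k hk⟩) := by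
        fun_prop
      have h5 := href.comp measurable_id h4
      convert h5 using 1
      · rfl
      · ext ω : 1
        exact Prod.ext (Finset.sum_subtype_of_mem (p := fun k => m ≤ k ∧ p k)
          (fun i => h ω (i + 1) - h ω i)
          (fun i hi => ⟨(Finset.mem_Ico.1 hi).1, hpk i hi⟩)).symm rfl
    have h6 := (IndepFun.assoc_of_prodMk (hmeas m)
      (Finset.measurable_sum _ fun i _ => hmI i) (hmI k) h3 h1).comp
      (φ := fun z => z.1 + z.2) (ψ := fun z => e * z) (measurable_of_countable _)
      (measurable_of_countable _)
    convert h6 using 1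
    · ext ω
      simp only [Function.comp]
      rw [sum_Ico_succ_sub _ hk.1]
      ring
    · rfl

/-! ### Jordan curves that are locally graphs -/

theorem Function.Periodic.deriv_periodic {E : Type*} [NormedAddCommGroup E] [NormedSpace ℝ E]
    {f : ℝ → E} {c : ℝ} (hf : Function.Periodic f c) : Function.Periodic (deriv f) c := by
  intro x
  rw [← deriv_comp_add_const, funext hf]

namespace IsC2JordanCurve
variable {φ : ℝ → ℂ} {D : Set ℂ} (hφ : IsC2JordanCurve φ D)
include hφ

theorem hasDerivAt (τ : ℝ) : HasDerivAt φ (deriv φ τ) τ :=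
  (hφ.contDiff.differentiable (by norm_num) τ).hasDerivAt

theorem contDiff_deriv : ContDiff ℝ 1 (deriv φ) := by
  have h := hφ.contDiff
  rw [show (2 : WithTop ℕ∞) = 1 + 1 by norm_num] at h
  exact (contDiff_succ_iff_deriv.1 h).2.2

theorem hasDerivAt_deriv (τ : ℝ) : HasDerivAt (deriv φ) (deriv (deriv φ) τ) τ :=
  (hφ.contDiff_deriv.differentiable (by norm_num) τ).hasDerivAt

theorem hasDerivAt_re (τ : ℝ) : HasDerivAt (fun τ => (φ τ).re) (deriv φ τ).re τ :=
  (Complex.reCLM.hasFDerivAt.comp_hasDerivAt τ (hφ.hasDerivAt τ))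

theorem hasDerivAt_im (τ : ℝ) : HasDerivAt (fun τ => (φ τ).im) (deriv φ τ).im τ :=
  (Complex.imCLM.hasFDerivAt.comp_hasDerivAt τ (hφ.hasDerivAt τ))

theorem coe_eq_coe {τ τ' : ℝ} (h : φ τ = φ τ') : (τ : AddCircle (1 : ℝ)) = τ' := by
  obtain ⟨u, hu, hu'⟩ := AddCircle.eq_coe_Ico (τ : AddCircle (1 : ℝ))
  obtain ⟨v, hv, hv'⟩ := AddCircle.eq_coe_Ico (τ' : AddCircle (1 : ℝ))
  have key : ∀ x y : ℝ, (x : AddCircle (1 : ℝ)) = y → φ x = φ y := fun x y hxy =>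
    congrArg hφ.periodic.lift hxy
  rw [← hu', ← hv']
  congr 1
  refine hφ.injOn hu hv ?_
  rw [key _ _ hu', key _ _ hv', h]

/-- A continuous injection of the compact circle into a Hausdorff space. -/
theorem isClosedEmbedding_lift : IsClosedEmbedding (hφ.periodic.lift : AddCircle (1 : ℝ) → ℂ) := by
  refine Continuous.isClosedEmbedding ?_ ?_
  · exact continuous_coinduced_dom.2 hφ.contDiff.continuous
  · intro x y
    induction x using QuotientAddGroup.induction_on with | _ x =>
    induction y using QuotientAddGroup.induction_on with | _ y =>
    exact fun h => hφ.coe_eq_coe h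

end IsC2JordanCurve

/-! ### The slope of the graph and the slope of the curve -/

/-- The graph of `f` over `[a, b]`, as a set of complex numbers. -/
def graphSet (f : ℝ → ℝ) (a b : ℝ) : Set ℂ := {z | z.re ∈ Icc a b ∧ z.im = f z.re}

/-- The slope of the curve `φ` at the parameter `τ`. -/
def curveSlope (φ : ℝ → ℂ) (τ : ℝ) : ℝ := (deriv φ τ).im / (deriv φ τ).re

section
variable {φ : ℝ → ℂ} {D : Set ℂ} (hφ : IsC2JordanCurve φ D) {V : Set ℂ} {a b : ℝ} {f : ℝ → ℝ}
include hφ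

/-- Along the parameters that map into the graph, the ordinate is `f` of the abscissa. The chain
rule within this set determines the derivative, because derivatives are unique at an accumulation
point. -/
theorem IsC2JordanCurve.im_deriv_eq {p τ : ℝ} (hp : HasDerivWithinAt f p (Icc a b) (φ τ).re)
    (hacc : AccPt τ (𝓟 (φ ⁻¹' graphSet f a b))) : (deriv φ τ).im = p * (deriv φ τ).re := by
  have hτ : τ ∈ closure (φ ⁻¹' graphSet f a b) := mem_closure_iff_clusterPt.2 hacc.clusterPt
  have h1 : HasDerivWithinAt (f ∘ fun τ => (φ τ).re) (p * (deriv φ τ).re)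
      (φ ⁻¹' graphSet f a b) τ :=
    hp.comp τ (hφ.hasDerivAt_re τ).hasDerivWithinAt fun x hx => hx.1
  have h2 := (hφ.hasDerivAt_im τ).hasDerivWithinAt (s := φ ⁻¹' graphSet f a b)
  refine (uniqueDiffWithinAt_iff_accPt.2 hacc).eq_deriv _ h2 (h1.congr_of_eventuallyEq ?_ ?_)
  · filter_upwards [self_mem_nhdsWithin] with x hx using hx.2
  -- The parameter `τ` is not assumed to map into the graph, so the identity at `τ` itself is
  -- obtained by continuity.
  · have hc1 : Tendsto (fun τ => (φ τ).im) (𝓝[φ ⁻¹' graphSet f a b] τ) (𝓝 (φ τ).im) :=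
      (hφ.hasDerivAt_im τ).continuousAt.tendsto.mono_left nhdsWithin_le_nhds
    have hc2 := h1.continuousWithinAt.tendsto
    have : (𝓝[φ ⁻¹' graphSet f a b] τ).NeBot := mem_closure_iff_nhdsWithin_neBot.1 hτ
    refine tendsto_nhds_unique hc1 (hc2.congr' ?_)
    filter_upwards [self_mem_nhdsWithin] with x hx using hx.2.symm

/-- Differentiability of `f` excludes a vertical tangent: a vanishing horizontal component would
make the whole derivative vanish, against regularity. -/
theorem IsC2JordanCurve.re_deriv_ne_zero {p τ : ℝ} (hp : HasDerivWithinAt f p (Icc a b) (φ τ).re)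
    (hacc : AccPt τ (𝓟 (φ ⁻¹' graphSet f a b))) : (deriv φ τ).re ≠ 0 := by
  intro h
  have h1 := hφ.im_deriv_eq hp hacc
  rw [h, mul_zero] at h1
  exact hφ.regular τ (Complex.ext h h1)

variable (hgraph : range φ ∩ V = graphSet f a b) (hdiff : DifferentiableOn ℝ f (Icc a b))
include hgraph

theorem IsC2JordanCurve.exists_param : ∃ T : ℝ → AddCircle (1 : ℝ),
    ∀ u ∈ Icc a b, hφ.periodic.lift (T u) = (⟨u, f u⟩ : ℂ) := by
  have : ∀ u, ∃ x : AddCircle (1 : ℝ), u ∈ Icc a b → hφ.periodic.lift x = (⟨u, f u⟩ : ℂ) := by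
    intro u
    by_cases hu : u ∈ Icc a b
    · have h1 : (⟨u, f u⟩ : ℂ) ∈ graphSet f a b := ⟨hu, rfl⟩
      rw [← hgraph] at h1
      obtain ⟨τ, hτ⟩ := h1.1
      exact ⟨τ, fun _ => hτ⟩
    · exact ⟨0, fun h => absurd h hu⟩
  choose T hT using this
  exact ⟨T, hT⟩

include hdiff

omit hgraph in
theorem IsC2JordanCurve.continuousOn_param {T : ℝ → AddCircle (1 : ℝ)}
    (hT : ∀ u ∈ Icc a b, hφ.periodic.lift (T u) = (⟨u, f u⟩ : ℂ)) : ContinuousOn T (Icc a b) := by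
  rw [hφ.isClosedEmbedding_lift.isInducing.continuousOn_iff]
  have h1 : ContinuousOn (fun u : ℝ => (u : ℂ) + (f u : ℂ) * Complex.I) (Icc a b) :=
    Complex.continuous_ofReal.continuousOn.add
      ((Complex.continuous_ofReal.comp_continuousOn hdiff.continuousOn).mul continuousOn_const)
  refine h1.congr fun u hu => ?_
  rw [Function.comp, hT u hu, Complex.mk_eq_add_mul_I]

/-- The circle parameter depends continuously on the abscissa, and `[a, b]` has no isolated point;
openness of the quotient map brings this back to real parameters. The end points are included, since
the heights are anchored near `a`. -/
theorem IsC2JordanCurve.accPt (hab : a < b) {τ : ℝ} (hτ : φ τ ∈ graphSet f a b) :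
    AccPt τ (𝓟 (φ ⁻¹' graphSet f a b)) := by
  obtain ⟨T, hT⟩ := hφ.exists_param hgraph
  have hTc := hφ.continuousOn_param hdiff hT
  set u₀ := (φ τ).re
  have hu₀ : u₀ ∈ Icc a b := hτ.1
  have hτ₀ : φ τ = (⟨u₀, f u₀⟩ : ℂ) := Complex.ext rfl hτ.2
  have hT₀ : T u₀ = (τ : AddCircle (1 : ℝ)) := by
    refine hφ.isClosedEmbedding_lift.injective ?_
    rw [hT _ hu₀, ← hτ₀]; rfl
  rw [accPt_iff_nhds]
  intro U hU
  have h1 : ((↑) : ℝ → AddCircle (1 : ℝ)) '' U ∈ 𝓝 (T u₀) := by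
    rw [hT₀]
    exact QuotientAddGroup.isOpenMap_coe.image_mem_nhds hU
  have h2 : ∀ᶠ u in 𝓝[Icc a b \ {u₀}] u₀, T u ∈ ((↑) : ℝ → AddCircle (1 : ℝ)) '' U :=
    ((hTc u₀ hu₀).mono sdiff_subset).eventually h1
  have h3 : (𝓝[Icc a b \ {u₀}] u₀).NeBot := by
    rw [← accPt_principal_iff_nhdsWithin]
    exact uniqueDiffWithinAt_iff_accPt.1 (uniqueDiffOn_Icc hab u₀ hu₀)
  obtain ⟨u, ⟨τ', hτ', hu'⟩, hu, hne⟩ := (h2.and self_mem_nhdsWithin).exists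
  have h4 : φ τ' = (⟨u, f u⟩ : ℂ) := by
    rw [← hT u hu, ← hu']; rfl
  refine ⟨τ', ⟨hτ', ?_⟩, ?_⟩
  · rw [mem_preimage, h4]
    exact ⟨hu, rfl⟩
  · rintro rfl
    apply hne
    rw [mem_singleton_iff]
    exact (congrArg Complex.re h4).symm

/-- The slope of the graph is the slope of the curve. -/
theorem IsC2JordanCurve.derivWithin_eq (hab : a < b) {τ : ℝ} (hτ : φ τ ∈ graphSet f a b) :
    (deriv φ τ).re ≠ 0 ∧ derivWithin f (Icc a b) (φ τ).re = curveSlope φ τ := by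
  have hp := (hdiff (φ τ).re hτ.1).hasDerivWithinAt
  have hacc := hφ.accPt hgraph hdiff hab hτ
  have h1 := hφ.re_deriv_ne_zero hp hacc
  refine ⟨h1, ?_⟩
  rw [curveSlope, eq_div_iff h1, hφ.im_deriv_eq hp hacc]

/-- Only differentiability of `f` is assumed; continuity of its derivative comes from the curve,
through the quotient of the components of `deriv φ` at the circle parameter. -/
theorem IsC2JordanCurve.continuousOn_derivWithin (hab : a < b) :
    ContinuousOn (derivWithin f (Icc a b)) (Icc a b) := by
  obtain ⟨T, hT⟩ := hφ.exists_param hgraph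
  have hTc := hφ.continuousOn_param hdiff hT
  have hper : Function.Periodic (deriv φ) 1 := hφ.periodic.deriv_periodic
  set G : AddCircle (1 : ℝ) → ℂ := hper.lift with hG
  have hGc : Continuous G := continuous_coinduced_dom.2 hφ.contDiff_deriv.continuous
  have key : ∀ u ∈ Icc a b, (G (T u)).re ≠ 0 ∧
      derivWithin f (Icc a b) u = (G (T u)).im / (G (T u)).re := by
    intro u hu
    obtain ⟨τ, hτ⟩ := QuotientAddGroup.mk_surjective (T u)
    have h1 : φ τ = (⟨u, f u⟩ : ℂ) := by
      rw [← hT u hu, ← hτ]; rfl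
    have h2 := hφ.derivWithin_eq hgraph hdiff hab (τ := τ) (by rw [h1]; exact ⟨hu, rfl⟩)
    rw [← hτ]
    rw [h1] at h2
    exact h2
  have hGT : ContinuousOn (fun u => G (T u)) (Icc a b) := hGc.comp_continuousOn hTc
  refine ContinuousOn.congr ?_ fun u hu => (key u hu).2
  exact (Complex.continuous_im.comp_continuousOn hGT).div
    (Complex.continuous_re.comp_continuousOn hGT) fun u hu => (key u hu).1

variable {t : ℝ} (hV : V ∈ 𝓝 (φ t))
include hV

omit hdiff in
theorem IsC2JordanCurve.eventually_mem_graphSet : ∀ᶠ τ in 𝓝 t, φ τ ∈ graphSet f a b := by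
  filter_upwards [hφ.contDiff.continuous.continuousAt.eventually_mem hV] with τ hτ
  rw [← hgraph]
  exact ⟨mem_range_self τ, hτ⟩

theorem IsC2JordanCurve.re_deriv_ne_zero_of_nhds : (deriv φ t).re ≠ 0 := by
  have h1 := hφ.eventually_mem_graphSet hgraph hV
  refine hφ.re_deriv_ne_zero (hdiff _ h1.self_of_nhds.1).hasDerivWithinAt ?_
  rw [accPt_iff_nhds]
  intro U hU
  have h2 : ∀ᶠ τ in 𝓝[≠] t, τ ∈ U ∧ φ τ ∈ graphSet f a b ∧ τ ≠ t :=
    ((eventually_mem_set.2 hU).filter_mono nhdsWithin_le_nhds).and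
      ((h1.filter_mono nhdsWithin_le_nhds).and self_mem_nhdsWithin)
  obtain ⟨τ, h3, h4, h5⟩ := h2.exists
  exact ⟨τ, ⟨h3, h4⟩, h5⟩

/-- Near `φ t` the curve can be parametrized by the abscissa. -/
theorem IsC2JordanCurve.exists_local_param : ∃ g : ℝ → ℝ, ContDiffAt ℝ 2 g (φ t).re ∧
    g (φ t).re = t ∧ HasDerivAt g (deriv φ t).re⁻¹ (φ t).re ∧
    ∀ᶠ u in 𝓝 (φ t).re, u ∈ Icc a b ∧ φ (g u) = (⟨u, f u⟩ : ℂ) := by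
  have hne := hφ.re_deriv_ne_zero_of_nhds hgraph hdiff hV
  -- The abscissa has nonzero derivative at `t`, so the inverse function theorem applies; the local
  -- inverse is `C²`.
  set x : ℝ → ℝ := fun τ => (φ τ).re with hx
  have hxc : ContDiffAt ℝ 2 x t := (Complex.reCLM.contDiff.comp hφ.contDiff).contDiffAt
  have hxd : HasDerivAt x (deriv φ t).re t := hφ.hasDerivAt_re t
  have hxs : HasStrictDerivAt x (deriv φ t).re t := hxc.hasStrictDerivAt' hxd (by norm_num)
  have h0 : HasFDerivAt x (((ContinuousLinearEquiv.unitsEquivAut ℝ) (Units.mk0 _ hne) :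
    ℝ ≃L[ℝ] ℝ) : ℝ →L[ℝ] ℝ) t := (hxs.hasStrictFDerivAt_equiv hne).hasFDerivAt
  refine ⟨hxc.localInverse h0 (by norm_num), hxc.to_localInverse h0 (by norm_num),
    hxc.localInverse_apply_image h0 (by norm_num), ?_, ?_⟩
  · exact (hxs.to_localInverse hne).hasDerivAt
  · have h1 := hxs.eventually_right_inverse hne
    have h2 : Tendsto (hxs.localInverse x _ t hne) (𝓝 (x t)) (𝓝 t) :=
      (hxs.hasStrictFDerivAt_equiv hne).localInverse_tendsto
    have h3 := h2.eventually (hφ.eventually_mem_graphSet hgraph hV)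
    filter_upwards [h1, h3] with u hu1 hu2
    have hu1' : (φ (hxs.localInverse x _ t hne u)).re = u := hu1
    have h4 := hu2.1
    have h5 := hu2.2
    rw [hu1'] at h4 h5
    exact ⟨h4, Complex.ext hu1' h5⟩

theorem IsC2JordanCurve.Icc_mem_nhds : Icc a b ∈ 𝓝 (φ t).re := by
  obtain ⟨g, -, -, -, h⟩ := hφ.exists_local_param hgraph hdiff hV
  filter_upwards [h] with u hu using hu.1

theorem IsC2JordanCurve.re_mem_Ioo : (φ t).re ∈ Ioo a b := by
  rw [← interior_Icc]
  exact mem_interior_iff_mem_nhds.2 (hφ.Icc_mem_nhds hgraph hdiff hV)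

/-- The slope of the graph is continuously differentiable near `φ t`. -/
theorem IsC2JordanCurve.derivWithin_regular :
    ContDiffAt ℝ 1 (derivWithin f (Icc a b)) (φ t).re ∧
    derivWithin f (Icc a b) (φ t).re = curveSlope φ t ∧
    HasDerivAt (derivWithin f (Icc a b)) (((deriv φ t).re * (deriv (deriv φ) t).im -
      (deriv (deriv φ) t).re * (deriv φ t).im) / (deriv φ t).re ^ 3) (φ t).re := by
  have hne := hφ.re_deriv_ne_zero_of_nhds hgraph hdiff hV
  have hI := hφ.re_mem_Ioo hgraph hdiff hV
  have hab := hI.1.trans hI.2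
  obtain ⟨g, hg, hgt, hgd, hgφ⟩ := hφ.exists_local_param hgraph hdiff hV
  have hev : derivWithin f (Icc a b) =ᶠ[𝓝 (φ t).re] fun u => curveSlope φ (g u) := by
    filter_upwards [hgφ] with u hu
    have h1 := hφ.derivWithin_eq hgraph hdiff hab (τ := g u) (by rw [hu.2]; exact ⟨hu.1, rfl⟩)
    rw [← h1.2, hu.2]
  have hre : ContDiff ℝ 1 fun τ => (deriv φ τ).re := Complex.reCLM.contDiff.comp hφ.contDiff_deriv
  have him : ContDiff ℝ 1 fun τ => (deriv φ τ).im := Complex.imCLM.contDiff.comp hφ.contDiff_deriv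
  refine ⟨ContDiffAt.congr_of_eventuallyEq ?_ hev, ?_, HasDerivAt.congr_of_eventuallyEq ?_ hev⟩
  · have h2 : ContDiffAt ℝ 1 (curveSlope φ) (g (φ t).re) := by
      rw [hgt]
      exact him.contDiffAt.div hre.contDiffAt hne
    exact h2.comp (φ t).re (hg.of_le (by norm_num))
  · rw [hev.self_of_nhds]
    dsimp only
    rw [hgt]
  · have h3 : HasDerivAt (fun τ => (deriv φ τ).re) (deriv (deriv φ) t).re t :=
      (Complex.reCLM.hasFDerivAt.comp_hasDerivAt t (hφ.hasDerivAt_deriv t))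
    have h4 : HasDerivAt (fun τ => (deriv φ τ).im) (deriv (deriv φ) t).im t :=
      (Complex.imCLM.hasFDerivAt.comp_hasDerivAt t (hφ.hasDerivAt_deriv t))
    -- The quotient rule gives denominator `x'²`, and the derivative `1/x'` of the local inverse
    -- raises it to `x'³`.
    have h5 := h4.div h3 hne
    rw [← hgt] at h5
    have h6 := h5.comp (φ t).re hgd
    rw [hgt] at h6
    refine h6.congr_deriv ?_
    field_simp
end

/-! ### Small circles centred on the curve -/

/-- The point of the graph of `f` over `u`. -/
def graphPoint (f : ℝ → ℝ) (u : ℝ) : ℂ := ⟨u, f u⟩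

theorem graphPoint_mem {f : ℝ → ℝ} {a b u : ℝ} (hu : u ∈ Icc a b) :
    graphPoint f u ∈ graphSet f a b := ⟨hu, rfl⟩

theorem graphPoint_re {f : ℝ → ℝ} {a b : ℝ} {z : ℂ} (hz : z ∈ graphSet f a b) :
    graphPoint f z.re = z := Complex.ext rfl hz.2.symm

theorem abs_sub_le_dist_graphPoint (f : ℝ → ℝ) (u v : ℝ) :
    |u - v| ≤ dist (graphPoint f u) (graphPoint f v) := by
  rw [Complex.dist_eq]
  exact Complex.abs_re_le_norm (graphPoint f u - graphPoint f v)

theorem dist_graphPoint_lt {f : ℝ → ℝ} {u v c : ℝ} (h : |u - c| < |v - c|)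
    (h' : |f u - f c| ≤ |f v - f c|) :
    dist (graphPoint f u) (graphPoint f c) < dist (graphPoint f v) (graphPoint f c) := by
  rw [Complex.dist_eq_re_im, Complex.dist_eq_re_im]
  refine Real.sqrt_lt_sqrt (by positivity) ?_
  have h1 := sq_lt_sq.2 h
  have h2 := sq_le_sq.2 h'
  exact add_lt_add_of_lt_of_le h1 h2

theorem continuousOn_graphPoint {f : ℝ → ℝ} {I : Set ℝ} (hf : ContinuousOn f I) :
    ContinuousOn (graphPoint f) I := by
  have h1 : ContinuousOn (fun u : ℝ => (u : ℂ) + (f u : ℂ) * Complex.I) I :=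
    Complex.continuous_ofReal.continuousOn.add
      ((Complex.continuous_ofReal.comp_continuousOn hf).mul continuousOn_const)
  refine h1.congr fun u _ => ?_
  rw [graphPoint, Complex.mk_eq_add_mul_I]

section
variable {f : ℝ → ℝ} {a b : ℝ} (hmono : MonotoneOn f (Icc a b) ∨ AntitoneOn f (Icc a b))
include hmono

/-- On a monotone graph both coordinates move away from the centre together, so the distance
strictly increases on each side. This makes the crossing unique on each side. -/
theorem dist_graphPoint_lt_of_right {c u v : ℝ} (hc : c ∈ Icc a b) (hu : u ∈ Icc a b)
    (hv : v ∈ Icc a b) (hcu : c ≤ u) (huv : u < v) :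
    dist (graphPoint f u) (graphPoint f c) < dist (graphPoint f v) (graphPoint f c) := by
  refine dist_graphPoint_lt ?_ ?_
  · rw [abs_of_nonneg (by linarith), abs_of_nonneg (by linarith)]
    linarith
  · rcases hmono with h | h
    · have h1 := h hc hu hcu
      have h2 := h hu hv huv.le
      rw [abs_of_nonneg (by linarith), abs_of_nonneg (by linarith)]
      linarith
    · have h1 := h hc hu hcu
      have h2 := h hu hv huv.le
      rw [abs_of_nonpos (by linarith), abs_of_nonpos (by linarith)]
      linarith

theorem dist_graphPoint_lt_of_left {c u v : ℝ} (hc : c ∈ Icc a b) (hu : u ∈ Icc a b)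
    (hv : v ∈ Icc a b) (huc : u ≤ c) (hvu : v < u) :
    dist (graphPoint f u) (graphPoint f c) < dist (graphPoint f v) (graphPoint f c) := by
  refine dist_graphPoint_lt ?_ ?_
  · rw [abs_of_nonpos (by linarith), abs_of_nonpos (by linarith)]
    linarith
  · rcases hmono with h | h
    · have h1 := h hu hc huc
      have h2 := h hv hu hvu.le
      rw [abs_of_nonpos (by linarith), abs_of_nonpos (by linarith)]
      linarith
    · have h1 := h hu hc huc
      have h2 := h hv hu hvu.le
      rw [abs_of_nonneg (by linarith), abs_of_nonneg (by linarith)]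
      linarith
end

/-- The circle of radius `r` about the point of the graph over `c` crosses the curve `γ` exactly
over `uL < c` and over `uR > c`. -/
structure IsGraphCrossing (γ : Set ℂ) (f : ℝ → ℝ) (a b c r uL uR : ℝ) : Prop where
  mem_left : uL ∈ Icc a b
  mem_right : uR ∈ Icc a b
  left_lt : uL < c
  lt_right : c < uR
  dist_left : dist (graphPoint f uL) (graphPoint f c) = r
  dist_right : dist (graphPoint f uR) (graphPoint f c) = r
  inter_eq : Metric.sphere (graphPoint f c) r ∩ γ = {graphPoint f uL, graphPoint f uR}

/-- Existence is the intermediate value theorem: the distance to the centre is `0` at `c` and at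
least `r` at `c ± r`. Uniqueness is its strict monotonicity, and for small `r` the circle lies in
`V`, where the curve is the graph. -/
theorem eventually_exists_graphCrossing {γ V : Set ℂ} {f : ℝ → ℝ} {a b c : ℝ}
    (hgraph : γ ∩ V = graphSet f a b) (hV : V ∈ 𝓝 (graphPoint f c)) (hc : c ∈ Ioo a b)
    (hf : ContinuousOn f (Icc a b)) (hmono : MonotoneOn f (Icc a b) ∨ AntitoneOn f (Icc a b)) :
    ∀ᶠ r in 𝓝[>] (0 : ℝ), ∃ uL uR, IsGraphCrossing γ f a b c r uL uR := by
  obtain ⟨ρ, hρ, hball⟩ := Metric.mem_nhds_iff.1 hV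
  have hc' : c ∈ Icc a b := Ioo_subset_Icc_self hc
  have hpos : 0 < min ρ (min (c - a) (b - c)) :=
    lt_min hρ (lt_min (by linarith [hc.1]) (by linarith [hc.2]))
  filter_upwards [Ioo_mem_nhdsGT hpos] with r hr
  obtain ⟨hr0, hr1⟩ := hr
  rw [lt_min_iff, lt_min_iff] at hr1
  obtain ⟨hrρ, hra, hrb⟩ := hr1
  have hcont : ContinuousOn (fun u => dist (graphPoint f u) (graphPoint f c)) (Icc a b) :=
    continuous_dist.comp_continuousOn ((continuousOn_graphPoint hf).prodMk continuousOn_const)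
  have hle : ∀ v, |v - c| = r → r ≤ dist (graphPoint f v) (graphPoint f c) := fun v hv => by
    rw [← hv]; exact abs_sub_le_dist_graphPoint f v c
  obtain ⟨uR, huR, hdR⟩ : ∃ u ∈ Icc c (c + r), dist (graphPoint f u) (graphPoint f c) = r := by
    have h1 := intermediate_value_Icc (a := c) (b := c + r) (by linarith)
      (hcont.mono (Icc_subset_Icc (by linarith [hc.1]) (by linarith)))
    refine h1 ⟨?_, hle _ ?_⟩
    · simpa using hr0.le
    · rw [add_sub_cancel_left, abs_of_pos hr0]
  obtain ⟨uL, huL, hdL⟩ : ∃ u ∈ Icc (c - r) c, dist (graphPoint f u) (graphPoint f c) = r := by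
    have h1 := intermediate_value_Icc' (a := c - r) (b := c) (by linarith)
      (hcont.mono (Icc_subset_Icc (by linarith) (by linarith [hc.2])))
    refine h1 ⟨?_, hle _ ?_⟩
    · simpa using hr0.le
    · rw [sub_sub_cancel_left, abs_neg, abs_of_pos hr0]
  have hne : ∀ u, dist (graphPoint f u) (graphPoint f c) = r → u ≠ c := by
    rintro u hu rfl
    rw [dist_self] at hu
    exact hr0.ne hu
  have hLI : uL ∈ Icc a b := ⟨by linarith [huL.1], by linarith [huL.2, hc.2]⟩
  have hRI : uR ∈ Icc a b := ⟨by linarith [huR.1, hc.1], by linarith [huR.2]⟩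
  refine ⟨uL, uR, hLI, hRI, lt_of_le_of_ne huL.2 (hne _ hdL), lt_of_le_of_ne huR.1
    (hne _ hdR).symm, hdL, hdR, ?_⟩
  have hsub : graphSet f a b ⊆ γ := by
    rw [← hgraph]; exact inter_subset_left
  ext z
  constructor
  · rintro ⟨hz1, hz2⟩
    have hzV : z ∈ V := hball (by rw [Metric.mem_ball, hz1]; exact hrρ)
    have hzg : z ∈ graphSet f a b := by rw [← hgraph]; exact ⟨hz2, hzV⟩
    have hz : graphPoint f z.re = z := graphPoint_re hzg
    have hz1' : dist (graphPoint f z.re) (graphPoint f c) = r := by rw [hz]; exact hz1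
    rcases le_total c z.re with h | h
    · right
      rw [mem_singleton_iff, ← hz]
      congr 1
      rcases lt_trichotomy z.re uR with h1 | h1 | h1
      · have := dist_graphPoint_lt_of_right hmono hc' hzg.1 hRI h h1
        linarith
      · exact h1
      · have := dist_graphPoint_lt_of_right hmono hc' hRI hzg.1 huR.1 h1
        linarith
    · left
      rw [← hz]
      congr 1
      rcases lt_trichotomy z.re uL with h1 | h1 | h1
      · have := dist_graphPoint_lt_of_left hmono hc' hLI hzg.1 huL.2 h1
        linarith
      · exact h1
      · have := dist_graphPoint_lt_of_left hmono hc' hzg.1 hLI h h1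
        linarith
  · rintro (rfl | rfl)
    · exact ⟨hdL, hsub (graphPoint_mem hLI)⟩
    · exact ⟨hdR, hsub (graphPoint_mem hRI)⟩

/-! ### Orientation of the curve and of the crossing points -/

section
variable {φ : ℝ → ℂ} {D : Set ℂ} (hφ : IsC2JordanCurve φ D) {V : Set ℂ} {a b : ℝ} {f : ℝ → ℝ}
  (hgraph : range φ ∩ V = graphSet f a b) (hdiff : DifferentiableOn ℝ f (Icc a b)) {t : ℝ}
  (hV : V ∈ 𝓝 (φ t))
include hφ hgraph hdiff hV

omit hdiff in
theorem IsC2JordanCurve.graphPoint_eq : graphPoint f (φ t).re = φ t :=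
  graphPoint_re (hφ.eventually_mem_graphSet hgraph hV).self_of_nhds

theorem IsC2JordanCurve.eventually_graphCrossing
    (hmono : MonotoneOn f (Icc a b) ∨ AntitoneOn f (Icc a b)) :
    ∀ᶠ r in 𝓝[>] (0 : ℝ), ∃ uL uR, IsGraphCrossing (range φ) f a b (φ t).re r uL uR :=
  eventually_exists_graphCrossing hgraph (by rwa [hφ.graphPoint_eq hgraph hV])
    (hφ.re_mem_Ioo hgraph hdiff hV) hdiff.continuousOn hmono

theorem IsC2JordanCurve.eventually_exists_crossingPair
    (hmono : MonotoneOn f (Icc a b) ∨ AntitoneOn f (Icc a b)) :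
    ∀ᶠ r in 𝓝[>] (0 : ℝ), ∃ x₀ x₁, IsCrossingPair φ t r x₀ x₁ := by
  obtain ⟨g, hg, hgt, -, hgφ⟩ := hφ.exists_local_param hgraph hdiff hV
  have hpt := hφ.graphPoint_eq hgraph hV
  have hne := hφ.re_deriv_ne_zero_of_nhds hgraph hdiff hV
  have hgc : Tendsto g (𝓝 (φ t).re) (𝓝 t) := by
    have := hg.continuousAt.tendsto
    rwa [hgt] at this
  have hslope := hasDerivAt_iff_tendsto_slope.1 (hφ.hasDerivAt_re t)
  have hsl : ∀ᶠ τ in 𝓝 t, τ ≠ t → 0 < (deriv φ t).re * slope (fun τ => (φ τ).re) t τ := by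
    have h1 := hslope.const_mul (deriv φ t).re
    exact eventually_nhdsWithin_iff.1 (h1.eventually_const_lt (mul_self_pos.2 hne))
  -- The parameter moves with or against the abscissa according to the sign of `(deriv φ t).re`; the
  -- bound `1 / 2` keeps the two crossing parameters within one period.
  have hnear : ∀ᶠ u in 𝓝 (φ t).re, φ (g u) = graphPoint f u ∧ |g u - t| < 1 / 2 ∧
      (u ≠ (φ t).re → 0 < (deriv φ t).re * ((u - (φ t).re) * (g u - t))) := by
    have h2 : ∀ᶠ τ in 𝓝 t, |τ - t| < 1 / 2 := by
      filter_upwards [Metric.ball_mem_nhds t (by norm_num : (0 : ℝ) < 1 / 2)] with τ hτ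
      rwa [Metric.mem_ball, Real.dist_eq] at hτ
    filter_upwards [hgφ, hgc.eventually hsl, hgc.eventually h2] with u h1 h2 h3
    refine ⟨h1.2, h3, fun hu => ?_⟩
    have h4 : g u ≠ t := by
      intro h
      rw [h] at h1
      exact hu (by rw [h1.2])
    have h5 := h2 h4
    rw [slope_def_field, h1.2] at h5
    dsimp only at h5
    have h6 : 0 < (g u - t) ^ 2 := by
      have := sub_ne_zero.2 h4
      positivity
    have h7 := mul_pos h5 h6
    have h8 := sub_ne_zero.2 h4
    field_simp at h7
    linarith
  obtain ⟨ρ, hρ, hball⟩ := Metric.eventually_nhds_iff.1 hnear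
  filter_upwards [hφ.eventually_graphCrossing hgraph hdiff hV hmono, Ioo_mem_nhdsGT hρ]
    with r ⟨uL, uR, hcr⟩ hr
  have hdL := abs_sub_le_dist_graphPoint f uL (φ t).re
  have hdR := abs_sub_le_dist_graphPoint f uR (φ t).re
  rw [hcr.dist_left] at hdL
  rw [hcr.dist_right] at hdR
  obtain ⟨hL1, hL2, hL3⟩ := hball (y := uL) (by rw [Real.dist_eq]; linarith [hr.2])
  obtain ⟨hR1, hR2, hR3⟩ := hball (y := uR) (by rw [Real.dist_eq]; linarith [hr.2])
  replace hL3 := hL3 hcr.left_lt.ne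
  replace hR3 := hR3 hcr.lt_right.ne'
  have hLneg := sub_neg.2 hcr.left_lt
  have hRpos := sub_pos.2 hcr.lt_right
  have hinter := hcr.inter_eq
  rw [hpt] at hinter
  rw [abs_lt] at hL2 hR2
  -- If the curve runs from right to left, the right crossing comes first.
  rcases lt_or_gt_of_ne hne with h | h
  · have h1 : 0 < g uL - t := by
      have := neg_of_mul_pos_right hL3 h.le
      exact pos_of_mul_neg_right this hLneg.le
    have h2 : g uR - t < 0 := by
      have := neg_of_mul_pos_right hR3 h.le
      exact neg_of_mul_neg_right this hRpos.le
    exact ⟨graphPoint f uR, graphPoint f uL, by rw [hinter, pair_comm], g uR, g uL, by linarith,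
      by linarith, by linarith, hR1, hL1⟩
  · have h1 : g uL - t < 0 := by
      have := pos_of_mul_pos_right hL3 h.le
      exact neg_of_mul_pos_right this hLneg.le
    have h2 : 0 < g uR - t := by
      have := pos_of_mul_pos_right hR3 h.le
      exact pos_of_mul_pos_right this hRpos.le
    exact ⟨graphPoint f uL, graphPoint f uR, hinter, g uL, g uR, by linarith, by linarith,
      by linarith, hL1, hR1⟩

/-- Starting along the inner normal `i φ'`, points lie in `D`, so `e * (f z.re - z.im)` grows from
`0` to nonnegative values. Its derivative, which is `-(e * x')` times a positive factor, is thus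
nonnegative. The sign of `e` encodes the side of `D`. -/
theorem IsC2JordanCurve.mul_re_deriv_neg {e : ℝ} (he : e ≠ 0)
    (hD : ∀ᶠ z in 𝓝 (φ t), z ∈ D → 0 ≤ e * (f z.re - z.im)) : e * (deriv φ t).re < 0 := by
  have hne := hφ.re_deriv_ne_zero_of_nhds hgraph hdiff hV
  have hI := hφ.Icc_mem_nhds hgraph hdiff hV
  have hgr := (hφ.eventually_mem_graphSet hgraph hV).self_of_nhds
  obtain ⟨-, hp, -⟩ := hφ.derivWithin_regular hgraph hdiff hV
  have hfd := (hdiff _ hgr.1).hasDerivWithinAt.hasDerivAt hI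
  rw [hp] at hfd
  set v := deriv φ t
  set F : ℝ → ℝ := fun ε => e * (f ((φ t).re - ε * v.im) - ε * v.re) with hF
  have hd : HasDerivAt F (e * (curveSlope φ t * (-v.im) - v.re)) 0 := by
    have h1 : HasDerivAt (fun ε : ℝ => (φ t).re - ε * v.im) (-v.im) 0 := by
      simpa using ((hasDerivAt_id (0 : ℝ)).mul_const v.im).const_sub (φ t).re
    have h2 : HasDerivAt (fun ε : ℝ => ε * v.re) v.re 0 := by
      simpa using (hasDerivAt_id (0 : ℝ)).mul_const v.re
    have h3 : HasDerivAt f (curveSlope φ t) ((φ t).re - 0 * v.im) := by simpa using hfd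
    exact ((h3.comp 0 h1).sub h2).const_mul e
  have hcont : Tendsto (fun ε : ℝ => φ t + ε * (Complex.I * v)) (𝓝[>] 0) (𝓝 (φ t)) := by
    have : Continuous fun ε : ℝ => φ t + ε * (Complex.I * v) := by fun_prop
    have h1 := this.tendsto 0
    simp only [Complex.ofReal_zero, zero_mul, add_zero] at h1
    exact h1.mono_left nhdsWithin_le_nhds
  have hnn : ∀ᶠ ε in 𝓝[>] (0 : ℝ), 0 ≤ slope F 0 ε := by
    filter_upwards [hcont.eventually hD, hφ.counterclockwise t, self_mem_nhdsWithin]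
      with ε h1 h2 h3
    have h4 := h1 h2
    simp only [Complex.add_re, Complex.add_im, Complex.mul_re, Complex.mul_im, Complex.ofReal_re,
      Complex.ofReal_im, Complex.I_re, Complex.I_im, hgr.2] at h4
    rw [slope_def_field]
    refine div_nonneg ?_ (by rw [sub_zero]; exact le_of_lt h3)
    simp only [hF, zero_mul, sub_zero]
    ring_nf at h4 ⊢
    linarith
  have hge := ge_of_tendsto ((hasDerivAt_iff_tendsto_slope.1 hd).mono_left
    (nhdsWithin_mono (0 : ℝ) (s := Ioi 0) fun x hx => ne_of_gt hx)) hnn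
  have h5 : e * (curveSlope φ t * (-v.im) - v.re) =
      -(e * v.re) * ((v.re ^ 2 + v.im ^ 2) / v.re ^ 2) := by
    have h6 : curveSlope φ t = v.im / v.re := rfl
    rw [h6]
    field_simp
    ring
  rw [h5] at hge
  have h6 : 0 < (v.re ^ 2 + v.im ^ 2) / v.re ^ 2 := by positivity
  have h7 := nonneg_of_mul_nonneg_left hge h6
  exact lt_of_le_of_ne (by linarith) (mul_ne_zero he hne)

/-- If the domain is below the graph, then the counterclockwise curve runs from right to left. -/
theorem IsC2JordanCurve.re_deriv_neg (hD : ∀ᶠ z in 𝓝 (φ t), z ∈ D ↔ z.im ≤ f z.re) :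
    (deriv φ t).re < 0 := by
  have h := hφ.mul_re_deriv_neg hgraph hdiff hV one_ne_zero (by
    filter_upwards [hD] with z hz hzD
    linarith [hz.1 hzD])
  linarith

/-- If the domain is above the graph, then the counterclockwise curve runs from left to right. -/
theorem IsC2JordanCurve.re_deriv_pos (hD : ∀ᶠ z in 𝓝 (φ t), z ∈ D ↔ f z.re ≤ z.im) :
    0 < (deriv φ t).re := by
  have h := hφ.mul_re_deriv_neg hgraph hdiff hV (e := -1) (by norm_num) (by
    filter_upwards [hD] with z hz hzD
    linarith [hz.1 hzD])
  linarith
end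

/-! ### Increments of a function between the crossing points -/

/-- By Pythagoras `r = |v r - c| * √(1 + slope²)`, so the quotient is a slope of `W` divided by the
length factor. Here `e = ±1` tells on which side of `c` the crossing lies. -/
theorem tendsto_div_radius {f : ℝ → ℝ} {c p : ℝ} (hf : HasDerivAt f p c) {W : ℝ → ℝ} {W' : ℝ}
    (hW : HasDerivAt W W' c) {v : ℝ → ℝ} {e : ℝ} (he : |e| = 1)
    (hv : ∀ᶠ r in 𝓝[>] (0 : ℝ), 0 < e * (v r - c) ∧
      dist (graphPoint f (v r)) (graphPoint f c) = r) :
    Tendsto (fun r => (W (v r) - W c) / r) (𝓝[>] 0) (𝓝 (e * W' / √(1 + p ^ 2))) := by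
  have hee : e * e = 1 := by rw [← abs_mul_abs_self, he, one_mul]
  have hvc : Tendsto v (𝓝[>] 0) (𝓝[≠] c) := by
    rw [tendsto_nhdsWithin_iff]
    constructor
    · rw [tendsto_iff_dist_tendsto_zero]
      have h0 : Tendsto (fun r : ℝ => r) (𝓝[>] 0) (𝓝 0) := tendsto_id.mono_left nhdsWithin_le_nhds
      refine squeeze_zero' (Eventually.of_forall fun r => dist_nonneg) ?_ h0
      filter_upwards [hv] with r hr
      rw [Real.dist_eq]
      exact (abs_sub_le_dist_graphPoint f _ _).trans hr.2.le
    · filter_upwards [hv] with r hr h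
      rw [mem_singleton_iff] at h
      rw [h, sub_self, mul_zero] at hr
      exact lt_irrefl _ hr.1
  have h1 := (hasDerivAt_iff_tendsto_slope.1 hW).comp hvc
  have h2 := (hasDerivAt_iff_tendsto_slope.1 hf).comp hvc
  have h3 : Tendsto (fun r => √(1 + slope f c (v r) ^ 2)) (𝓝[>] 0) (𝓝 √(1 + p ^ 2)) :=
    (Real.continuous_sqrt.tendsto _).comp ((h2.pow 2).const_add 1)
  have hpos : √(1 + p ^ 2) ≠ 0 := by positivity
  have h4 := (h1.const_mul e).div h3 hpos
  refine h4.congr' ?_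
  filter_upwards [hv] with r hr
  obtain ⟨hr1, hr2⟩ := hr
  simp only [Pi.div_apply, Function.comp]
  generalize v r = w at *
  have hne : w - c ≠ 0 := fun h => by rw [h, mul_zero] at hr1; exact lt_irrefl _ hr1
  have habs : |w - c| = e * (w - c) := by
    rw [← abs_of_pos hr1, abs_mul, he, one_mul]
  have h5 : r = e * (w - c) * √(1 + slope f c w ^ 2) := by
    rw [← habs, ← Real.sqrt_sq (abs_nonneg (w - c)), ← Real.sqrt_mul (by positivity), sq_abs,
      slope_def_field]
    rw [Complex.dist_eq_re_im] at hr2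
    rw [← hr2]
    congr 1
    simp only [graphPoint]
    field_simp
  have h6 : √(1 + slope f c w ^ 2) ≠ 0 := by positivity
  conv_rhs => rw [h5]
  rw [slope_def_field W]
  have hene : e ≠ 0 := fun h => by rw [h, zero_mul] at hee; exact zero_ne_one hee
  rw [div_eq_div_iff h6 (by positivity)]
  field_simp
  linear_combination (W w - W c) * hee

/-! ### The law of large numbers for the heights -/

/-- Chebyshev's inequality: the variance of the sum is additive, and each term is at most the second
moment `q * (2 * q + 1)`. -/
theorem IsGeometricWalk.measureReal_le {Ω : Type*} [MeasurableSpace Ω] {P : Measure Ω}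
    [IsProbabilityMeasure P] {h : Ω → ℤ → ℤ} {e : ℤ} {q : ℤ → ℝ} {m M : ℤ}
    (hw : IsGeometricWalk P h e q m M) {B : ℝ} (hB : ∀ k ∈ Ico m M, q k ≤ B) {k : ℤ}
    (hmk : m ≤ k) (hkM : k ≤ M) {c : ℝ} (hc : 0 < c) :
    P.real {ω | c ≤ |((h ω k : ℝ) - h ω m) - e * ∑ i ∈ Finset.Ico m k, q i|} ≤
      (k - m) * (B * (2 * B + 1)) / c ^ 2 := by
  set X : ℤ → Ω → ℝ := fun i ω => ((e * (h ω (i + 1) - h ω i) : ℤ) : ℝ) with hX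
  have hsub : ∀ i ∈ Finset.Ico m k, i ∈ Ico m M := fun i hi => by
    rw [Finset.mem_Ico] at hi
    exact ⟨hi.1, hi.2.trans_le hkM⟩
  have hXm : ∀ i, Measurable (X i) := fun i =>
    (measurable_of_countable (fun z : ℤ => (z : ℝ))).comp (hw.measurable_increment i)
  have hmap : ∀ i, ∀ F : ℤ → ℝ, ∫ ω, F (e * (h ω (i + 1) - h ω i)) ∂P =
      ∫ l, F l ∂(P.map fun ω => e * (h ω (i + 1) - h ω i)) := fun i F =>
    (integral_map (hw.measurable_increment i).aemeasurable
      (measurable_of_countable F).aestronglyMeasurable).symm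
  have hXL : ∀ i ∈ Finset.Ico m k, MemLp (X i) 2 P := by
    intro i hi
    have := Measure.isProbabilityMeasure_map (μ := P) (hw.measurable_increment i).aemeasurable
    rw [memLp_two_iff_integrable_sq (hXm i).aestronglyMeasurable]
    exact ((hw.law i (hsub i hi)).integrable_pow (hw.nonneg i) 2).comp_measurable
      (hw.measurable_increment i)
  have hXE : ∀ i ∈ Finset.Ico m k, ∫ ω, X i ω ∂P = q i := by
    intro i hi
    have := Measure.isProbabilityMeasure_map (μ := P) (hw.measurable_increment i).aemeasurable
    rw [hmap i fun z => (z : ℝ)]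
    exact (hw.law i (hsub i hi)).integral_id (hw.nonneg i)
  have hXV : ∀ i ∈ Finset.Ico m k, Var[X i; P] ≤ B * (2 * B + 1) := by
    intro i hi
    have := Measure.isProbabilityMeasure_map (μ := P) (hw.measurable_increment i).aemeasurable
    have h1 : ∫ ω, X i ω ^ 2 ∂P = q i * (2 * q i + 1) := by
      rw [hmap i fun z => (z : ℝ) ^ 2]
      exact (hw.law i (hsub i hi)).integral_sq (hw.nonneg i)
    refine (variance_le_expectation_sq (hXm i).aestronglyMeasurable).trans ?_
    have h2 : ∫ ω, (X i ^ 2) ω ∂P = q i * (2 * q i + 1) := h1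
    rw [h2]
    have h3 := hB i (hsub i hi)
    have h4 := hw.nonneg i
    exact mul_le_mul h3 (by linarith) (by linarith) (by linarith)
  set Y : Ω → ℝ := ∑ i ∈ Finset.Ico m k, X i with hY
  have hYL : MemLp Y 2 P := memLp_finsetSum' _ hXL
  have hYE : ∫ ω, Y ω ∂P = ∑ i ∈ Finset.Ico m k, q i := by
    simp only [hY, Finset.sum_apply]
    rw [integral_finsetSum _ fun i hi => (hXL i hi).integrable (by norm_num)]
    exact Finset.sum_congr rfl hXE
  have hYV : Var[Y; P] ≤ (k - m) * (B * (2 * B + 1)) := by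
    rw [hY, IndepFun.variance_sum hXL]
    · refine (Finset.sum_le_sum hXV).trans ?_
      rw [Finset.sum_const, nsmul_eq_mul, Int.card_Ico]
      have h5 : (((k - m).toNat : ℕ) : ℝ) = k - m := by
        have : (((k - m).toNat : ℤ) : ℝ) = ((k - m : ℤ) : ℝ) := by
          rw [Int.toNat_of_nonneg (by omega)]
        push_cast at this
        exact this
      rw [h5]
    · intro i hi j hj hij
      exact (hw.indep_increments i (hsub i hi) j (hsub j hj) hij).comp
        (measurable_of_countable (fun z : ℤ => (z : ℝ)))
        (measurable_of_countable (fun z : ℤ => (z : ℝ)))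
  have hee : (e : ℝ) * e = 1 := by rcases hw.sign with rfl | rfl <;> norm_num
  have hea : |(e : ℝ)| = 1 := by rcases hw.sign with rfl | rfl <;> norm_num
  have hYh : ∀ ω, Y ω = e * ((h ω k : ℝ) - h ω m) := by
    intro ω
    have h6 := sum_Ico_succ_sub (fun i => h ω i) hmk
    simp only [hY, Finset.sum_apply, hX]
    rw [← Int.cast_sum, ← Finset.mul_sum, h6]
    push_cast
    ring
  have hset : {ω | c ≤ |((h ω k : ℝ) - h ω m) - e * ∑ i ∈ Finset.Ico m k, q i|} =
      {ω | c ≤ |Y ω - ∫ ω, Y ω ∂P|} := by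
    ext ω
    simp only [mem_ofPred_eq]
    rw [hYE, hYh ω]
    have : (e : ℝ) * ((h ω k : ℝ) - h ω m) - ∑ i ∈ Finset.Ico m k, q i =
        e * (((h ω k : ℝ) - h ω m) - e * ∑ i ∈ Finset.Ico m k, q i) := by
      linear_combination (∑ i ∈ Finset.Ico m k, q i) * hee
    rw [this, abs_mul, hea, one_mul]
  rw [hset, Measure.real]
  refine (ENNReal.toReal_le_of_le_ofReal (by have := variance_nonneg Y P; positivity)
    (meas_ge_le_variance_div_sq hYL hc)).trans ?_
  gcongr

/-- Riemann sums of the derivative on the lattice `ℤ / N`. -/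
theorem eventually_riemann_sum {f : ℝ → ℝ} {a b : ℝ} (hf : DifferentiableOn ℝ f (Icc a b))
    (hd : ContinuousOn (derivWithin f (Icc a b)) (Icc a b)) {ε : ℝ} (hε : 0 < ε) :
    ∀ᶠ N : ℕ in atTop, ∀ m k : ℤ, m ≤ k → a ≤ (m : ℝ) / N → (k : ℝ) / N ≤ b →
      |(∑ i ∈ Finset.Ico m k, derivWithin f (Icc a b) ((i : ℝ) / N)) / N -
        (f ((k : ℝ) / N) - f ((m : ℝ) / N))| ≤ ε * (b - a) := by
  have huc := isCompact_Icc.uniformContinuousOn_of_continuous hd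
  rw [Metric.uniformContinuousOn_iff_le] at huc
  obtain ⟨η, hη, huc⟩ := huc ε hε
  filter_upwards [eventually_gt_atTop 0,
    (tendsto_inv_atTop_nhds_zero_nat (𝕜 := ℝ)).eventually_le_const hη] with N hN hNη
  have hN' : (0 : ℝ) < N := by exact_mod_cast hN
  have hstep : ∀ i : ℤ, a ≤ (i : ℝ) / N → ((i + 1 : ℤ) : ℝ) / N ≤ b →
      |derivWithin f (Icc a b) ((i : ℝ) / N) / N -
        (f (((i + 1 : ℤ) : ℝ) / N) - f ((i : ℝ) / N))| ≤ ε / N := by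
    intro i hi hi'
    have hlt : (i : ℝ) / N < ((i + 1 : ℤ) : ℝ) / N := by
      rw [div_lt_div_iff_of_pos_right hN']; push_cast; linarith
    have hdiff : ((i + 1 : ℤ) : ℝ) / N - (i : ℝ) / N = (N : ℝ)⁻¹ := by
      push_cast; field_simp; ring
    have hsub : Icc ((i : ℝ) / N) (((i + 1 : ℤ) : ℝ) / N) ⊆ Icc a b := Icc_subset_Icc hi hi'
    -- By the mean value theorem the increment over a cell is the derivative at an inner point,
    -- which uniform continuity compares with the left end point.
    obtain ⟨x, hx, hx'⟩ := exists_hasDerivAt_eq_slope f (derivWithin f (Icc a b)) hlt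
      (hf.continuousOn.mono hsub) (fun x hx => by
        have hxI : Icc a b ∈ 𝓝 x := Icc_mem_nhds (hi.trans_lt hx.1) (hx.2.trans_le hi')
        exact (hf x (mem_of_mem_nhds hxI)).hasDerivWithinAt.hasDerivAt hxI)
    rw [hdiff, div_inv_eq_mul] at hx'
    have h1 : f (((i + 1 : ℤ) : ℝ) / N) - f ((i : ℝ) / N) = derivWithin f (Icc a b) x / N := by
      rw [hx']; field_simp
    rw [h1, ← sub_div, abs_div, abs_of_pos hN']
    refine div_le_div_of_nonneg_right ?_ hN'.le
    rw [← Real.dist_eq]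
    refine huc _ ⟨hi, hlt.le.trans hi'⟩ _ (hsub (Ioo_subset_Icc_self hx)) ?_
    rw [Real.dist_eq, abs_sub_comm, abs_of_pos (by linarith [hx.1])]
    linarith [hx.2]
  intro m k hmk ha hb
  have hsum : |(∑ i ∈ Finset.Ico m k, derivWithin f (Icc a b) ((i : ℝ) / N)) / N -
      (f ((k : ℝ) / N) - f ((m : ℝ) / N))| ≤ (k - m) * (ε / N) := by
    induction k, hmk using Int.leInduction with
    | base => simp
    | succ k hk ih =>
      have hk1 : (m : ℝ) / N ≤ k / N := by
        rw [div_le_div_iff_of_pos_right hN']; exact_mod_cast hk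
      have hk2 : (k : ℝ) / N ≤ ((k + 1 : ℤ) : ℝ) / N := by
        rw [div_le_div_iff_of_pos_right hN']; push_cast; linarith
      have h1 := ih (hk2.trans hb)
      have h2 := hstep k (ha.trans hk1) hb
      rw [← Finset.insert_Ico_right_eq_Ico_add_one hk, Finset.sum_insert (by simp), add_div]
      have h3 := abs_add_le (derivWithin f (Icc a b) ((k : ℝ) / N) / N -
        (f (((k + 1 : ℤ) : ℝ) / N) - f ((k : ℝ) / N)))
        ((∑ i ∈ Finset.Ico m k, derivWithin f (Icc a b) ((i : ℝ) / N)) / N -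
        (f ((k : ℝ) / N) - f ((m : ℝ) / N)))
      have h4 : (((k + 1 : ℤ) : ℝ) - m) * (ε / N) = ε / N + (k - m) * (ε / N) := by
        push_cast; ring
      rw [h4]
      refine le_trans (le_of_eq ?_) (h3.trans (add_le_add h2 h1))
      congr 1
      ring
  refine hsum.trans ?_
  have h5 : ((k : ℝ) - m) * (ε / N) = ε * (k / N - m / N) := by field_simp
  rw [h5]
  exact mul_le_mul_of_nonneg_left (by linarith) hε.le

section
variable {Ω : Type*} [MeasurableSpace Ω] {P : ℕ → Measure Ω} [∀ N, IsProbabilityMeasure (P N)]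
  {h : ℕ → Ω → ℤ → ℤ} {f : ℝ → ℝ} {a b : ℝ} {m : ℕ → ℤ} {e : ℤ}

/-- The heights are close to the graph of `f` in probability, uniformly in the abscissa. -/
theorem eventually_height_close (hab : a < b) (hf : DifferentiableOn ℝ f (Icc a b))
    (hd : ContinuousOn (derivWithin f (Icc a b)) (Icc a b))
    (he : ∀ u ∈ Icc a b, (e : ℝ) * |derivWithin f (Icc a b) u| = derivWithin f (Icc a b) u)
    (hw : ∀ᶠ N : ℕ in atTop, IsGeometricWalk (P N) (h N) e
      (fun k => |derivWithin f (Icc a b) ((k : ℝ) / N)|) (m N) ⌊N * b⌋)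
    (hm : ∀ᶠ N : ℕ in atTop, (m N : ℝ) / N ∈ Icc a b ∧ |a - (m N : ℝ) / N| ≤ 1 / N)
    (hconv : ∀ ε : ℝ, 0 < ε →
      Tendsto (fun N : ℕ => (P N).real {ω | ε ≤ |height N (h N ω) (m N) - f a|}) atTop (𝓝 0))
    {c ε : ℝ} (hc : 0 < c) (hε : 0 < ε) :
    ∀ᶠ N : ℕ in atTop, ∀ k : ℤ, m N ≤ k → (k : ℝ) / N ≤ b →
      (P N).real {ω | c ≤ |height N (h N ω) k - f ((k : ℝ) / N)|} ≤ ε := by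
  obtain ⟨B, hB⟩ := isCompact_Icc.exists_bound_of_continuousOn hd
  have hB0 : 0 ≤ B := (norm_nonneg _).trans (hB a (left_mem_Icc.2 hab.le))
  have hba : 0 < b - a := sub_pos.2 hab
  have hfa : ∀ᶠ N : ℕ in atTop, |f ((m N : ℝ) / N) - f a| ≤ c / 8 := by
    have h1 : Tendsto (fun N : ℕ => (m N : ℝ) / N) atTop (𝓝[Icc a b] a) := by
      rw [tendsto_nhdsWithin_iff]
      refine ⟨?_, hm.mono fun N hN => hN.1⟩
      rw [tendsto_iff_dist_tendsto_zero]
      refine squeeze_zero' (Eventually.of_forall fun _ => dist_nonneg) (hm.mono fun N hN => ?_)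
        tendsto_one_div_atTop_nhds_zero_nat
      rw [dist_comm, Real.dist_eq]
      exact hN.2
    have h2 := (hf.continuousOn a (left_mem_Icc.2 hab.le)).tendsto.comp h1
    have h3 := (Metric.tendsto_nhds.1 h2) (c / 8) (by positivity)
    filter_upwards [h3] with N hN
    rw [Real.dist_eq] at hN
    exact hN.le
  -- The variance is of order `N`, while deviations of the unscaled heights are measured at order
  -- `N`; Chebyshev thus leaves a factor `1/N`.
  have hvar : ∀ᶠ N : ℕ in atTop, (b - a) * (B * (2 * B + 1)) / (c / 4) ^ 2 * (1 / N) ≤ ε / 2 := by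
    have h1 := (tendsto_one_div_atTop_nhds_zero_nat (𝕜 := ℝ)).const_mul
      ((b - a) * (B * (2 * B + 1)) / (c / 4) ^ 2)
    rw [mul_zero] at h1
    exact h1.eventually_le_const (by positivity)
  filter_upwards [hw, hm, hfa, hvar, eventually_gt_atTop 0,
    (hconv (c / 4) (by positivity)).eventually_le_const (show (0 : ℝ) < ε / 2 by positivity),
    eventually_riemann_sum hf hd (ε := c / (8 * (b - a))) (by positivity)]
    with N hwN hmN hfaN hvarN hN hconvN hrN k hmk hkb
  have hN' : (0 : ℝ) < N := by exact_mod_cast hN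
  have hkM : k ≤ ⌊N * b⌋ := by
    rw [Int.le_floor]
    rwa [div_le_iff₀ hN', mul_comm] at hkb
  have hin : ∀ i ∈ Ico (m N) ⌊N * b⌋, (i : ℝ) / N ∈ Icc a b := by
    intro i hi
    constructor
    · refine hmN.1.1.trans ?_
      rw [div_le_div_iff_of_pos_right hN']; exact_mod_cast hi.1
    · rw [div_le_iff₀ hN', mul_comm]
      exact Int.le_floor.1 hi.2.le
  have hev := hwN.measureReal_le (B := B) (fun i hi => hB _ (hin i hi)) hmk hkM
    (c := c / 4 * N) (by positivity)
  have hsum : (e : ℝ) * ∑ i ∈ Finset.Ico (m N) k, |derivWithin f (Icc a b) ((i : ℝ) / N)| =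
      ∑ i ∈ Finset.Ico (m N) k, derivWithin f (Icc a b) ((i : ℝ) / N) := by
    rw [Finset.mul_sum]
    refine Finset.sum_congr rfl fun i hi => he _ (hin i ?_)
    rw [Finset.mem_Ico] at hi
    exact ⟨hi.1, hi.2.trans_le hkM⟩
  rw [hsum] at hev
  have hr := hrN (m N) k hmk hmN.1.1 hkb
  have hcb : c / (8 * (b - a)) * (b - a) = c / 8 := by field_simp
  rw [hcb] at hr
  -- The error splits into the reference height (`c/4`), the fluctuation of the walk (`c/4`), the
  -- Riemann sum (`c/8`) and the displacement of the reference point from `a` (`c/8`). Only the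
  -- first two are random.
  have hsubset : {ω | c ≤ |height N (h N ω) k - f ((k : ℝ) / N)|} ⊆
      {ω | c / 4 ≤ |height N (h N ω) (m N) - f a|} ∪
      {ω | c / 4 * N ≤ |((h N ω k : ℝ) - h N ω (m N)) -
        ∑ i ∈ Finset.Ico (m N) k, derivWithin f (Icc a b) ((i : ℝ) / N)|} := by
    intro ω hω
    by_contra hcon
    simp only [mem_union, mem_ofPred_eq, not_or, not_le] at hcon hω
    obtain ⟨h1, h2⟩ := hcon
    set S := ∑ i ∈ Finset.Ico (m N) k, derivWithin f (Icc a b) ((i : ℝ) / N)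
    have h3 : |((h N ω k : ℝ) - h N ω (m N) - S) / N| < c / 4 := by
      rwa [abs_div, abs_of_pos hN', div_lt_iff₀ hN']
    have h4 : height N (h N ω) k - f ((k : ℝ) / N) = (height N (h N ω) (m N) - f a) +
        ((h N ω k : ℝ) - h N ω (m N) - S) / N + (S / N - (f ((k : ℝ) / N) - f ((m N : ℝ) / N))) -
        (f ((m N : ℝ) / N) - f a) := by
      simp only [height]
      field_simp
      ring
    rw [h4] at hω
    rw [abs_lt] at h1 h3
    rw [abs_le] at hr hfaN
    have h5 : |(height N (h N ω) (m N) - f a) +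
        ((h N ω k : ℝ) - h N ω (m N) - S) / N + (S / N - (f ((k : ℝ) / N) - f ((m N : ℝ) / N))) -
        (f ((m N : ℝ) / N) - f a)| < c := by
      rw [abs_lt]
      constructor <;> linarith [h1.1, h1.2, h3.1, h3.2, hr.1, hr.2, hfaN.1, hfaN.2]
    linarith
  refine (measureReal_mono hsubset).trans ((measureReal_union_le _ _).trans ?_)
  have h6 : ((k : ℝ) - m N) * (B * (2 * B + 1)) / (c / 4 * N) ^ 2 ≤
      (b - a) * (B * (2 * B + 1)) / (c / 4) ^ 2 * (1 / N) := by
    have h7 : (k : ℝ) - m N ≤ N * (b - a) := by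
      have h8 := hmN.1.1
      rw [div_le_iff₀ hN'] at hkb
      rw [le_div_iff₀ hN'] at h8
      linarith
    have h9 : (b - a) * (B * (2 * B + 1)) / (c / 4) ^ 2 * (1 / N) =
        (N * (b - a)) * (B * (2 * B + 1)) / (c / 4 * N) ^ 2 := by
      field_simp
    rw [h9]
    gcongr
  linarith
end

/-! ### Weighted sums of increments -/

theorem sum_Ico_pred_sub (v : ℤ → ℝ) {m k : ℤ} (hmk : m ≤ k) :
    ∑ i ∈ Finset.Ico (m + 1) (k + 1), (v i - v (i - 1)) = v k - v m := by
  induction k, hmk using Int.leInduction with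
  | base => simp
  | succ k hk ih =>
    rw [← Finset.insert_Ico_right_eq_Ico_add_one (by omega), Finset.sum_insert (by simp), ih,
      add_sub_cancel_right]
    ring

theorem card_lattice_Icc_le {N : ℕ} (x y : ℝ) (hxy : x ≤ y) :
    ((Finset.Icc ⌈N * x⌉ ⌊N * y⌋).card : ℝ) ≤ N * (y - x) + 1 := by
  have h1 : (0 : ℝ) ≤ N * (y - x) := mul_nonneg (Nat.cast_nonneg N) (by linarith)
  rw [Int.card_Icc]
  rcases le_total 0 (⌊N * y⌋ + 1 - ⌈N * x⌉) with h | h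
  · have h2 : (((⌊N * y⌋ + 1 - ⌈N * x⌉).toNat : ℤ) : ℝ) = ((⌊N * y⌋ + 1 - ⌈N * x⌉ : ℤ) : ℝ) := by
      rw [Int.toNat_of_nonneg h]
    rw [Int.cast_natCast] at h2
    rw [h2]
    push_cast
    linarith [Int.floor_le (N * y), Int.le_ceil (N * x)]
  · rw [Int.toNat_of_nonpos h]
    push_cast
    linarith

/-- A sum of increments of `w` over the lattice, weighted by a function that is close to the
indicator of `[uL, uR]` away from the end points. -/
theorem abs_weighted_sum_sub_le {N : ℕ} (hN : 0 < N) {w : ℝ → ℝ} {g : ℤ → ℝ}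
    {c ρ uL uR δ ε K : ℝ} (hδ : 0 < δ) (hε : 0 ≤ ε) (hρ : 1 / N ≤ ρ) (hLR : uL ≤ uR)
    (hL : N * (c - ρ) + 1 ≤ N * uL) (hR : N * uR + 1 ≤ N * (c + ρ))
    (hw : ∀ u ∈ Icc (c - 2 * ρ) (c + 2 * ρ), ∀ v ∈ Icc (c - 2 * ρ) (c + 2 * ρ),
      |w u - w v| ≤ K * |u - v|) (hK : 0 ≤ K)
    (hg₀ : ∀ k, 0 ≤ g k) (hg₁ : ∀ k, g k ≤ 1)
    (hout : ∀ k ∈ Finset.Ico ⌈N * (c - ρ)⌉ ⌊N * (c + ρ)⌋,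
      (k : ℝ) / N < uL - 2 * δ ∨ uR + 2 * δ < (k : ℝ) / N → g k ≤ ε)
    (hin : ∀ k : ℤ, uL + 2 * δ < (k : ℝ) / N → (k : ℝ) / N < uR - 2 * δ → 1 - ε ≤ g k) :
    |∑ k ∈ Finset.Ico ⌈N * (c - ρ)⌉ ⌊N * (c + ρ)⌋,
      (w ((k : ℝ) / N) - w (((k - 1 : ℤ) : ℝ) / N)) * g k - (w uR - w uL)| ≤
      K * (2 * ρ * ε + 8 * δ + 4 / N) := by
  have hN' : (0 : ℝ) < N := by exact_mod_cast hN
  have hρ0 : 0 < ρ := lt_of_lt_of_le (by positivity) hρ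
  set k₀ := ⌈N * (c - ρ)⌉ with hk₀
  set k₁ := ⌊N * (c + ρ)⌋ with hk₁
  set kL := ⌊N * uL⌋ with hkL
  set kR := ⌊N * uR⌋ with hkR
  have hk0L : k₀ ≤ kL := by
    rw [hkL, Int.le_floor]
    linarith [Int.ceil_lt_add_one (N * (c - ρ))]
  have hLRk : kL ≤ kR := Int.floor_le_floor (mul_le_mul_of_nonneg_left hLR hN'.le)
  have hkR1 : kR + 1 ≤ k₁ := by
    rw [hk₁, Int.le_floor]
    push_cast
    linarith [Int.floor_le (N * uR)]
  -- The index `k₀ - 1` occurs in the differences, which is why the Lipschitz bound is required on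
  -- the window of half-width `2 * ρ`.
  have hwin : ∀ k : ℤ, k₀ - 1 ≤ k → k ≤ k₁ → (k : ℝ) / N ∈ Icc (c - 2 * ρ) (c + 2 * ρ) := by
    intro k h1 h2
    have h3 : (k₀ : ℝ) - 1 ≤ k := by exact_mod_cast h1
    have h4 : (k : ℝ) ≤ k₁ := by exact_mod_cast h2
    have h5 := Int.le_ceil (N * (c - ρ))
    have h6 := Int.floor_le (N * (c + ρ))
    rw [div_le_iff₀ hN'] at hρ
    constructor
    · rw [le_div_iff₀ hN']
      linarith
    · rw [div_le_iff₀ hN']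
      have := mul_pos hρ0 hN'
      linarith
  have huw : ∀ u, N * (c - ρ) + 1 ≤ N * u → N * u + 1 ≤ N * (c + ρ) →
      u ∈ Icc (c - 2 * ρ) (c + 2 * ρ) := by
    intro u h1 h2
    constructor
    · have : c - ρ ≤ u := le_of_mul_le_mul_left (by linarith) hN'
      linarith
    · have : u ≤ c + ρ := le_of_mul_le_mul_left (by linarith) hN'
      linarith
  have hNLR : N * uL ≤ N * uR := mul_le_mul_of_nonneg_left hLR hN'.le
  have hfloor : ∀ u, N * (c - ρ) + 1 ≤ N * u → N * u + 1 ≤ N * (c + ρ) →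
      |w ((⌊N * u⌋ : ℝ) / N) - w u| ≤ K * (1 / N) := by
    intro u h1 h2
    have h3 : k₀ ≤ ⌊N * u⌋ := by
      rw [Int.le_floor]; linarith [Int.ceil_lt_add_one (N * (c - ρ))]
    have h4 : ⌊N * u⌋ ≤ k₁ := Int.floor_le_floor (by linarith)
    refine (hw _ (hwin _ (by omega) h4) u (huw u h1 h2)).trans ?_
    refine mul_le_mul_of_nonneg_left ?_ hK
    have h5 := Int.floor_le (N * u)
    have h6 := Int.lt_floor_add_one (N * u)
    have h7 : (⌊N * u⌋ : ℝ) / N - u = (⌊N * u⌋ - N * u) / N := by field_simp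
    rw [h7, abs_div, abs_of_pos hN', div_le_div_iff_of_pos_right hN', abs_le]
    constructor <;> linarith
  have hstep : ∀ k ∈ Finset.Ico k₀ k₁, |w ((k : ℝ) / N) - w (((k - 1 : ℤ) : ℝ) / N)| ≤ K * (1 / N) := by
    intro k hk
    rw [Finset.mem_Ico] at hk
    refine (hw _ (hwin k (by omega) (by omega)) _ (hwin (k - 1) (by omega) (by omega))).trans
      (le_of_eq ?_)
    congr 1
    push_cast
    rw [← sub_div, sub_sub_cancel, abs_of_pos (by positivity)]
  -- With the exact indicator in place of `g`, the sum telescopes.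
  have htel : ∑ k ∈ Finset.Ico k₀ k₁, (w ((k : ℝ) / N) - w (((k - 1 : ℤ) : ℝ) / N)) *
      (if k ∈ Finset.Ico (kL + 1) (kR + 1) then 1 else 0) =
      w ((kR : ℝ) / N) - w ((kL : ℝ) / N) := by
    rw [← sum_Ico_pred_sub (fun k => w ((k : ℝ) / N)) hLRk]
    simp only [mul_ite, mul_one, mul_zero]
    rw [Finset.sum_ite_mem, Finset.inter_eq_right.2]
    exact Finset.Ico_subset_Ico (by omega) hkR1
  -- The exceptional columns near the two crossings, at most `4 * N * δ + 1` each; there only `|g -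
  -- indicator| ≤ 1` is available.
  set bL := Finset.Icc ⌈N * (uL - 2 * δ)⌉ ⌊N * (uL + 2 * δ)⌋ with hbL
  set bR := Finset.Icc ⌈N * (uR - 2 * δ)⌉ ⌊N * (uR + 2 * δ)⌋ with hbR
  have hterm : ∀ k ∈ Finset.Ico k₀ k₁,
      |g k - (if k ∈ Finset.Ico (kL + 1) (kR + 1) then 1 else 0)| ≤
      ε + ((if k ∈ bL then 1 else 0) + (if k ∈ bR then 1 else 0)) := by
    intro k hk
    have h0 := hg₀ k
    have h1 := hg₁ k
    by_cases hkbL : k ∈ bL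
    · rw [if_pos hkbL]
      have : (0 : ℝ) ≤ if k ∈ bR then 1 else 0 := by split_ifs <;> norm_num
      rw [abs_le]
      split_ifs <;> (constructor <;> linarith)
    by_cases hkbR : k ∈ bR
    · rw [if_pos hkbR]
      have : (0 : ℝ) ≤ if k ∈ bL then 1 else 0 := by split_ifs <;> norm_num
      rw [abs_le]
      split_ifs <;> constructor <;> linarith
    rw [if_neg hkbL, if_neg hkbR, add_zero, add_zero]
    have hmem : ∀ u : ℝ, k ∉ Finset.Icc ⌈N * (u - 2 * δ)⌉ ⌊N * (u + 2 * δ)⌋ →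
        (k : ℝ) / N < u - 2 * δ ∨ u + 2 * δ < (k : ℝ) / N := by
      intro u hu
      by_contra hcon
      rw [not_or, not_lt, not_lt, le_div_iff₀ hN', div_le_iff₀ hN'] at hcon
      apply hu
      rw [Finset.mem_Icc, Int.ceil_le, Int.le_floor]
      exact ⟨by linarith [hcon.1], by linarith [hcon.2]⟩
    have hltL : ∀ u : ℝ, (k : ℝ) / N < u → k ≤ ⌊N * u⌋ := by
      intro u hu
      rw [Int.le_floor]
      rw [div_lt_iff₀ hN'] at hu
      linarith
    have hgtL : ∀ u : ℝ, u < (k : ℝ) / N → ⌊N * u⌋ < k := by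
      intro u hu
      rw [Int.floor_lt]
      rw [lt_div_iff₀ hN'] at hu
      linarith
    rcases hmem uL hkbL with h2 | h2
    · have h3 := hltL uL (by linarith)
      have h4 := hout k hk (Or.inl h2)
      rw [if_neg (by rw [Finset.mem_Ico]; omega), sub_zero, abs_of_nonneg h0]
      exact h4
    · have h3 := hgtL uL (by linarith)
      rcases hmem uR hkbR with h5 | h5
      · have h6 := hltL uR (by linarith)
        have h7 := hin k h2 h5
        rw [if_pos (by rw [Finset.mem_Ico]; omega), abs_of_nonpos (by linarith)]
        linarith
      · have h6 := hgtL uR (by linarith)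
        have h4 := hout k hk (Or.inr h5)
        rw [if_neg (by rw [Finset.mem_Ico]; omega), sub_zero, abs_of_nonneg h0]
        exact h4
  have hcard : ∀ b : Finset ℤ, ∑ k ∈ Finset.Ico k₀ k₁, (if k ∈ b then (1 : ℝ) else 0) ≤ b.card := by
    intro b
    rw [Finset.sum_ite_mem, Finset.sum_const, nsmul_eq_mul, mul_one]
    exact_mod_cast Finset.card_le_card Finset.inter_subset_right
  have hcL : (bL.card : ℝ) ≤ N * (4 * δ) + 1 := by
    refine (card_lattice_Icc_le _ _ (by linarith)).trans (le_of_eq ?_); ring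
  have hcR : (bR.card : ℝ) ≤ N * (4 * δ) + 1 := by
    refine (card_lattice_Icc_le _ _ (by linarith)).trans (le_of_eq ?_); ring
  have hcI : ((Finset.Ico k₀ k₁).card : ℝ) ≤ N * (2 * ρ) := by
    rw [Int.card_Ico]
    have h8 : (((k₁ - k₀).toNat : ℤ) : ℝ) = ((k₁ - k₀ : ℤ) : ℝ) := by
      rw [Int.toNat_of_nonneg (by omega)]
    rw [Int.cast_natCast] at h8
    rw [h8]
    push_cast
    linarith [Int.le_ceil (N * (c - ρ)), Int.floor_le (N * (c + ρ))]
  have hmain : |∑ k ∈ Finset.Ico k₀ k₁, (w ((k : ℝ) / N) - w (((k - 1 : ℤ) : ℝ) / N)) * g k -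
      (w ((kR : ℝ) / N) - w ((kL : ℝ) / N))| ≤
      K * (1 / N) * (N * (2 * ρ) * ε + ((N * (4 * δ) + 1) + (N * (4 * δ) + 1))) := by
    rw [← htel, ← Finset.sum_sub_distrib]
    refine (Finset.abs_sum_le_sum_abs _ _).trans ?_
    have h9 : ∀ k ∈ Finset.Ico k₀ k₁, |(w ((k : ℝ) / N) - w (((k - 1 : ℤ) : ℝ) / N)) * g k -
        (w ((k : ℝ) / N) - w (((k - 1 : ℤ) : ℝ) / N)) *
        (if k ∈ Finset.Ico (kL + 1) (kR + 1) then 1 else 0)| ≤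
        K * (1 / N) * (ε + ((if k ∈ bL then 1 else 0) + (if k ∈ bR then 1 else 0))) := by
      intro k hk
      rw [← mul_sub, abs_mul]
      exact mul_le_mul (hstep k hk) (hterm k hk) (abs_nonneg _) (by positivity)
    refine (Finset.sum_le_sum h9).trans ?_
    rw [← Finset.mul_sum, Finset.sum_add_distrib, Finset.sum_add_distrib, Finset.sum_const,
      nsmul_eq_mul]
    refine mul_le_mul_of_nonneg_left ?_ (by positivity)
    exact add_le_add (mul_le_mul_of_nonneg_right hcI hε)
      (add_le_add ((hcard bL).trans hcL) ((hcard bR).trans hcR))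
  have hfR := hfloor uR (by linarith) hR
  have hfL := hfloor uL hL (by linarith)
  -- Two of the four terms `1 / N` come from counting exceptional columns, the other two from
  -- rounding `uL` and `uR` to the lattice.
  have hfin : K * (2 * ρ * ε + 8 * δ + 4 / N) =
      K * (1 / N) * (N * (2 * ρ) * ε + ((N * (4 * δ) + 1) + (N * (4 * δ) + 1))) +
      K * (1 / N) + K * (1 / N) := by
    field_simp
    ring
  rw [hfin]
  rw [abs_le] at hmain hfR hfL ⊢
  constructor <;> linarith [hmain.1, hmain.2, hfR.1, hfR.2, hfL.1, hfL.2]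

/-! ### The mean of the averaged drift -/

/-- The density of the corners of the interface over `u`. -/
def cornerDensity (f : ℝ → ℝ) (a b u : ℝ) : ℝ :=
  |derivWithin f (Icc a b) u| / (1 + |derivWithin f (Icc a b) u|)

theorem dist_point_graphPoint (f : ℝ → ℝ) (N : ℕ) (k j : ℤ) :
    dist (point N (k, j)) (graphPoint f ((k : ℝ) / N)) = |(j : ℝ) / N - f ((k : ℝ) / N)| := by
  rw [Complex.dist_of_re_eq (by rfl), Real.dist_eq]
  rfl

theorem dist_point_add_offset_lt {f : ℝ → ℝ} {N : ℕ} {e : ℤ} {v : ℤ → ℤ} {k : ℤ} {c : ℝ}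
    (hN : 1 / (N : ℝ) ≤ c) (h : |height N v k - f ((k : ℝ) / N)| < c) :
    dist (point N (k, v k + IsGeometricWalk.cornerOffset e)) (graphPoint f ((k : ℝ) / N)) <
      2 * c := by
  rw [dist_point_graphPoint]
  have h1 : ((v k + IsGeometricWalk.cornerOffset e : ℤ) : ℝ) / N - f ((k : ℝ) / N) =
      (height N v k - f ((k : ℝ) / N)) +
        ((IsGeometricWalk.cornerOffset e : ℝ) - 1 / 2) * (1 / N) := by
    simp only [height]; push_cast; ring
  have h2 : |((IsGeometricWalk.cornerOffset e : ℝ) - 1 / 2) * (1 / N)| ≤ c := by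
    rw [abs_mul, abs_of_nonneg (by positivity : (0 : ℝ) ≤ 1 / N)]
    have h3 : |(IsGeometricWalk.cornerOffset e : ℝ) - 1 / 2| ≤ 1 := by
      unfold IsGeometricWalk.cornerOffset
      split_ifs <;> norm_num [abs_le]
    have h4 : (0 : ℝ) ≤ 1 / N := by positivity
    nlinarith
  rw [h1]
  have := abs_add_le (height N v k - f ((k : ℝ) / N))
    (((IsGeometricWalk.cornerOffset e : ℝ) - 1 / 2) * (1 / N))
  linarith

/-- Both radii equal `δ`, so the naming of the crossing points by orientation is irrelevant for the
estimates. -/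
theorem region_subset {s p₀ p₁ x₀ x₁ : ℂ} {r δ : ℝ} (h₀ : x₀ = p₀ ∨ x₀ = p₁)
    (h₁ : x₁ = p₀ ∨ x₁ = p₁) : region s r x₀ x₁ δ δ ⊆ region s r p₀ p₁ δ δ := by
  unfold region
  rintro z ((hz | hz) | hz)
  · exact Or.inl (Or.inl hz)
  · rcases h₀ with rfl | rfl
    · exact Or.inl (Or.inr hz)
    · exact Or.inr hz
  · rcases h₁ with rfl | rfl
    · exact Or.inl (Or.inr hz)
    · exact Or.inr hz

theorem isCompact_region (s : ℂ) (r : ℝ) (x₀ x₁ : ℂ) (α₁ α₂ : ℝ) :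
    IsCompact (region s r x₀ x₁ α₁ α₂) :=
  ((isCompact_closedBall s r).union (isCompact_closedBall x₀ α₁)).union
    (isCompact_closedBall x₁ α₂)

/-! ### The graph relative to the observation region -/

section
variable {f : ℝ → ℝ} {a b : ℝ} (hmono : MonotoneOn f (Icc a b) ∨ AntitoneOn f (Icc a b))
  {γ : Set ℂ} {c r uL uR : ℝ} (hcr : IsGraphCrossing γ f a b c r uL uR)
include hmono hcr

theorem IsGraphCrossing.graphPoint_mem_ball {u : ℝ} (h₁ : uL < u) (h₂ : u < uR) :
    graphPoint f u ∈ Metric.ball (graphPoint f c) r := by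
  have hc : c ∈ Icc a b :=
    ⟨hcr.mem_left.1.trans hcr.left_lt.le, hcr.lt_right.le.trans hcr.mem_right.2⟩
  have hu : u ∈ Icc a b := ⟨hcr.mem_left.1.trans h₁.le, h₂.le.trans hcr.mem_right.2⟩
  rw [Metric.mem_ball]
  rcases le_total c u with h | h
  · rw [← hcr.dist_right]
    exact dist_graphPoint_lt_of_right hmono hc hu hcr.mem_right h h₂
  · rw [← hcr.dist_left]
    exact dist_graphPoint_lt_of_left hmono hc hu hcr.mem_left h h₁

theorem IsGraphCrossing.graphPoint_notMem_region {u δ : ℝ} (hu : u ∈ Icc a b) (hδ : 0 < δ)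
    (h : u ≤ uL - 2 * δ ∨ uR + 2 * δ ≤ u) :
    graphPoint f u ∉ region (graphPoint f c) r (graphPoint f uL) (graphPoint f uR) δ δ := by
  have hc : c ∈ Icc a b :=
    ⟨hcr.mem_left.1.trans hcr.left_lt.le, hcr.lt_right.le.trans hcr.mem_right.2⟩
  have hL := abs_sub_le_dist_graphPoint f u uL
  have hR := abs_sub_le_dist_graphPoint f u uR
  have hlt := hcr.left_lt.trans hcr.lt_right
  rintro ((hz | hz) | hz)
  · rw [Metric.mem_closedBall] at hz
    rcases h with h | h
    · have := dist_graphPoint_lt_of_left hmono hc hcr.mem_left hu hcr.left_lt.le (by linarith)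
      rw [hcr.dist_left] at this
      linarith
    · have := dist_graphPoint_lt_of_right hmono hc hcr.mem_right hu hcr.lt_right.le (by linarith)
      rw [hcr.dist_right] at this
      linarith
  · rw [Metric.mem_closedBall] at hz
    have := abs_le.1 (hL.trans hz)
    rcases h with h | h <;> linarith [this.1, this.2]
  · rw [Metric.mem_closedBall] at hz
    have := abs_le.1 (hR.trans hz)
    rcases h with h | h <;> linarith [this.1, this.2]

variable (hf : ContinuousOn f (Icc a b)) {δ : ℝ} (hδ : 0 < δ)
include hf hδ

/-- Away from the crossing points the graph is well inside the disc or well outside the region. -/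
theorem IsGraphCrossing.exists_margin : ∃ η > 0,
    (∀ u, uL + 2 * δ ≤ u → u ≤ uR - 2 * δ → ∀ z, dist z (graphPoint f u) < η →
      z ∈ Metric.closedBall (graphPoint f c) r) ∧
    (∀ u ∈ Icc a b, u ≤ uL - 2 * δ ∨ uR + 2 * δ ≤ u → ∀ z, dist z (graphPoint f u) < η →
      z ∉ region (graphPoint f c) r (graphPoint f uL) (graphPoint f uR) δ δ) := by
  have hgc := continuousOn_graphPoint hf
  -- Over a closed interval the graph is compact; contained in an open set, it has a positive
  -- distance to the complement. The same is used for the outer arcs and the complement of the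
  -- region.
  have hin : IsCompact (graphPoint f '' Icc (uL + 2 * δ) (uR - 2 * δ)) :=
    isCompact_Icc.image_of_continuousOn (hgc.mono (Icc_subset_Icc (by linarith [hcr.mem_left.1])
      (by linarith [hcr.mem_right.2])))
  obtain ⟨η₁, hη₁, h₁⟩ := hin.exists_thickening_subset_open
    (Metric.isOpen_ball (x := graphPoint f c) (ε := r)) (by
      rintro _ ⟨u, hu, rfl⟩
      exact hcr.graphPoint_mem_ball hmono (by linarith [hu.1]) (by linarith [hu.2]))
  have hout : IsCompact (graphPoint f '' (Icc a (uL - 2 * δ) ∪ Icc (uR + 2 * δ) b)) :=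
    (isCompact_Icc.union isCompact_Icc).image_of_continuousOn (hgc.mono (union_subset
      (Icc_subset_Icc le_rfl (by linarith [hcr.mem_left.2]))
      (Icc_subset_Icc (by linarith [hcr.mem_right.1]) le_rfl)))
  obtain ⟨η₂, hη₂, h₂⟩ := hout.exists_thickening_subset_open
    (isCompact_region (graphPoint f c) r (graphPoint f uL) (graphPoint f uR) δ δ).isClosed.isOpen_compl
    (by
      rintro _ ⟨u, hu | hu, rfl⟩
      · exact hcr.graphPoint_notMem_region hmono ⟨hu.1, by linarith [hu.2, hcr.mem_left.2]⟩ hδ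
          (Or.inl hu.2)
      · exact hcr.graphPoint_notMem_region hmono ⟨by linarith [hu.1, hcr.mem_right.1], hu.2⟩ hδ
          (Or.inr hu.1))
  refine ⟨min η₁ η₂, lt_min hη₁ hη₂, ?_, ?_⟩
  · intro u hu1 hu2 z hz
    refine Metric.ball_subset_closedBall (h₁ ?_)
    rw [Metric.mem_thickening_iff]
    exact ⟨_, mem_image_of_mem _ ⟨hu1, hu2⟩, hz.trans_le (min_le_left _ _)⟩
  · intro u hu h z hz
    refine h₂ ?_
    rw [Metric.mem_thickening_iff]
    refine ⟨_, mem_image_of_mem _ (?_ : u ∈ _), hz.trans_le (min_le_right _ _)⟩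
    rcases h with h | h
    · exact Or.inl ⟨hu.1, h⟩
    · exact Or.inr ⟨h, hu.2⟩
end

theorem abs_re_point_sub_le (N : ℕ) (x : ℤ × ℤ) (z : ℂ) :
    |(x.1 : ℝ) / N - z.re| ≤ dist (point N x) z := by
  rw [Complex.dist_eq]
  exact Complex.abs_re_le_norm (point N x - z)

theorem dist_point_neighbour_le {N : ℕ} {x y : ℤ × ℤ} (hy : y ∈ insert x (neighbours x)) :
    dist (point N y) (point N x) ≤ 1 / N := by
  have h0 : (0 : ℝ) ≤ 1 / N := by positivity
  rw [Complex.dist_eq]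
  refine (Complex.norm_le_abs_re_add_abs_im _).trans ?_
  simp only [neighbours, Finset.mem_insert, Finset.mem_singleton] at hy
  simp only [point, Complex.sub_re, Complex.sub_im, ← sub_div, abs_div, Nat.abs_cast]
  rw [← add_div]
  refine div_le_div_of_nonneg_right ?_ (Nat.cast_nonneg N)
  rcases hy with rfl | rfl | rfl | rfl | rfl <;> norm_num

section
variable {Ω : Type*} [MeasurableSpace Ω] {P : ℕ → Measure Ω} [∀ N, IsProbabilityMeasure (P N)]
  {h : ℕ → Ω → ℤ → ℤ} {σ : ℕ → Ω → Config} {f : ℝ → ℝ} {a b : ℝ} {m : ℕ → ℤ} {e : ℤ}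

/-- The mean of the averaged drift is close to the difference of the corner densities at the two
crossing points. -/
theorem eventually_abs_integral_sub_le
    (hw : ∀ᶠ N : ℕ in atTop, IsGeometricWalk (P N) (h N) e
      (fun k => |derivWithin f (Icc a b) ((k : ℝ) / N)|) (m N) ⌊N * b⌋)
    (hm : ∀ᶠ N : ℕ in atTop, (m N : ℝ) / N ∈ Icc a b ∧ |a - (m N : ℝ) / N| ≤ 1 / N)
    (hlln : ∀ c ε : ℝ, 0 < c → 0 < ε → ∀ᶠ N : ℕ in atTop, ∀ k : ℤ, m N ≤ k → (k : ℝ) / N ≤ b →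
      (P N).real {ω | c ≤ |height N (h N ω) k - f ((k : ℝ) / N)|} ≤ ε)
    (hf : ContinuousOn f (Icc a b)) (hmono : MonotoneOn f (Icc a b) ∨ AntitoneOn f (Icc a b))
    {V : Set ℂ} (hst : ∀ᶠ N : ℕ in atTop, ∀ᵐ ω ∂(P N), ∀ k j : ℤ, (k : ℝ) / N ∈ Icc a b →
      point N (k, j) ∈ V → (σ N ω (k, j) = true ↔ j ≤ h N ω k))
    {c ρ K : ℝ} (hρ : Icc (c - 2 * ρ) (c + 2 * ρ) ⊆ Ioo a b)
    (hball : Metric.ball (graphPoint f c) ρ ⊆ V) (hK : 0 ≤ K)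
    (hlip : ∀ u ∈ Icc (c - 2 * ρ) (c + 2 * ρ), ∀ v ∈ Icc (c - 2 * ρ) (c + 2 * ρ),
      |cornerDensity f a b u - cornerDensity f a b v| ≤ K * |u - v|)
    {γ : Set ℂ} {r uL uR δ : ℝ} (hr : 0 < r) (hcr : IsGraphCrossing γ f a b c r uL uR) (hδ : 0 < δ)
    (hrδ : r + δ < ρ)
    {x₀ x₁ : ℂ} (h₀ : x₀ = graphPoint f uL ∨ x₀ = graphPoint f uR)
    (h₁ : x₁ = graphPoint f uL ∨ x₁ = graphPoint f uR) :
    ∀ᶠ N : ℕ in atTop, ∀ hN : 1 ≤ N,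
      |∫ ω, ∑ x ∈ (finite_meetingSites_region hN (graphPoint f c) r x₀ x₁ δ δ).toFinset,
        siteWeight N (graphPoint f c) r x₀ x₁ x δ * siteDrift (σ N ω) x ∂(P N) -
        e / 2 * (cornerDensity f a b uR - cornerDensity f a b uL)| ≤ 5 * K * δ := by
  have hρ0 : 0 < ρ := by linarith
  have haρ : a < c - 2 * ρ := (hρ (left_mem_Icc.2 (by linarith))).1
  have hbρ : c + 2 * ρ < b := (hρ (right_mem_Icc.2 (by linarith))).2
  obtain ⟨η, hη, hηin, hηout⟩ := hcr.exists_margin hmono hf hδ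
  have hev : ∀ x : ℝ, 0 < x → ∀ᶠ N : ℕ in atTop, 1 / (N : ℝ) ≤ x := fun x hx =>
    tendsto_one_div_atTop_nhds_zero_nat.eventually_le_const hx
  -- A height error below `η / 4` puts the corner within `η / 2` of the graph, and its box within
  -- `η`. The probability `δ / (2 * ρ)` is chosen so that summing over the window of length `2 * ρ`
  -- costs one `δ`.
  filter_upwards [hw, hm, hlln (η / 4) (δ / (2 * ρ)) (by positivity) (by positivity), hst,
    hev (η / 4) (by positivity), hev ((ρ - (r + δ)) / 4) (by linarith), hev (δ / 4) (by positivity)]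
    with N hwN hmN hllnN hstN hNη hNρ hNδ hN
  have hN' : (0 : ℝ) < N := by exact_mod_cast hN
  set s := graphPoint f c with hs
  set F := (finite_meetingSites_region hN s r x₀ x₁ δ δ).toFinset with hF
  set A : ℤ × ℤ → ℝ := fun x => siteWeight N s r x₀ x₁ x δ with hA
  have hA₀ : ∀ x, 0 ≤ A x := fun x => siteWeight_nonneg N s r x₀ x₁ x hδ.le
  have hA₁ : ∀ x, A x ≤ 1 := fun x => siteWeight_le_one N s r x₀ x₁ x hδ
  have hAF : ∀ x ∉ F, A x = 0 := fun x hx => by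
    rw [hF, Finite.mem_toFinset] at hx
    exact siteWeight_eq_zero N s r x₀ x₁ x hδ.le hx
  have hsub := region_subset (s := s) (r := r) (δ := δ) h₀ h₁
  have hdL := hcr.dist_left
  have hdR := hcr.dist_right
  have hregion : ∀ z ∈ region s r x₀ x₁ δ δ, dist z s ≤ r + δ := by
    intro z hz
    rcases hsub hz with (hz | hz) | hz
    · rw [Metric.mem_closedBall] at hz
      linarith
    · rw [Metric.mem_closedBall] at hz
      linarith [dist_triangle z (graphPoint f uL) s]
    · rw [Metric.mem_closedBall] at hz
      linarith [dist_triangle z (graphPoint f uR) s]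
  have hFdist : ∀ x ∈ F, dist (point N x) s ≤ r + δ + 1 / N := by
    intro x hx
    rw [hF, Finite.mem_toFinset] at hx
    obtain ⟨z, hz1, hz2⟩ := hx
    have h3 := dist_point_le hz1
    rw [dist_comm] at h3
    linarith [dist_triangle (point N x) z s, hregion z hz2]
  have hs_re : s.re = c := rfl
  have h2N : 2 ≤ N * (ρ - (r + δ)) := by
    have : 1 / (N : ℝ) * N ≤ (ρ - (r + δ)) / 4 * N := mul_le_mul_of_nonneg_right hNρ hN'.le
    rw [one_div, inv_mul_cancel₀ hN'.ne'] at this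
    linarith
  set k₀ := ⌈N * (c - ρ)⌉ with hk₀
  set k₁ := ⌊N * (c + ρ)⌋ with hk₁
  -- The gap `ρ - (r + δ)` is worth at least two lattice steps: one for the size of a box and one
  -- for the rounding of the window.
  have hcols : ∀ x ∈ F, k₀ < x.1 ∧ x.1 < k₁ := by
    intro x hx
    have h3 := (abs_re_point_sub_le N x s).trans (hFdist x hx)
    rw [hs_re, abs_le] at h3
    have e1 : (x.1 : ℝ) = N * (x.1 / N) := by field_simp
    have e2 : N * (1 / (N : ℝ)) = 1 := by field_simp
    have h4 : N * (c - (r + δ + 1 / N)) ≤ x.1 := by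
      rw [e1]; exact mul_le_mul_of_nonneg_left (by linarith [h3.1]) hN'.le
    have h5 : (x.1 : ℝ) ≤ N * (c + (r + δ + 1 / N)) := by
      rw [e1]; exact mul_le_mul_of_nonneg_left (by linarith [h3.2]) hN'.le
    have h6 := Int.ceil_lt_add_one (N * (c - ρ))
    have h7 := Int.lt_floor_add_one (N * (c + ρ))
    have h8 : (k₀ : ℝ) < x.1 := by
      rw [hk₀]
      nlinarith
    have h9 : (x.1 : ℝ) < k₁ := by
      rw [hk₁]
      nlinarith
    exact ⟨by exact_mod_cast h8, by exact_mod_cast h9⟩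
  have hk01 : k₀ ≤ k₁ := by
    rw [hk₁, Int.le_floor]
    have h6 := Int.ceil_lt_add_one (N * (c - ρ))
    have : 0 < N * r := by positivity
    have : 0 < N * δ := by positivity
    rw [hk₀]
    nlinarith
  -- The reference point is within `1 / N` of `a`, hence to the left of the window.
  have hmk₀ : m N ≤ k₀ := by
    have h3 := (abs_le.1 hmN.2).1
    have h4 : (m N : ℝ) / N ≤ c - ρ := by
      have : 1 / (N : ℝ) ≤ ρ := by linarith
      linarith
    rw [div_le_iff₀ hN'] at h4
    have h5 := Int.le_ceil (N * (c - ρ))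
    have h6 : (m N : ℝ) ≤ k₀ := by rw [hk₀]; linarith
    exact_mod_cast h6
  have hk₁M : k₁ ≤ ⌊N * b⌋ := Int.floor_le_floor (mul_le_mul_of_nonneg_left (by linarith) hN'.le)
  have hstair : ∀ᵐ ω ∂(P N), ∀ x ∈ F, IsStaircaseAt (σ N ω) (h N ω) x := by
    filter_upwards [hstN] with ω hω x hx y hy
    have h3 : dist (point N y) s < ρ := by
      have h4 := dist_point_neighbour_le (N := N) hy
      have h5 := hFdist x hx
      have h6 := dist_triangle (point N y) (point N x) s
      have h7 : (0 : ℝ) < 1 / N := by positivity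
      linarith
    have h4 := (abs_re_point_sub_le N y s).trans h3.le
    rw [hs_re, abs_le] at h4
    have h5 : (y.1 : ℝ) / N ∈ Icc a b := ⟨by linarith [h4.1], by linarith [h4.2]⟩
    exact hω y.1 y.2 h5 (hball h3)
  rw [hwN.integral_sum_siteDrift hA₀ hA₁ hAF hmk₀ hk01 hk₁M hcols hstair]
  set g : ℤ → ℝ := fun k => ∫ ω, A (k, h N ω k + IsGeometricWalk.cornerOffset e) ∂(P N) with hg
  have hgint : ∀ k, Integrable (fun ω => A (k, h N ω k + IsGeometricWalk.cornerOffset e)) (P N) :=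
    fun k => integrable_weight hA₀ hA₁ ((hwN.measurable k).add_const _)
  have hg₀ : ∀ k, 0 ≤ g k := fun k => integral_nonneg fun ω => hA₀ _
  have hg₁ : ∀ k, g k ≤ 1 := fun k => by
    have := integral_mono (hgint k) (integrable_const (1 : ℝ)) fun ω => hA₁ _
    simpa using this
  have hmeas : ∀ k, MeasurableSet {ω | η / 4 ≤ |height N (h N ω) k - f ((k : ℝ) / N)|} := by
    intro k
    have h3 : Measurable fun ω => |height N (h N ω) k - f ((k : ℝ) / N)| :=
      (measurable_of_countable (fun z : ℤ => |((z : ℝ) + 1 / 2) / N - f ((k : ℝ) / N)|)).comp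
        (hwN.measurable k)
    exact measurableSet_le measurable_const h3
  have hrange : ∀ k ∈ Finset.Ico k₀ k₁, m N ≤ k ∧ (k : ℝ) / N ∈ Icc a b := by
    intro k hk
    rw [Finset.mem_Ico] at hk
    refine ⟨by omega, ?_, ?_⟩
    · have h3 : (k₀ : ℝ) ≤ k := by exact_mod_cast hk.1
      have h4 := Int.le_ceil (N * (c - ρ))
      rw [le_div_iff₀ hN']
      nlinarith
    · have h3 : (k : ℝ) ≤ k₁ := by exact_mod_cast hk.2.le
      have h4 := Int.floor_le (N * (c + ρ))
      rw [div_le_iff₀ hN']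
      nlinarith
  -- Unless the height is far from `f`, the corner box misses the region and its weight is `0`; the
  -- mean weight is at most the probability of a large deviation.
  have hout : ∀ k ∈ Finset.Ico k₀ k₁,
      (k : ℝ) / N < uL - 2 * δ ∨ uR + 2 * δ < (k : ℝ) / N → g k ≤ δ / (2 * ρ) := by
    intro k hk hk'
    obtain ⟨hk1, hk2⟩ := hrange k hk
    refine le_trans ?_ (hllnN k hk1 hk2.2)
    rw [← integral_indicator_one (hmeas k)]
    refine integral_mono (hgint k) ((integrable_const (1 : ℝ)).indicator (hmeas k)) fun ω => ?_
    dsimp only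
    by_cases hω : η / 4 ≤ |height N (h N ω) k - f ((k : ℝ) / N)|
    · rw [indicator_of_mem
        (s := {ω | η / 4 ≤ |height N (h N ω) k - f ((k : ℝ) / N)|}) hω]
      exact hA₁ _
    · rw [indicator_of_notMem
        (s := {ω | η / 4 ≤ |height N (h N ω) k - f ((k : ℝ) / N)|}) hω]
      have h3 := dist_point_add_offset_lt (e := e) hNη (not_le.1 hω)
      refine (siteWeight_eq_zero N s r x₀ x₁ _ hδ.le ?_).le
      rintro ⟨z, hz1, hz2⟩
      refine hηout _ hk2 (hk'.imp le_of_lt le_of_lt) z ?_ (hsub hz2)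
      have h4 := dist_point_le hz1
      linarith [dist_triangle z (point N (k, h N ω k + IsGeometricWalk.cornerOffset e))
        (graphPoint f ((k : ℝ) / N))]
  -- Unless the height is far from `f`, the corner lies in the disc and its weight is `1`.
  have hin : ∀ k : ℤ, uL + 2 * δ < (k : ℝ) / N → (k : ℝ) / N < uR - 2 * δ →
      1 - δ / (2 * ρ) ≤ g k := by
    intro k hk hk'
    have habs := abs_sub_le_dist_graphPoint f uL c
    have habs' := abs_sub_le_dist_graphPoint f uR c
    rw [hdL, abs_le] at habs
    rw [hdR, abs_le] at habs'
    have hk1 : m N ≤ k := by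
      have h3 : c - ρ ≤ (k : ℝ) / N := by linarith [habs.1]
      rw [le_div_iff₀ hN'] at h3
      have h4 : k₀ ≤ k := by
        rw [hk₀, Int.ceil_le]; linarith
      omega
    have hk2 : (k : ℝ) / N ≤ b := by linarith [habs'.2]
    have h5 := hllnN k hk1 hk2
    have h6 : 1 - g k ≤ (P N).real {ω | η / 4 ≤ |height N (h N ω) k - f ((k : ℝ) / N)|} := by
      have h7 : 1 - g k = ∫ ω, (1 - A (k, h N ω k + IsGeometricWalk.cornerOffset e)) ∂(P N) := by
        rw [integral_sub (integrable_const _) (hgint k)]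
        simp [hg]
      rw [h7, ← integral_indicator_one (hmeas k)]
      refine integral_mono ((integrable_const _).sub (hgint k))
        ((integrable_const (1 : ℝ)).indicator (hmeas k)) fun ω => ?_
      dsimp only
      by_cases hω : η / 4 ≤ |height N (h N ω) k - f ((k : ℝ) / N)|
      · rw [indicator_of_mem
          (s := {ω | η / 4 ≤ |height N (h N ω) k - f ((k : ℝ) / N)|}) hω,
          Pi.one_apply]
        linarith [hA₀ (k, h N ω k + IsGeometricWalk.cornerOffset e)]
      · rw [indicator_of_notMem
          (s := {ω | η / 4 ≤ |height N (h N ω) k - f ((k : ℝ) / N)|}) hω]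
        have h3 := dist_point_add_offset_lt (e := e) hNη (not_le.1 hω)
        have h8 := siteWeight_eq_one N s r x₀ x₁ (k, h N ω k + IsGeometricWalk.cornerOffset e) hN hδ
          (hηin _ hk.le hk'.le _ (by linarith))
        simp only [hA, h8, sub_self, le_refl]
    linarith
  have habs := abs_sub_le_dist_graphPoint f uL c
  have habs' := abs_sub_le_dist_graphPoint f uR c
  rw [hdL, abs_le] at habs
  rw [hdR, abs_le] at habs'
  have hNδ0 : 0 < N * δ := by positivity
  have hmain := abs_weighted_sum_sub_le (N := N) (w := cornerDensity f a b) (g := g) (c := c)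
    (ρ := ρ) (uL := uL) (uR := uR) (δ := δ) (ε := δ / (2 * ρ)) (K := K) hN hδ (by positivity)
    (by linarith) (hcr.left_lt.trans hcr.lt_right).le (by nlinarith [habs.1])
    (by nlinarith [habs'.2]) hlip hK hg₀ hg₁ hout hin
  have hea : |(e : ℝ) / 2| = 1 / 2 := by
    rcases hwN.sign with he | he <;> rw [he] <;> norm_num [abs_div]
  rw [← mul_sub, abs_mul, hea]
  have h9 : 2 * ρ * (δ / (2 * ρ)) = δ := by field_simp
  have h10 : 4 / (N : ℝ) ≤ δ := by
    have : 4 / (N : ℝ) = 4 * (1 / N) := by ring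
    linarith
  have h11 : K * (2 * ρ * (δ / (2 * ρ)) + 8 * δ + 4 / N) ≤ K * (10 * δ) :=
    mul_le_mul_of_nonneg_left (by linarith) hK
  have h12 := hmain.trans h11
  calc _ ≤ 1 / 2 * (K * (10 * δ)) := mul_le_mul_of_nonneg_left h12 (by norm_num)
    _ = 5 * K * δ := by ring
end

/-! ### Spohn's initial condition as a geometric walk -/

section
variable {Ω : Type*} [MeasurableSpace Ω] {P : ℕ → Measure Ω} [∀ N, IsProbabilityMeasure (P N)]
  {σ : ℕ → Ω → Config} {h : ℕ → Ω → ℤ → ℤ} {γ D V : Set ℂ} {s : ℂ} {a b : ℝ} {f : ℝ → ℝ}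
  {m : ℕ → ℤ} (hS : SpohnInitialCondition γ D s V a b f m P σ h)
include hS

/-- The direction of monotonicity provides `e`, which also fixes the sign of the slope. The window
ends at `⌊N * b⌋` so that every increment is taken over two abscissas of `[a, b]`. -/
theorem SpohnInitialCondition.exists_sign_isGeometricWalk : ∃ e : ℤ,
    (∀ u ∈ Icc a b, (e : ℝ) * |derivWithin f (Icc a b) u| = derivWithin f (Icc a b) u) ∧
    ∀ N : ℕ, 1 ≤ N → (m N : ℝ) / N ∈ Icc a b → IsGeometricWalk (P N) (h N) e
      (fun k => |derivWithin f (Icc a b) ((k : ℝ) / N)|) (m N) ⌊N * b⌋ := by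
  have hp : ∀ N : ℕ, 1 ≤ N → (m N : ℝ) / N ∈ Icc a b → ∀ k ∈ Ico (m N) ⌊N * b⌋,
      (k : ℝ) / N ∈ Icc a b ∧ ((k + 1 : ℤ) : ℝ) / N ∈ Icc a b := by
    intro N hN hmN k hk
    have hN' : (0 : ℝ) < N := by exact_mod_cast hN
    have h1 : ((k + 1 : ℤ) : ℝ) / N ≤ b := by
      rw [div_le_iff₀ hN', mul_comm, ← Int.le_floor]
      exact hk.2
    have h2 : a ≤ (k : ℝ) / N :=
      hmN.1.trans (div_le_div_of_nonneg_right (by exact_mod_cast hk.1) hN'.le)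
    have h3 : (k : ℝ) / N ≤ ((k + 1 : ℤ) : ℝ) / N :=
      div_le_div_of_nonneg_right (by push_cast; linarith) hN'.le
    exact ⟨⟨h2, h3.trans h1⟩, ⟨h2.trans h3, h1⟩⟩
  rcases hS.monotone with hmono | hanti
  · refine ⟨1, fun u _ => ?_, fun N hN hmN => ?_⟩
    · rw [abs_of_nonneg hmono.derivWithin_nonneg, Int.cast_one, one_mul]
    · refine isGeometricWalk_of_indep (hS.measurable_height N) (Or.inl rfl) (fun _ => abs_nonneg _)
        (fun k hk l => ?_) (hp N hN hmN) (hS.indep_increments N hN) (hS.indep_reference N hN)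
      have h1 := hp N hN hmN k hk
      rw [← hS.law_of_monotone hmono N hN k h1.1 h1.2 l]
      simp only [one_mul]
  · refine ⟨-1, fun u _ => ?_, fun N hN hmN => ?_⟩
    · rw [abs_of_nonpos hanti.derivWithin_nonpos]
      push_cast
      ring
    · refine isGeometricWalk_of_indep (hS.measurable_height N) (Or.inr rfl) (fun _ => abs_nonneg _)
        (fun k hk l => ?_) (hp N hN hmN) (hS.indep_increments N hN) (hS.indep_reference N hN)
      have h1 := hp N hN hmN k hk
      have h2 := hS.law_of_antitone hanti N hN k h1.1 h1.2 (-l)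
      rw [neg_neg] at h2
      rw [← h2]
      congr 1
      ext ω
      simp only [mem_ofPred_eq]
      omega

end

section
variable {Ω : Type*} [MeasurableSpace Ω] {P : ℕ → Measure Ω}
  {σ : ℕ → Ω → Config} {h : ℕ → Ω → ℤ → ℤ} {φ : ℝ → ℂ} {D V : Set ℂ} {t a b : ℝ} {f : ℝ → ℝ}
  {m : ℕ → ℤ}

/-- Up to a spin reversal the droplet is below its boundary. -/
theorem SpohnInitialCondition.exists_side
    (hS : SpohnInitialCondition (range φ) D (φ t) V a b f m P σ h) (hφ : IsC2JordanCurve φ D) :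
    ∃ (w : ℝ) (σ' : ℕ → Ω → Config), w * (deriv φ t).re = -|(deriv φ t).re| ∧ |w| = 1 ∧
      (∀ N ω x, siteDrift (σ N ω) x = w * siteDrift (σ' N ω) x) ∧
      ∀ N : ℕ, 1 ≤ N → ∀ᵐ ω ∂(P N), ∀ k j : ℤ, (k : ℝ) / N ∈ Icc a b →
        point N (k, j) ∈ V → (σ' N ω (k, j) = true ↔ j ≤ h N ω k) := by
  rcases hS.side with ⟨hD, hσ⟩ | ⟨hD, hσ⟩
  · have h1 := hφ.re_deriv_neg hS.graph hS.differentiable hS.mem_nhds hD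
    refine ⟨1, σ, ?_, by norm_num, fun N ω x => (one_mul _).symm, hσ⟩
    rw [abs_of_neg h1]
    ring
  · have h1 := hφ.re_deriv_pos hS.graph hS.differentiable hS.mem_nhds hD
    -- The reversed configuration has its plus spins below the same heights.
    refine ⟨-1, fun N ω y => !σ N ω y, ?_, by norm_num, fun N ω x => ?_, fun N hN => ?_⟩
    · rw [abs_of_pos h1]
      ring
    · rw [siteDrift_not]
      ring
    · filter_upwards [hσ N hN] with ω hω k j hk hj
      have h2 := hω k j hk hj
      rw [Bool.not_eq_true', ← Bool.not_eq_true, h2, not_lt]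

end

/-! ### Regularity of the corner density -/

/-- Both the absolute value and `p ↦ p / (1 + p)` on `[0, ∞)` are `1`-Lipschitz. -/
theorem abs_cornerDensity_sub_le (f : ℝ → ℝ) (a b u v : ℝ) :
    |cornerDensity f a b u - cornerDensity f a b v| ≤
      |derivWithin f (Icc a b) u - derivWithin f (Icc a b) v| := by
  refine le_trans ?_ (abs_abs_sub_abs_le _ _)
  simp only [cornerDensity]
  have hp := abs_nonneg (derivWithin f (Icc a b) u)
  have hq := abs_nonneg (derivWithin f (Icc a b) v)
  set p := |derivWithin f (Icc a b) u|
  set q := |derivWithin f (Icc a b) v|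
  have h1 : p / (1 + p) - q / (1 + q) = (p - q) / ((1 + p) * (1 + q)) := by
    field_simp
    ring
  rw [h1, abs_div]
  refine div_le_self (abs_nonneg _) ?_
  rw [abs_of_pos (by positivity)]
  nlinarith [mul_nonneg hp hq]

/-- Monotonicity gives the slope a fixed sign, so its absolute value equals `e` times the slope near
`c` and stays differentiable even where the slope vanishes. -/
theorem hasDerivAt_cornerDensity {f : ℝ → ℝ} {a b e κ c : ℝ} (he : |e| = 1)
    (hsign : ∀ᶠ u in 𝓝 c, e * |derivWithin f (Icc a b) u| = derivWithin f (Icc a b) u)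
    (hd : HasDerivAt (derivWithin f (Icc a b)) κ c) :
    HasDerivAt (cornerDensity f a b) (e * κ / (1 + |derivWithin f (Icc a b) c|) ^ 2) c := by
  have hee : e * e = 1 := by rw [← abs_mul_abs_self, he, one_mul]
  have habs : ∀ᶠ u in 𝓝 c, |derivWithin f (Icc a b) u| = e * derivWithin f (Icc a b) u := by
    filter_upwards [hsign] with u hu
    rw [← hu, ← mul_assoc, hee, one_mul, abs_mul, he, one_mul, abs_abs]
  have hc := habs.self_of_nhds
  have hne : 1 + e * derivWithin f (Icc a b) c ≠ 0 := by
    rw [← hc]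
    positivity
  have h1 := (hd.const_mul e).fun_div ((hd.const_mul e).const_add 1) hne
  rw [hc]
  have h2 : cornerDensity f a b =ᶠ[𝓝 c] fun u =>
      e * derivWithin f (Icc a b) u / (1 + e * derivWithin f (Icc a b) u) := by
    filter_upwards [habs] with u hu
    rw [cornerDensity, hu]
  refine (h1.congr_of_eventuallyEq h2).congr_deriv ?_
  congr 1
  ring

/-! ### Lower and upper limits -/

/-- Both limits in `N` lie between `G - C * δ` and `G + C * δ`. In `EReal` they exist without
boundedness conditions. -/
theorem tendsto_liminf_limsup_of_abs_sub_le {F : ℝ → ℕ → ℝ} {G C : ℝ}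
    (hF : ∀ᶠ δ in 𝓝[>] (0 : ℝ), ∀ᶠ N in atTop, |F δ N - G| ≤ C * δ) :
    Tendsto (fun δ => liminf (fun N => (F δ N : EReal)) atTop) (𝓝[>] 0) (𝓝 (G : EReal)) ∧
    Tendsto (fun δ => limsup (fun N => (F δ N : EReal)) atTop) (𝓝[>] 0) (𝓝 (G : EReal)) := by
  have hlo : Tendsto (fun δ : ℝ => ((G - C * δ : ℝ) : EReal)) (𝓝[>] 0) (𝓝 (G : EReal)) := by
    refine EReal.tendsto_coe.2 (tendsto_nhdsWithin_of_tendsto_nhds ?_)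
    have : Continuous fun δ : ℝ => G - C * δ := by fun_prop
    simpa using this.tendsto 0
  have hup : Tendsto (fun δ : ℝ => ((G + C * δ : ℝ) : EReal)) (𝓝[>] 0) (𝓝 (G : EReal)) := by
    refine EReal.tendsto_coe.2 (tendsto_nhdsWithin_of_tendsto_nhds ?_)
    have : Continuous fun δ : ℝ => G + C * δ := by fun_prop
    simpa using this.tendsto 0
  have h1 : ∀ᶠ δ in 𝓝[>] (0 : ℝ), ((G - C * δ : ℝ) : EReal) ≤
      liminf (fun N => (F δ N : EReal)) atTop := by
    filter_upwards [hF] with δ hδ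
    refine le_liminf_of_le (by isBoundedDefault) ?_
    filter_upwards [hδ] with N hN
    exact EReal.coe_le_coe_iff.2 (by linarith [(abs_le.1 hN).1])
  have h2 : ∀ᶠ δ in 𝓝[>] (0 : ℝ), limsup (fun N => (F δ N : EReal)) atTop ≤
      ((G + C * δ : ℝ) : EReal) := by
    filter_upwards [hF] with δ hδ
    refine limsup_le_of_le (by isBoundedDefault) ?_
    filter_upwards [hδ] with N hN
    exact EReal.coe_le_coe_iff.2 (by linarith [(abs_le.1 hN).2])
  have h3 : ∀ δ, liminf (fun N => (F δ N : EReal)) atTop ≤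
      limsup (fun N => (F δ N : EReal)) atTop := fun δ => liminf_le_limsup
  exact ⟨tendsto_of_tendsto_of_tendsto_of_le_of_le' hlo hup h1
      (h2.mono fun δ hδ => (h3 δ).trans hδ),
    tendsto_of_tendsto_of_tendsto_of_le_of_le' hlo hup
      (h1.mono fun δ hδ => hδ.trans (h3 δ)) h2⟩

/-! ### The limit as the radius tends to zero -/

/-- With `n = ‖φ'‖`, the length factor is `n / |x'|` and `|cos| + |sin|` is `(|x'| + |y'|) / n`. The
sign `e` occurs twice and cancels, and `w = -|x'| / x'` corrects the odd power of `x'`. -/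
theorem curvature_limit_eq {φ : ℝ → ℂ} {t w e : ℝ} (hx : (deriv φ t).re ≠ 0)
    (hw : w * (deriv φ t).re = -|(deriv φ t).re|) (he : |e| = 1) :
    w * e / 4 * (2 * (e * (((deriv φ t).re * (deriv (deriv φ) t).im -
      (deriv (deriv φ) t).re * (deriv φ t).im) / (deriv φ t).re ^ 3) /
        (1 + |curveSlope φ t|) ^ 2) / √(1 + curveSlope φ t ^ 2)) =
      -curvature φ t /
        (2 * (|Real.cos (deriv φ t).arg| + |Real.sin (deriv φ t).arg|) ^ 2) := by
  have hee : e * e = 1 := by rw [← abs_mul_abs_self, he, one_mul]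
  have hne : deriv φ t ≠ 0 := fun h => hx (by rw [h]; rfl)
  rw [Complex.cos_arg hne, Complex.sin_arg]
  simp only [curvature, curveSlope]
  have hn : 0 < ‖deriv φ t‖ := norm_pos_iff.2 hne
  have hsq : ‖deriv φ t‖ ^ 2 = (deriv φ t).re ^ 2 + (deriv φ t).im ^ 2 := by
    rw [Complex.sq_norm, Complex.normSq_apply]
    ring
  set n := ‖deriv φ t‖
  set C := (deriv φ t).re * (deriv (deriv φ) t).im - (deriv (deriv φ) t).re * (deriv φ t).im
  set x := (deriv φ t).re
  set y := (deriv φ t).im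
  have hax : 0 < |x| := abs_pos.2 hx
  have hsqrt : √(1 + (y / x) ^ 2) = n / |x| := by
    rw [Real.sqrt_eq_iff_mul_self_eq_of_pos (by positivity)]
    rw [div_mul_div_comm, abs_mul_abs_self, ← sq, ← sq, hsq]
    field_simp
  have hwx : w = -|x| / x := by
    rw [eq_div_iff hx, hw]
  have hx2 : x ^ 2 = |x| ^ 2 := (sq_abs x).symm
  rw [hsqrt, abs_div, abs_div, abs_div, abs_of_pos hn, hwx]
  have h1 : -|x| / x * e / 4 * (2 * (e * (C / x ^ 3) / (1 + |y| / |x|) ^ 2) / (n / |x|)) =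
      -((e * e) * |x| ^ 2 * C) / (2 * (x ^ 2) ^ 2 * (1 + |y| / |x|) ^ 2 * n) := by
    field_simp
    ring
  rw [h1, hee, hx2]
  field_simp

/-- The two crossings lie on opposite sides of `c`, so their one-sided limits are opposite and add
up in the difference. -/
theorem tendsto_cornerDensity_crossing {γ : Set ℂ} {f : ℝ → ℝ} {a b c p W' : ℝ}
    (hf : HasDerivAt f p c) (hW : HasDerivAt (cornerDensity f a b) W' c) {uL uR : ℝ → ℝ}
    (hcr : ∀ᶠ r in 𝓝[>] (0 : ℝ), IsGraphCrossing γ f a b c r (uL r) (uR r)) :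
    Tendsto (fun r => (cornerDensity f a b (uR r) - cornerDensity f a b (uL r)) / r) (𝓝[>] 0)
      (𝓝 (2 * W' / √(1 + p ^ 2))) := by
  have hR := tendsto_div_radius hf hW (v := uR) (e := 1) (by norm_num) (by
    filter_upwards [hcr] with r hr
    exact ⟨by linarith [hr.lt_right], hr.dist_right⟩)
  have hL := tendsto_div_radius hf hW (v := uL) (e := -1) (by norm_num) (by
    filter_upwards [hcr] with r hr
    exact ⟨by linarith [hr.left_lt], hr.dist_left⟩)
  convert hR.sub hL using 2
  · ring
  · ring

theorem IsCrossingPair.eq_graphPoint {φ : ℝ → ℂ} {t r : ℝ} {x₀ x₁ : ℂ} {f : ℝ → ℝ} {a b uL uR : ℝ}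
    (hx : IsCrossingPair φ t r x₀ x₁) (hpt : graphPoint f (φ t).re = φ t)
    (hcr : IsGraphCrossing (range φ) f a b (φ t).re r uL uR) :
    (x₀ = graphPoint f uL ∨ x₀ = graphPoint f uR) ∧
      (x₁ = graphPoint f uL ∨ x₁ = graphPoint f uR) := by
  have h1 := hcr.inter_eq
  rw [hpt, hx.1] at h1
  have h2 : x₀ ∈ ({graphPoint f uL, graphPoint f uR} : Set ℂ) := h1 ▸ mem_insert _ _
  have h3 : x₁ ∈ ({graphPoint f uL, graphPoint f uR} : Set ℂ) :=
    h1 ▸ mem_insert_of_mem _ (mem_singleton _)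
  exact ⟨h2, h3⟩

/-- The mean of the averaged drift at a fixed small radius. -/
theorem SpohnInitialCondition.exists_mean_avgDrift_bound
    {Ω' : Type*} [mΩ' : MeasurableSpace Ω'] {Q : Config → Measure Ω'}
    {ℱ : Filtration ℝ≥0 mΩ'} {X : ℝ≥0 → Ω' → Config} (hX : IsGlauberProcess Q ℱ X)
    {φ : ℝ → ℂ} {D : Set ℂ} (hφ : IsC2JordanCurve φ D) {t : ℝ}
    {V : Set ℂ} {a b : ℝ} {f : ℝ → ℝ} {m : ℕ → ℤ}
    {Ω : Type*} [MeasurableSpace Ω] {P : ℕ → Measure Ω} [∀ N, IsProbabilityMeasure (P N)]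
    {σ : ℕ → Ω → Config} {h : ℕ → Ω → ℤ → ℤ}
    (hS : SpohnInitialCondition (range φ) D (φ t) V a b f m P σ h)
    (hm : ∀ᶠ N : ℕ in atTop, (m N : ℝ) / N ∈ Icc a b ∧ |a - (m N : ℝ) / N| ≤ 1 / N)
    (hconv : ∀ ε : ℝ, 0 < ε →
      Tendsto (fun N : ℕ => (P N).real {ω | ε ≤ |height N (h N ω) (m N) - f a|}) atTop (𝓝 0)) :
    ∃ v K : ℝ,
      (∀ uL uR : ℝ → ℝ,
        (∀ᶠ r in 𝓝[>] (0 : ℝ), IsGraphCrossing (range φ) f a b (φ t).re r (uL r) (uR r)) →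
        Tendsto (fun r => v * ((cornerDensity f a b (uR r) - cornerDensity f a b (uL r)) / r))
          (𝓝[>] 0) (𝓝 (-curvature φ t /
            (2 * (|Real.cos (deriv φ t).arg| + |Real.sin (deriv φ t).arg|) ^ 2)))) ∧
      ∀ᶠ r in 𝓝[>] (0 : ℝ), ∀ x₀ x₁ uL uR, IsCrossingPair φ t r x₀ x₁ →
        IsGraphCrossing (range φ) f a b (φ t).re r uL uR →
        ∀ᶠ δ in 𝓝[>] (0 : ℝ), ∀ᶠ N : ℕ in atTop,
          |1 / (2 * r) * ∫ ω, avgDrift Q X N (σ N ω) (φ t) r x₀ x₁ δ ∂(P N) -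
            v * ((cornerDensity f a b uR - cornerDensity f a b uL) / r)| ≤ K / r * δ := by
  obtain ⟨e, hsign, hwalk⟩ := hS.exists_sign_isGeometricWalk
  obtain ⟨w, σ', hw, hw1, hσ', hst⟩ := hS.exists_side hφ
  have hdiff := hS.differentiable
  have hI := hφ.re_mem_Ioo hS.graph hdiff hS.mem_nhds
  have hpt := hφ.graphPoint_eq hS.graph hS.mem_nhds
  have hInhds := hφ.Icc_mem_nhds hS.graph hdiff hS.mem_nhds
  have hab := hI.1.trans hI.2
  obtain ⟨hreg, hslope, hd⟩ := hφ.derivWithin_regular hS.graph hdiff hS.mem_nhds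
  have hfd := (hdiff _ (Ioo_subset_Icc_self hI)).hasDerivWithinAt.hasDerivAt hInhds
  rw [hslope] at hfd
  have hwalk' : ∀ᶠ N : ℕ in atTop, IsGeometricWalk (P N) (h N) e
      (fun k => |derivWithin f (Icc a b) ((k : ℝ) / N)|) (m N) ⌊N * b⌋ := by
    filter_upwards [hm, eventually_ge_atTop 1] with N hmN hN using hwalk N hN hmN.1
  have hst' : ∀ᶠ N : ℕ in atTop, ∀ᵐ ω ∂(P N), ∀ k j : ℤ, (k : ℝ) / N ∈ Icc a b →
      point N (k, j) ∈ V → (σ' N ω (k, j) = true ↔ j ≤ h N ω k) := by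
    filter_upwards [eventually_ge_atTop 1] with N hN using hst N hN
  -- The sign is a property of the walk, so it is read off at any single large `N`.
  have he : |(e : ℝ)| = 1 := by
    obtain ⟨N, hN⟩ := hwalk'.exists
    rcases hN.sign with h1 | h1 <;> rw [h1] <;> norm_num
  have hlln := fun c ε hc hε => eventually_height_close hab hdiff
    (hφ.continuousOn_derivWithin hS.graph hdiff hab) hsign hwalk' hm hconv (c := c) (ε := ε) hc hε
  have hcd := hasDerivAt_cornerDensity he (by
    filter_upwards [hInhds] with u hu using hsign u hu) hd
  rw [hslope] at hcd
  obtain ⟨K, U, hU, hK⟩ := hreg.exists_lipschitzOnWith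
  obtain ⟨ρ₁, hρ₁, hρU⟩ := Metric.nhds_basis_closedBall.mem_iff.1
    (inter_mem hU (isOpen_Ioo.mem_nhds hI))
  have hVn := hS.mem_nhds
  rw [← hpt] at hVn
  obtain ⟨ρ₂, hρ₂, hρV⟩ := Metric.mem_nhds_iff.1 hVn
  -- The Lipschitz window has half-width `2 * ρ`, hence the half of `ρ₁`; the disc of radius `ρ`
  -- must lie in `V`.
  set ρ := min (ρ₁ / 2) ρ₂ with hρdef
  have hρ0 : 0 < ρ := lt_min (by positivity) hρ₂
  have hρsub : Icc ((φ t).re - 2 * ρ) ((φ t).re + 2 * ρ) ⊆ U ∩ Ioo a b := by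
    refine Subset.trans ?_ hρU
    rw [Real.closedBall_eq_Icc]
    have := min_le_left (ρ₁ / 2) ρ₂
    exact Icc_subset_Icc (by linarith) (by linarith)
  have hlip : ∀ u ∈ Icc ((φ t).re - 2 * ρ) ((φ t).re + 2 * ρ),
      ∀ v ∈ Icc ((φ t).re - 2 * ρ) ((φ t).re + 2 * ρ),
      |cornerDensity f a b u - cornerDensity f a b v| ≤ K * |u - v| := fun u hu v hv =>
    (abs_cornerDensity_sub_le f a b u v).trans
      (hK.dist_le_mul u (hρsub hu).1 v (hρsub hv).1)
  -- The mean drift is `w * e / 2` times the difference of densities, with error `5 * K * δ`; the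
  -- normalization `1 / (2 * r)` halves both constants.
  refine ⟨w * e / 4, 5 * K / 2, fun uL uR hcr => ?_, ?_⟩
  · rw [← curvature_limit_eq (hφ.re_deriv_ne_zero_of_nhds hS.graph hdiff hS.mem_nhds) hw he]
    exact (tendsto_cornerDensity_crossing hfd hcd hcr).const_mul _
  · filter_upwards [Ioo_mem_nhdsGT hρ0] with r hr x₀ x₁ uL uR hx hcr
    obtain ⟨h₀, h₁⟩ := hx.eq_graphPoint hpt hcr
    filter_upwards [Ioo_mem_nhdsGT (sub_pos.2 hr.2)] with δ hδ
    filter_upwards [eventually_abs_integral_sub_le hwalk' hm hlln hdiff.continuousOn hS.monotone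
      hst' (fun u hu => (hρsub hu).2) ((Metric.ball_subset_ball (min_le_right _ _)).trans hρV)
      K.coe_nonneg hlip hr.1 hcr hδ.1 (by linarith [hδ.2]) h₀ h₁, eventually_ge_atTop 1]
      with N hmain hN
    replace hmain := hmain hN
    rw [hpt] at hmain
    simp_rw [hX.avgDrift_eq hN _ _ _ _ _ hδ.1, hσ', mul_left_comm _ w, ← Finset.mul_sum]
    rw [integral_const_mul]
    set J := ∫ ω, ∑ x ∈ (finite_meetingSites_region hN (φ t) r x₀ x₁ δ δ).toFinset,
      siteWeight N (φ t) r x₀ x₁ x δ * siteDrift (σ' N ω) x ∂(P N)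
    set W := cornerDensity f a b uR - cornerDensity f a b uL
    have hr0 := hr.1
    have h3 : 1 / (2 * r) * (w * J) - w * e / 4 * (W / r) =
        w * (1 / (2 * r)) * (J - e / 2 * W) := by
      field_simp
      ring
    rw [h3, abs_mul, abs_mul, hw1, one_mul, abs_of_pos (by positivity)]
    calc _ ≤ 1 / (2 * r) * (5 * K * δ) := mul_le_mul_of_nonneg_left hmain (by positivity)
      _ = _ := by
        field_simp

end

/-! ### The theorem -/

theorem proposition2
    -- the zero-temperature Glauber dynamics
    {Ω' : Type*} [mΩ' : MeasurableSpace Ω'] (Q : Config → Measure Ω')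
    (ℱ : Filtration ℝ≥0 mΩ') (X : ℝ≥0 → Ω' → Config) (hX : IsGlauberProcess Q ℱ X)
    -- the curve, the enclosed domain, and the point `φ t` of the curve
    (φ : ℝ → ℂ) (D : Set ℂ) (hφ : IsC2JordanCurve φ D) (t : ℝ)
    -- the random initial configurations
    (V : Set ℂ) (a b : ℝ) (f : ℝ → ℝ) (m : ℕ → ℤ)
    {Ω : Type*} [MeasurableSpace Ω] (P : ℕ → Measure Ω) [∀ N, IsProbabilityMeasure (P N)]
    (σ : ℕ → Ω → Config) (h : ℕ → Ω → ℤ → ℤ)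
    (hSpohn : SpohnInitialCondition (range φ) D (φ t) V a b f m P σ h)
    -- the reference points and the convergence in probability of the height
    (hm : ∀ᶠ N : ℕ in atTop, (m N : ℝ) / N ∈ Icc a b ∧ |a - (m N : ℝ) / N| ≤ 1 / N)
    (hconv : ∀ ε : ℝ, 0 < ε →
      Tendsto (fun N : ℕ => (P N).real {ω | ε ≤ |height N (h N ω) (m N) - f a|}) atTop (𝓝 0)) :
    -- for small radii the circle meets the curve in exactly two points
    (∀ᶠ r : ℝ in 𝓝[>] 0, ∃ x₀ x₁ : ℂ, IsCrossingPair φ t r x₀ x₁) ∧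
    ∀ x₀ x₁ : ℝ → ℂ, (∀ᶠ r : ℝ in 𝓝[>] 0, IsCrossingPair φ t r (x₀ r) (x₁ r)) →
      -- the initial drift, its average and its expectation are well defined
      (∀ r : ℝ, 0 < r → ∀ N : ℕ, 1 ≤ N → ∀ (η : Config) (α₁ α₂ : ℝ),
        Tendsto (driftQuotient Q X N η (region (φ t) r (x₀ r) (x₁ r) α₁ α₂)) (𝓝[>] 0)
          (𝓝 (drift Q X N η (region (φ t) r (x₀ r) (x₁ r) α₁ α₂)))) ∧
      (∀ r : ℝ, 0 < r → ∀ δ : ℝ, 0 < δ → ∀ N : ℕ, 1 ≤ N → ∀ η : Config,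
        IntegrableOn (fun p : ℝ × ℝ => drift Q X N η (region (φ t) r (x₀ r) (x₁ r) p.1 p.2))
          (Icc 0 δ ×ˢ Icc 0 δ)) ∧
      (∀ r : ℝ, 0 < r → ∀ δ : ℝ, 0 < δ → ∀ N : ℕ, 1 ≤ N →
        Integrable (fun ω => avgDrift Q X N (σ N ω) (φ t) r (x₀ r) (x₁ r) δ) (P N)) ∧
      -- the two triple limits; `lower r` and `upper r` are the limits as `δ → 0`
      ∃ lower upper : ℝ → EReal,
        (∀ᶠ r : ℝ in 𝓝[>] 0, Tendsto (fun δ : ℝ => liminf (fun N : ℕ =>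
            ((1 / (2 * r) * ∫ ω, avgDrift Q X N (σ N ω) (φ t) r (x₀ r) (x₁ r) δ ∂(P N) : ℝ) :
              EReal)) atTop) (𝓝[>] 0) (𝓝 (lower r))) ∧
        (∀ᶠ r : ℝ in 𝓝[>] 0, Tendsto (fun δ : ℝ => limsup (fun N : ℕ =>
            ((1 / (2 * r) * ∫ ω, avgDrift Q X N (σ N ω) (φ t) r (x₀ r) (x₁ r) δ ∂(P N) : ℝ) :
              EReal)) atTop) (𝓝[>] 0) (𝓝 (upper r))) ∧
        Tendsto lower (𝓝[>] 0) (𝓝 ((-curvature φ t /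
          (2 * (|Real.cos (deriv φ t).arg| + |Real.sin (deriv φ t).arg|) ^ 2) : ℝ) : EReal)) ∧
        Tendsto upper (𝓝[>] 0) (𝓝 ((-curvature φ t /
          (2 * (|Real.cos (deriv φ t).arg| + |Real.sin (deriv φ t).arg|) ^ 2) : ℝ) : EReal)) := by
  have hgraph : range φ ∩ V = graphSet f a b := hSpohn.graph
  have hdiff := hSpohn.differentiable
  have hV := hSpohn.mem_nhds
  refine ⟨hφ.eventually_exists_crossingPair hgraph hdiff hV hSpohn.monotone,
    fun x₀ x₁ hx => ⟨fun r _ N hN η α₁ α₂ => ?_, fun r _ δ _ N hN η => ?_,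
      fun r _ δ hδ N hN => ?_, ?_⟩⟩
  · have hfin := finite_meetingSites_region hN (φ t) r (x₀ r) (x₁ r) α₁ α₂
    rw [hX.drift_eq hN η hfin]
    exact hX.tendsto_driftQuotient hN η hfin
  · exact hX.integrableOn_drift hN η (φ t) r (x₀ r) (x₁ r) δ
  · exact hX.integrable_avgDrift (hSpohn.measurable_config N) hN (φ t) r (x₀ r) (x₁ r) hδ
  · obtain ⟨v, K, hlim, hbound⟩ := hSpohn.exists_mean_avgDrift_bound hX hφ hm hconv
    have hcr := hφ.eventually_graphCrossing hgraph hdiff hV hSpohn.monotone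
    -- The crossing abscissas are selected for every `r`, with a default value where none exist, so
    -- as to form functions of `r`.
    have hcr' : ∀ r, ∃ u : ℝ × ℝ, (∃ uL uR, IsGraphCrossing (range φ) f a b (φ t).re r uL uR) →
        IsGraphCrossing (range φ) f a b (φ t).re r u.1 u.2 := by
      intro r
      by_cases h1 : ∃ uL uR, IsGraphCrossing (range φ) f a b (φ t).re r uL uR
      · obtain ⟨uL, uR, h2⟩ := h1
        exact ⟨(uL, uR), fun _ => h2⟩
      · exact ⟨0, fun h2 => absurd h2 h1⟩
    choose u hu using hcr'
    have hu' : ∀ᶠ r in 𝓝[>] (0 : ℝ),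
        IsGraphCrossing (range φ) f a b (φ t).re r (u r).1 (u r).2 :=
      hcr.mono fun r hr => hu r hr
    have hG := EReal.tendsto_coe.2 (hlim (fun r => (u r).1) (fun r => (u r).2) hu')
    have hmain : ∀ᶠ r in 𝓝[>] (0 : ℝ), ∀ᶠ δ in 𝓝[>] (0 : ℝ), ∀ᶠ N : ℕ in atTop,
        |1 / (2 * r) * ∫ ω, avgDrift Q X N (σ N ω) (φ t) r (x₀ r) (x₁ r) δ ∂(P N) -
          v * ((cornerDensity f a b (u r).2 - cornerDensity f a b (u r).1) / r)| ≤ K / r * δ := by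
      filter_upwards [hbound, hx, hu'] with r h1 h2 h3 using h1 _ _ _ _ h2 h3
    -- At fixed `r` the lower and upper limits agree, so one function of `r` serves for both.
    exact ⟨_, _, hmain.mono fun r hr => (tendsto_liminf_limsup_of_abs_sub_le hr).1,
      hmain.mono fun r hr => (tendsto_liminf_limsup_of_abs_sub_le hr).2, hG, hG⟩
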